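/- \textbf{Definitions.} A \emph{partial commutative monoid} is a set $S$ with an element $0$ and a partial binary operation $+$ that is associative and commutative (if one side of $(a+b)+c=a+(b+c)$, resp. $a+b=b+a$, is defined, so is the other, and both are equal) and satisfies $a+0=a$. Its algebraic preordering is: $a\le b$ iff $a+x=b$ for some $x\in S$. Every commutative monoid is a partial commutative monoid. A homomorphism preserves $0$ and all defined sums. A \emph{lower embedding} is a one-to-one homomorphism $\varphi\colon A\to B$ such that $\varphi(x)\le\varphi(y)$ implies $x\le y$ and whose range is a lower subset of $B$ for the algebraic preordering. In $S$, write $a\perp b$ if $x\le a,b$ implies $x=0$; $X^\perp=\{s\in S: s\perp x\ \forall x\in X\}$ and $x^\perp=\{x\}^\perp$. An element $c$ is \emph{directly finite} if $x+c=c$ implies $x=0$; \emph{purely infinite} if $c+c=c$; \emph{multiple-free} if $x+x\le c$ (with $x+x$ defined) implies $x=0$. Let $S_{\mathrm{fin}}$ and $S_{\mathrm{mf}}$ be the sets of directly finite and of multiple-free elements. Write $a\ll_{\mathrm{rem}}b$ if $a\le b$ and, for all $x$ with $a+x$ defined, $b\le a+x$ implies $b\le x$. A \emph{projection} of $S$ is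 an endomorphism $p$ of $S$ such that each $x\in S$ is of the form $x=p(x)+y$ with $y\in(pS)^\perp$. The set $\mathbb B(S)$ of projections is ordered by: $p\le q$ iff $pq=qp=p$; $p^\perp$ denotes the projection with range $(pS)^\perp$ and $(p^\perp)^{-1}\{0\}=pS$. A \emph{continuous dimension scale} is a partial commutative monoid $S$ such that: (M1) $S$ has refinement (if $a_0+a_1=b_0+b_1$, there are $c_{ij}$ with $a_i=c_{i0}+c_{i1}$ and $b_j=c_{0j}+c_{1j}$) and $\le$ is antisymmetric; (M2) every nonempty subset of $S$ has an infimum; (M3) for all $x,y\in S$ there is a projection $p$ with $p(x)\le p(y)$ and $p^\perp(y)\le p^\perp(x)$; (M4) for all $a,b\in S$ there is a largest projection $p$ with $p(a)\le p(b)$; (M5) every element is the sum of a directly finite and a purely infinite element; (M6) if $a,b$ are purely infinite and $a\ll_{\mathrm{rem}}b$, then the set of all purely infinite $x$ with $a\ll_{\mathrm{rem}}x$ and $x^\perp=b^\perp$ has a least element. A \emph{finitary unit} of $S$ is a set $E\subseteq S_{\mathrm{fin}}\setminus\{0\}$ of pairwise orthogonal elements such that no nonzero element of $S_{\mathrm{fin}}$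 is orthogonal to all elements of $E$, and such that each $e\in E$ either is multiple-free or has no nonzero multiple-free element below it. Put $S_{\mathrm I}=S_{\mathrm{mf}}^{\perp\perp}$, $S_{\mathrm{II}}=S_{\mathrm{mf}}^{\perp}\cap S_{\mathrm{fin}}^{\perp\perp}$, $S_{\mathrm{III}}=S_{\mathrm{fin}}^{\perp}$. Let $\Omega$ be the ultrafilter space of the Boolean algebra $\mathbb B(S)$, with basic open sets $\Omega_p=\{\mathfrak a\in\Omega: p\in\mathfrak a\}$, and for $i\in\{\mathrm I,\mathrm{II},\mathrm{III}\}$ let $\Omega_i=\Omega_{p_i}$, where $p_i$ is the projection of $S$ onto $S_i$. Let $\mathbb Z_\infty=\mathbb Z^+\cup\{\aleph_\xi:\xi\text{ an ordinal}\}$, $\mathbb R_\infty=\mathbb R^+\cup\{\aleph_\xi:\xi\text{ an ordinal}\}$, $\mathbf 2_\infty=\{0\}\cup\{\aleph_\xi:\xi\text{ an ordinal}\}$ (where $\mathbb Z^+$, $\mathbb R^+$ contain $0$), with the natural total ordering, the interval topology, and the addition that extends the addition of the finite elements, with $\aleph_\xi+\aleph_\eta=\aleph_{\max(\xi,\eta)}$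 and every finite element absorbed by every aleph. Let $\mathbf C(\Omega_{\mathrm I},\mathbb Z_\infty;\Omega_{\mathrm{II}},\mathbb R_\infty;\Omega_{\mathrm{III}},\mathbf 2_\infty)$ be the commutative monoid, under pointwise addition, of all maps on $\Omega$ whose restrictions to $\Omega_{\mathrm I}$, $\Omega_{\mathrm{II}}$, $\Omega_{\mathrm{III}}$ are continuous maps to $\mathbb Z_\infty$, $\mathbb R_\infty$, $\mathbf 2_\infty$, respectively. For a map $f$ on $\Omega$ and $U\subseteq\Omega$, $f\rfloor_U$ agrees with $f$ on $U$ and is $0$ elsewhere. \textbf{Theorem.} Let $S$ be a continuous dimension scale and let $E$ be a finitary unit of $S$. Then there exists a unique lower embedding \[\varepsilon\colon S\hookrightarrow\mathbf C(\Omega_{\mathrm I},\mathbb Z_\infty;\Omega_{\mathrm{II}},\mathbb R_\infty;\Omega_{\mathrm{III}},\mathbf 2_\infty)\] such that $\varepsilon(p(x))=\varepsilon(x)\rfloor_{\Omega_p}$ for all $x\in S$ and all projections $p$ of $S$, and $\varepsilon(e)$ takes its values in $\{0,1\}$ for all $e\in E\cap S_{\mathrm{II}}$. Furthermore, this embedding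 satisfies that $\varepsilon(e)$ takes its values in $\{0,1\}$ for all $e\in E$. -/

import Mathlib

open scoped NNReal

universe u

namespace DimScale

/-! ## Partial commutative monoids -/

/-- A partial commutative monoid. The partial addition takes values in `Option S`:
`padd a b = some c` means that `a + b` is defined and equal to `c`, and `padd a b = none` means
that `a + b` is undefined. -/
class PartialCommMonoid (S : Type*) extends Zero S where
  /-- the partial addition -/
  padd : S → S → Option S
  /-- `(a + b) + c` is defined iff `a + (b + c)` is, and then both are equal -/
  padd_assoc : ∀ a b c : S,
    ((padd a b).bind fun s => padd s c) = ((padd b c).bind fun t => padd a t)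
  /-- `a + b` is defined iff `b + a` is, and then both are equal -/
  padd_comm : ∀ a b : S, padd a b = padd b a
  /-- `a + 0` is defined and equal to `a` -/
  padd_zero : ∀ a : S, padd a 0 = some a

/-- `IsSum a b c`: the sum `a + b` is defined and equal to `c`. -/
def IsSum {S : Type*} [PartialCommMonoid S] (a b c : S) : Prop :=
  PartialCommMonoid.padd a b = some c

/-- A (total) commutative monoid is a partial commutative monoid. -/
instance instPartialCommMonoidOfAddCommMonoid (M : Type*) [AddCommMonoid M] :
    PartialCommMonoid M where
  padd a b := some (a + b)
  padd_assoc a b c := by simp [add_assoc]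
  padd_comm a b := by simp [add_comm]
  padd_zero a := by simp

/-- The algebraic preordering: `a ≤ b` iff `a + x = b` for some `x`. -/
def AlgLE {S : Type*} [PartialCommMonoid S] (a b : S) : Prop := ∃ x : S, IsSum a x b

/-- Homomorphisms of partial commutative monoids. -/
structure IsHom {A B : Type*} [PartialCommMonoid A] [PartialCommMonoid B] (φ : A → B) : Prop where
  map_zero : φ 0 = 0
  map_add : ∀ a b c : A, IsSum a b c → IsSum (φ a) (φ b) (φ c)

/-- Lower embeddings: homomorphisms that are one-to-one, reflect the algebraic preordering, and
whose range is a lower subset of the codomain for the algebraic preordering. -/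
structure IsLowerEmbedding {A B : Type*} [PartialCommMonoid A] [PartialCommMonoid B]
    (φ : A → B) : Prop where
  isHom : IsHom φ
  injective : Function.Injective φ
  le_of_map_le : ∀ x y : A, AlgLE (φ x) (φ y) → AlgLE x y
  range_lower : ∀ (b : B) (a : A), AlgLE b (φ a) → b ∈ Set.range φ

section Notions

variable {S : Type*} [PartialCommMonoid S]

/-- The refinement property. -/
def HasRefinement (S : Type*) [PartialCommMonoid S] : Prop :=
  ∀ a₀ a₁ b₀ b₁ s : S, IsSum a₀ a₁ s → IsSum b₀ b₁ s →
    ∃ c₀₀ c₀₁ c₁₀ c₁₁ : S,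
      IsSum c₀₀ c₀₁ a₀ ∧ IsSum c₁₀ c₁₁ a₁ ∧ IsSum c₀₀ c₁₀ b₀ ∧ IsSum c₀₁ c₁₁ b₁

/-- Orthogonality: the only common lower bound of `a` and `b` is `0`. -/
def Orth (a b : S) : Prop := ∀ x : S, AlgLE x a → AlgLE x b → x = 0

/-- `X^⊥`, the set of the elements that are orthogonal to all elements of `X`. -/
def perp (X : Set S) : Set S := {s | ∀ x ∈ X, Orth s x}

/-- `c` is directly finite: `x + c = c` implies `x = 0`. -/
def DirectlyFinite (c : S) : Prop := ∀ x : S, IsSum x c c → x = 0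

/-- `a` is purely infinite: `a + a = a`. -/
def PurelyInfinite (a : S) : Prop := IsSum a a a

/-- `a` is multiple-free: `2x ≤ a` (with `2x` defined) implies `x = 0`. -/
def MultipleFree (a : S) : Prop := ∀ x s : S, IsSum x x s → AlgLE s a → x = 0

/-- `a` is removable from `b`: `a ≤ b`, and `b ≤ a + x` (with `a + x` defined) implies `b ≤ x`. -/
def Removable (a b : S) : Prop :=
  AlgLE a b ∧ ∀ x s : S, IsSum a x s → AlgLE b s → AlgLE b x

/-- The set of directly finite elements. -/
def finSet (S : Type*) [PartialCommMonoid S] : Set S := {a | DirectlyFinite a}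

/-- The set of multiple-free elements. -/
def mfSet (S : Type*) [PartialCommMonoid S] : Set S := {a | MultipleFree a}

/-! ## Projections -/

/-- A projection: an endomorphism `p` such that `x ∈ p(x) + (pS)^⊥` for all `x`. -/
structure Projection (S : Type*) [PartialCommMonoid S] where
  /-- the underlying map -/
  toFun : S → S
  isHom : IsHom toFun
  split : ∀ x : S, ∃ y ∈ perp (Set.range toFun), IsSum (toFun x) y x

instance : CoeFun (Projection S) fun _ => S → S := ⟨Projection.toFun⟩

theorem Projection.idem (p : Projection S) (x : S) : p (p x) = p x := by
  obtain ⟨y, hy, hs⟩ := p.split (p x)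
  have hy0 : y = 0 := hy (p x) ⟨x, rfl⟩ y
    ⟨0, PartialCommMonoid.padd_zero y⟩
    ⟨p (p x), by
      have h := hs
      unfold IsSum at h ⊢
      rw [PartialCommMonoid.padd_comm]
      exact h⟩
  subst hy0
  have h := hs
  unfold IsSum at h
  rw [PartialCommMonoid.padd_zero] at h
  exact Option.some.inj h

theorem Projection.ext_fun {p q : Projection S} (h : ∀ x, p x = q x) : p = q := by
  cases p; cases q
  congr
  exact funext h

/-- The ordering of projections: `p ≤ q` iff the infimum `p ∧ q = pq = qp` equals `p`. -/
instance : PartialOrder (Projection S) where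
  le p q := ∀ x, p (q x) = p x ∧ q (p x) = p x
  le_refl p x := ⟨p.idem x, p.idem x⟩
  le_trans p q r hpq hqr x := by
    refine ⟨?_, ?_⟩
    · rw [← (hpq (r x)).1, (hqr x).1, (hpq x).1]
    · rw [← (hpq x).2, (hqr (p x)).2]
  le_antisymm p q hpq hqp := Projection.ext_fun fun x => by
    rw [← (hpq x).1, (hqp x).2]

/-- `q = p^⊥`: the projection with range `(pS)^⊥` that vanishes exactly on `pS`. -/
def IsOrthocomplement (p q : Projection S) : Prop :=
  Set.range q = perp (Set.range p) ∧ {x | q x = 0} = Set.range p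

/-- General comparability. -/
def GeneralComparability (S : Type*) [PartialCommMonoid S] : Prop :=
  ∀ x y : S, ∃ p q : Projection S, IsOrthocomplement p q ∧ AlgLE (p x) (p y) ∧ AlgLE (q y) (q x)

/-- For all `a`, `b` there is a largest projection `p` such that `p(a) ≤ p(b)`. -/
def BooleanValued (S : Type*) [PartialCommMonoid S] : Prop :=
  ∀ a b : S, ∃ p : Projection S, IsGreatest {q : Projection S | AlgLE (q a) (q b)} p

/-! ## Continuous dimension scales -/

/-- Continuous dimension scales. -/
structure IsContinuousDimensionScale (S : Type*) [PartialCommMonoid S] : Prop where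
  refinement : HasRefinement S
  antisymm : ∀ a b : S, AlgLE a b → AlgLE b a → a = b
  exists_inf : ∀ X : Set S, X.Nonempty →
    ∃ a : S, (∀ x ∈ X, AlgLE a x) ∧ ∀ b : S, (∀ x ∈ X, AlgLE b x) → AlgLE b a
  generalComparability : GeneralComparability S
  booleanValued : BooleanValued S
  exists_decomp : ∀ a : S, ∃ x y : S, IsSum x y a ∧ DirectlyFinite x ∧ PurelyInfinite y
  exists_least : ∀ a b : S, PurelyInfinite a → PurelyInfinite b → Removable a b →
    ∃ c : S, (PurelyInfinite c ∧ Removable a c ∧ perp {c} = perp {b}) ∧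
      ∀ x : S, PurelyInfinite x → Removable a x → perp {x} = perp {b} → AlgLE c x

/-- A finitary unit: a maximal antichain `E` of nonzero directly finite elements such that each
`e ∈ E` either is multiple-free or has no nonzero multiple-free element below it. -/
structure IsFinitaryUnit (E : Set S) : Prop where
  subset_fin : E ⊆ finSet S
  zero_notMem : (0 : S) ∉ E
  orth : ∀ a ∈ E, ∀ b ∈ E, a ≠ b → Orth a b
  maximal : ∀ a ∈ finSet S, a ≠ 0 → ∃ e ∈ E, ¬ Orth a e
  pure : ∀ e ∈ E, MultipleFree e ∨ ∀ x : S, AlgLE x e → MultipleFree x → x = 0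

/-! ## Types I, II, III and the ultrafilter space -/

/-- `S_I = (S_mf)^⊥⊥`. -/
def typeI (S : Type*) [PartialCommMonoid S] : Set S := perp (perp (mfSet S))

/-- `S_II = (S_mf)^⊥ ∩ (S_fin)^⊥⊥`. -/
def typeII (S : Type*) [PartialCommMonoid S] : Set S := perp (mfSet S) ∩ perp (perp (finSet S))

/-- `S_III = (S_fin)^⊥`. -/
def typeIII (S : Type*) [PartialCommMonoid S] : Set S := perp (finSet S)

/-- The set `Ω` of ultrafilters (maximal proper filters) of the Boolean algebra of projections. -/
def UltrafilterSpace (S : Type*) [PartialCommMonoid S] : Type _ :=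
  {F : Order.PFilter (Projection S) //
    Maximal (fun G : Order.PFilter (Projection S) => (G : Set (Projection S)) ≠ Set.univ) F}

/-- `Ω_p`, the set of ultrafilters that contain `p`. -/
def basicSet (p : Projection S) : Set (UltrafilterSpace S) := {F | p ∈ F.1}

/-- The Stone topology: the sets `Ω_p` form a basis. -/
instance : TopologicalSpace (UltrafilterSpace S) :=
  TopologicalSpace.generateFrom (Set.range (basicSet : Projection S → Set (UltrafilterSpace S)))

/-- `Ω_p` for the projection `p` of `S` onto `X`, such as `Ω_I` for `X = S_I`. -/
def summandSet (X : Set S) : Set (UltrafilterSpace S) :=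
  {F | ∃ p : Projection S, Set.range p = X ∧ F ∈ basicSet p}

end Notions

/-! ## Adjoining the alephs to a totally ordered monoid -/

/-- The set `F` of finite elements together with all alephs `ℵ_ξ`, `ξ` an ordinal. -/
inductive AlephExt (F : Type) : Type (u + 1)
  | fin : F → AlephExt F
  | aleph : Ordinal.{u} → AlephExt F

namespace AlephExt

variable {F : Type}

/-- `AlephExt F` as a lexicographic sum. -/
def toSum : AlephExt.{u} F → F ⊕ₗ Ordinal.{u}
  | fin a => toLex (Sum.inl a)
  | aleph α => toLex (Sum.inr α)

theorem toSum_injective : Function.Injective (toSum (F := F)) := by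
  rintro (a | α) (b | β) h <;> simp [toSum] at h <;> simp [h]

/-- The natural total ordering: finite elements lie below all alephs. -/
noncomputable instance [LinearOrder F] : LinearOrder (AlephExt.{u} F) :=
  LinearOrder.lift' toSum toSum_injective

/-- The interval topology, which for a total ordering is the order topology. -/
noncomputable instance [LinearOrder F] : TopologicalSpace (AlephExt.{u} F) := Preorder.topology _

instance [LinearOrder F] : OrderTopology (AlephExt.{u} F) := ⟨rfl⟩

section Order

variable [LinearOrder F]

@[simp] theorem fin_le_fin {a b : F} : (fin a : AlephExt.{u} F) ≤ fin b ↔ a ≤ b :=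
  Sum.Lex.inl_le_inl_iff

@[simp] theorem aleph_le_aleph {α β : Ordinal.{u}} : (aleph α : AlephExt F) ≤ aleph β ↔ α ≤ β :=
  Sum.Lex.inr_le_inr_iff

@[simp] theorem fin_lt_fin {a b : F} : (fin a : AlephExt.{u} F) < fin b ↔ a < b :=
  Sum.Lex.inl_lt_inl_iff

@[simp] theorem aleph_lt_aleph {α β : Ordinal.{u}} : (aleph α : AlephExt F) < aleph β ↔ α < β :=
  Sum.Lex.inr_lt_inr_iff

@[simp] theorem fin_lt_aleph (a : F) (α : Ordinal.{u}) : (fin a : AlephExt F) < aleph α :=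
  Sum.Lex.inl_lt_inr _ _

@[simp] theorem not_aleph_lt_fin (a : F) (α : Ordinal.{u}) : ¬ (aleph α : AlephExt F) < fin a :=
  (fin_lt_aleph a α).asymm

end Order

/-- The addition extends the addition of `F`, satisfies `ℵ_α + ℵ_β = ℵ_(max α β)`, and each aleph
absorbs all finite elements. -/
noncomputable instance [Add F] : Add (AlephExt.{u} F) where
  add
    | fin a, fin b => fin (a + b)
    | fin _, aleph β => aleph β
    | aleph α, fin _ => aleph α
    | aleph α, aleph β => aleph (max α β)

@[simp] theorem fin_add_fin [Add F] (a b : F) : (fin a + fin b : AlephExt.{u} F) = fin (a + b) :=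
  rfl

@[simp] theorem fin_add_aleph [Add F] (a : F) (β : Ordinal.{u}) :
    (fin a + aleph β : AlephExt F) = aleph β := rfl

@[simp] theorem aleph_add_fin [Add F] (α : Ordinal.{u}) (b : F) :
    (aleph α + fin b : AlephExt F) = aleph α := rfl

@[simp] theorem aleph_add_aleph [Add F] (α β : Ordinal.{u}) :
    (aleph α + aleph β : AlephExt F) = aleph (max α β) := rfl

instance [Zero F] : Zero (AlephExt.{u} F) := ⟨fin 0⟩

noncomputable instance [AddCommMonoid F] : AddCommMonoid (AlephExt.{u} F) where
  add_assoc := by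
    rintro (a | α) (b | β) (c | γ) <;> simp [add_assoc, max_assoc]
  zero_add := by
    rintro (a | α)
    · exact congrArg fin (zero_add a)
    · rfl
  add_zero := by
    rintro (a | α)
    · exact congrArg fin (add_zero a)
    · rfl
  add_comm := by
    rintro (a | α) (b | β) <;> simp [add_comm, max_comm]
  nsmul := nsmulRec

/-- The map induced by a map between the finite elements, which fixes the alephs. -/
def map {G : Type} (φ : F → G) : AlephExt.{u} F → AlephExt.{u} G
  | fin a => fin (φ a)
  | aleph α => aleph α

theorem map_zero' {G : Type} [AddCommMonoid F] [AddCommMonoid G] (φ : F →+ G) :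
    map φ (0 : AlephExt.{u} F) = 0 := congrArg fin (φ.map_zero)

theorem map_add' {G : Type} [AddCommMonoid F] [AddCommMonoid G] (φ : F →+ G)
    (x y : AlephExt.{u} F) : map φ (x + y) = map φ x + map φ y := by
  rcases x with a | α <;> rcases y with b | β <;> simp [map]

section Topology

variable [LinearOrder F]

theorem range_fin : Set.range (fin : F → AlephExt.{u} F) = Set.Iio (aleph 0) := by
  ext x
  rcases x with a | α <;> simp

theorem isOpenEmbedding_fin [TopologicalSpace F] [OrderTopology F] :
    Topology.IsOpenEmbedding (fin : F → AlephExt.{u} F) := by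
  refine ⟨StrictMono.isEmbedding_of_ordConnected (fun a b h => fin_lt_fin.2 h) ?_, ?_⟩
  · rw [range_fin]; exact Set.ordConnected_Iio
  · rw [range_fin]; exact isOpen_Iio

theorem add_lt_aleph [Add F] {x y : AlephExt.{u} F} {γ : Ordinal.{u}} (hx : x < aleph γ)
    (hy : y < aleph γ) : x + y < aleph γ := by
  rcases x with a | α <;> rcases y with b | β <;> simp_all

variable [AddCommMonoid F] [CanonicallyOrderedAdd F]

theorem le_add_left' (x y : AlephExt.{u} F) : x ≤ x + y := by
  rcases x with a | α <;> rcases y with b | β <;> simp [(fin_lt_aleph _ _).le]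

theorem tendsto_add_aleph {x y : AlephExt.{u} F} {δ : Ordinal.{u}} (h : x + y = aleph δ) :
    Filter.Tendsto (fun z : AlephExt.{u} F × AlephExt.{u} F => z.1 + z.2) (nhds (x, y))
      (nhds (aleph δ)) := by
  have hx : x ≤ aleph δ := h ▸ le_add_left' x y
  have hy : y ≤ aleph δ := by rw [← h, add_comm]; exact le_add_left' y x
  have hxy : x = aleph δ ∨ y = aleph δ := by
    rcases x with a | α <;> rcases y with b | β <;> simp_all
    rcases le_total α β with h' | h' <;> simp_all
  have c1 : Filter.Tendsto (fun z : AlephExt.{u} F × AlephExt.{u} F => z.1) (nhds (x, y))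
      (nhds x) := continuous_fst.continuousAt
  have c2 : Filter.Tendsto (fun z : AlephExt.{u} F × AlephExt.{u} F => z.2) (nhds (x, y))
      (nhds y) := continuous_snd.continuousAt
  rw [tendsto_order]
  refine ⟨fun c hc => ?_, fun c hc => ?_⟩
  · rcases hxy with e | e
    · filter_upwards [c1.eventually (lt_mem_nhds (e ▸ hc))] with z hz
      exact lt_of_lt_of_le hz (le_add_left' _ _)
    · filter_upwards [c2.eventually (lt_mem_nhds (e ▸ hc))] with z hz
      rw [add_comm]
      exact lt_of_lt_of_le hz (le_add_left' _ _)
  · rcases c with c | γ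
    · exact absurd hc (not_aleph_lt_fin _ _)
    · filter_upwards [c1.eventually (gt_mem_nhds (hx.trans_lt hc)),
        c2.eventually (gt_mem_nhds (hy.trans_lt hc))] with z h1 h2
      exact add_lt_aleph h1 h2

instance [TopologicalSpace F] [OrderTopology F] [ContinuousAdd F] :
    ContinuousAdd (AlephExt.{u} F) where
  continuous_add := by
    rw [continuous_iff_continuousAt]
    rintro ⟨x, y⟩
    rcases h : x + y with c | δ
    · rcases x with a | α <;> rcases y with b | β <;> simp at h
      have hp := (isOpenEmbedding_fin.{u} (F := F)).prodMap (isOpenEmbedding_fin.{u} (F := F))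
      have := hp.continuousAt_iff (g := fun z : AlephExt.{u} F × AlephExt.{u} F => z.1 + z.2)
        (x := (a, b))
      refine this.1 ?_
      have hc : Continuous fun z : F × F => (fin (z.1 + z.2) : AlephExt.{u} F) :=
        isOpenEmbedding_fin.continuous.comp continuous_add
      exact hc.continuousAt
    · have := tendsto_add_aleph h
      rw [← h] at this
      exact this

end Topology

end AlephExt

/-- `ℤ_∞`: the natural numbers and all alephs. -/
abbrev ZInf : Type (u + 1) := AlephExt.{u} ℕ

/-- `ℝ_∞`: the nonnegative reals and all alephs. -/
abbrev RInf : Type (u + 1) := AlephExt.{u} ℝ≥0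

/-- `2_∞`: zero and all alephs. -/
abbrev TwoInf : Type (u + 1) := AlephExt.{u} PUnit.{1}

/-- The inclusion of `ℤ_∞` into `ℝ_∞`. -/
noncomputable def ZInf.toRInf : ZInf.{u} → RInf.{u} := AlephExt.map (Nat.castAddMonoidHom ℝ≥0)

/-- The inclusion of `2_∞` into `ℝ_∞`. -/
noncomputable def TwoInf.toRInf : TwoInf.{u} → RInf.{u} :=
  AlephExt.map (0 : PUnit.{1} →+ ℝ≥0)

instance : OrderTopology PUnit.{1} where
  topology_eq_generate_intervals := Subsingleton.elim _ _

/-- `C(Ω₁, ℤ_∞; Ω₂, ℝ_∞; Ω₃, 2_∞)`: the maps on `Ω`, with values in the union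
`ℤ_∞ ∪ ℝ_∞ ∪ 2_∞ = ℝ_∞`, whose restrictions to `Ω₁`, `Ω₂` and `Ω₃` are continuous maps to
`ℤ_∞`, `ℝ_∞` and `2_∞`, respectively. It is a commutative monoid under pointwise addition. -/
noncomputable def mixedC {Ω : Type*} [TopologicalSpace Ω] (Ω₁ Ω₂ Ω₃ : Set Ω) :
    AddSubmonoid (Ω → RInf.{u}) where
  carrier := {f |
    (∃ g : C(Ω₁, ZInf.{u}), ∀ ω : Ω₁, f ω = (g ω).toRInf) ∧
    (∃ g : C(Ω₂, RInf.{u}), ∀ ω : Ω₂, f ω = g ω) ∧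
    (∃ g : C(Ω₃, TwoInf.{u}), ∀ ω : Ω₃, f ω = (g ω).toRInf)}
  zero_mem' := ⟨⟨0, fun _ => (AlephExt.map_zero' _).symm⟩, ⟨0, fun _ => rfl⟩,
    ⟨0, fun _ => (AlephExt.map_zero' _).symm⟩⟩
  add_mem' := by
    rintro f f' ⟨⟨g₁, h₁⟩, ⟨g₂, h₂⟩, ⟨g₃, h₃⟩⟩ ⟨⟨g₁', h₁'⟩, ⟨g₂', h₂'⟩, ⟨g₃', h₃'⟩⟩
    refine ⟨⟨g₁ + g₁', fun ω => ?_⟩, ⟨g₂ + g₂', fun ω => ?_⟩, ⟨g₃ + g₃', fun ω => ?_⟩⟩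
    · rw [Pi.add_apply, h₁, h₁']; exact (AlephExt.map_add' _ _ _).symm
    · rw [Pi.add_apply, h₂, h₂']; rfl
    · rw [Pi.add_apply, h₃, h₃']; exact (AlephExt.map_add' _ _ _).symm

/-- `C(Ω_I, ℤ_∞; Ω_II, ℝ_∞; Ω_III, 2_∞)` for the ultrafilter space `Ω` of the Boolean algebra of
projections of `S`. Here `S` is a set of the universe `u` and the alephs are those indexed by the
ordinals of that universe. -/
noncomputable abbrev ScaleFunctions (S : Type u) [PartialCommMonoid S] :
    AddSubmonoid (UltrafilterSpace S → RInf.{u}) :=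
  mixedC.{u} (summandSet (typeI S)) (summandSet (typeII S)) (summandSet (typeIII S))

/-- The embeddings under consideration: lower embeddings `ε` with `ε(p(x)) = ε(x)⌋_{Ω_p}` for all
`x` and all projections `p`, and with `ε(e)` taking values in `{0, 1}` for `e ∈ E ∩ S_II`. -/
structure IsAdmissibleEmbedding {S : Type u} [PartialCommMonoid S] (E : Set S)
    (ε : S → ScaleFunctions S) : Prop where
  isLowerEmbedding : IsLowerEmbedding ε
  map_projection : ∀ (x : S) (p : Projection S),
    (ε (p x) : UltrafilterSpace S → RInf.{u}) = (basicSet p).indicator (ε x)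
  values : ∀ e ∈ E ∩ typeII S, ∀ ω : UltrafilterSpace S,
    (ε e : UltrafilterSpace S → RInf.{u}) ω ∈ ({0, AlephExt.fin 1} : Set RInf.{u})

end DimScale

set_option linter.unusedSectionVars false

namespace DimScale

/-! The projections form a complete Boolean algebra with Stone space `Ω`, and all arguments are
local over it. Conditions (M3) and (M4) give each comparison `x ≤ y` a Boolean truth value `leProj x
y`, with `leProj x y ⊔ leProj y x = ⊤`. Hence at each ultrafilter any two elements are comparable.
By (M5), `infProj a` separates the purely infinite part of `a` from its directly finite part, and
the two parts are measured in different ways.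

Purely infinite elements get an ordinal rank for the local strict order; the rank is defined with
Boolean values. (M6) makes a strict lower bound of a family strictly below its infimum, so infima
preserve the property of having rank at least `ξ` (`le_rankProj_of_isGLB`). The ordinals of the
universe do not inject into `S → Projection S`, so the ranks stabilize. A minimal element at the
stable rank then shows that no element has unbounded rank on a nonzero projection
(`eq_bot_of_forall_le_succProj`). Rank `ξ` becomes the value `ℵ_ξ`.

Directly finite elements are cancellative and archimedean, so they can be measured against the unit
`E`: count how often a unit fits into `a`. On type I the units are multiple-free, remainders vanish,
and the count is additive. On type II units can be halved indefinitely, and the counts of `2^n`-th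
parts, divided by `2^n`, converge to an additive value. On type III there are no nonzero directly
finite elements.

The resulting map `scaleFun` reflects the order, because a strict local inequality stays strict
between the values on some nonzero projection (`exists_scaleFun_lt`). Its range is lower: a function
`f` below `scaleFun b` is the value of the supremum of all `c ≤ b` whose value is at most `f`
(`exists_scaleFun_eq`).

For uniqueness, the lower range of an admissible embedding supplies enough elements with prescribed
values. These force the alephs by induction on the ordinal (`aleph_le`) and force multiple-free
units to be at most `1` (`le_one_of_multipleFree`). Finite values are then squeezed between
multiples of parts of units (`le_of_finite`). Two admissible embeddings agree on a dense set, hence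
everywhere by continuity. -/

/-! ## The total monoid of a partial commutative monoid -/

/-- `S` together with an absorbing element, the value of the undefined sums. -/
def Ext (S : Type*) : Type _ := Option S

namespace Ext

variable {S : Type*}

/-- The inclusion of `S` into `Ext S`. -/
@[coe] def of (a : S) : Ext S := some a

instance : Coe S (Ext S) := ⟨of⟩

/-- The value of the undefined sums. -/
def undef : Ext S := (none : Option S)

theorem of_injective : Function.Injective (of : S → Ext S) := fun _ _ h => Option.some.inj h

@[simp] theorem of_inj {a b : S} : (a : Ext S) = b ↔ a = b := of_injective.eq_iff

theorem of_ne_undef (a : S) : (a : Ext S) ≠ undef := Option.some_ne_none a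

theorem cases_of (x : Ext S) : x = undef ∨ ∃ a : S, x = a := by
  cases x with
  | none => exact Or.inl rfl
  | some a => exact Or.inr ⟨a, rfl⟩

variable [PartialCommMonoid S]

instance : Add (Ext S) :=
  ⟨fun x y => Option.bind x fun a => Option.bind y fun b => PartialCommMonoid.padd a b⟩

instance : Zero (Ext S) := ⟨((0 : S) : Ext S)⟩

theorem undef_add (x : Ext S) : undef + x = undef := rfl

theorem add_undef (x : Ext S) : x + undef = undef := by
  rcases cases_of x with rfl | ⟨a, rfl⟩ <;> rfl

instance : AddCommMonoid (Ext S) where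
  add_assoc x y z := by
    rcases cases_of x with rfl | ⟨a, rfl⟩
    · simp only [undef_add]
    rcases cases_of y with rfl | ⟨b, rfl⟩
    · simp only [undef_add, add_undef]
    rcases cases_of z with rfl | ⟨c, rfl⟩
    · simp only [add_undef]
    exact PartialCommMonoid.padd_assoc a b c
  add_comm x y := by
    rcases cases_of x with rfl | ⟨a, rfl⟩
    · simp only [undef_add, add_undef]
    rcases cases_of y with rfl | ⟨b, rfl⟩
    · simp only [undef_add, add_undef]
    exact PartialCommMonoid.padd_comm a b
  zero_add x := by
    rcases cases_of x with rfl | ⟨a, rfl⟩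
    · exact add_undef _
    · exact (PartialCommMonoid.padd_comm 0 a).trans (PartialCommMonoid.padd_zero a)
  add_zero x := by
    rcases cases_of x with rfl | ⟨a, rfl⟩
    · rfl
    · exact PartialCommMonoid.padd_zero a
  nsmul := nsmulRec

@[simp] theorem of_zero : ((0 : S) : Ext S) = 0 := rfl

theorem isSum_iff {a b c : S} : IsSum a b c ↔ (a + b : Ext S) = c := Iff.rfl

theorem exists_of_add_eq {x y : Ext S} {c : S} (h : x + y = c) :
    ∃ a b : S, x = a ∧ y = b := by
  rcases cases_of x with rfl | ⟨a, rfl⟩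
  · rw [undef_add] at h
    exact absurd h.symm (of_ne_undef c)
  rcases cases_of y with rfl | ⟨b, rfl⟩
  · rw [add_undef] at h
    exact absurd h.symm (of_ne_undef c)
  exact ⟨a, b, rfl, rfl⟩

end Ext

/-! ### The algebraic ordering, with infima and suprema -/

section Basic

variable {S : Type u} [PartialCommMonoid S] [hS : Fact (IsContinuousDimensionScale S)]

/-- The algebraic ordering. -/
instance instPartialOrderExt : PartialOrder (Ext S) where
  le x y := ∃ z, x + z = y
  le_refl x := ⟨0, add_zero x⟩
  le_trans := by
    rintro x _ _ ⟨a, rfl⟩ ⟨b, rfl⟩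
    exact ⟨a + b, (add_assoc _ _ _).symm⟩
  le_antisymm x y := by
    rintro ⟨a, ha⟩ ⟨b, hb⟩
    rcases Ext.cases_of x with rfl | ⟨x, rfl⟩
    · rw [← ha, Ext.undef_add]
    obtain ⟨y, b, rfl, rfl⟩ := Ext.exists_of_add_eq hb
    obtain ⟨_, a, -, rfl⟩ := Ext.exists_of_add_eq ha
    exact congrArg _ (hS.1.antisymm _ _ ⟨a, ha⟩ ⟨b, hb⟩)

instance instIsOrderedAddMonoidExt : IsOrderedAddMonoid (Ext S) where
  add_le_add_left := by
    rintro x _ ⟨a, rfl⟩ c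
    exact ⟨a, by abel⟩

instance instCanonicallyOrderedAddExt : CanonicallyOrderedAdd (Ext S) where
  exists_add_of_le := by
    rintro x _ ⟨a, rfl⟩
    exact ⟨a, rfl⟩
  le_self_add x y := ⟨y, rfl⟩
  le_add_self x y := ⟨y, add_comm _ _⟩

instance instPartialOrder : PartialOrder S := PartialOrder.lift Ext.of Ext.of_injective

theorem Ext.of_le_of {a b : S} : (a : Ext S) ≤ b ↔ a ≤ b := Iff.rfl

theorem le_iff_exists {a b : S} : a ≤ b ↔ ∃ c : S, (a + c : Ext S) = b := by
  constructor
  · rintro ⟨z, hz⟩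
    obtain ⟨_, c, -, rfl⟩ := Ext.exists_of_add_eq hz
    exact ⟨c, hz⟩
  · rintro ⟨c, hc⟩
    exact ⟨c, hc⟩

theorem algLE_iff {a b : S} : AlgLE a b ↔ a ≤ b := le_iff_exists.symm

theorem Ext.exists_of_le {x : Ext S} {c : S} (h : x ≤ c) : ∃ a : S, x = a ∧ a ≤ c := by
  obtain ⟨z, hz⟩ := h
  obtain ⟨a, b, rfl, rfl⟩ := Ext.exists_of_add_eq hz
  exact ⟨a, rfl, b, hz⟩

protected theorem zero_le (a : S) : (0 : S) ≤ a := Ext.of_le_of.1 (zero_le (a := (a : Ext S)))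

theorem eq_zero_of_le_zero {a : S} (h : a ≤ 0) : a = 0 := le_antisymm h (DimScale.zero_le a)

theorem le_of_add_eq {a b c : S} (h : (a + b : Ext S) = c) : a ≤ c := ⟨b, h⟩

theorem le_of_add_eq' {a b c : S} (h : (a + b : Ext S) = c) : b ≤ c :=
  ⟨a, (add_comm _ _).trans h⟩

theorem exists_isGLB {X : Set S} (hX : X.Nonempty) : ∃ a, IsGLB X a := by
  obtain ⟨a, h1, h2⟩ := hS.1.exists_inf X hX
  exact ⟨a, fun x hx => algLE_iff.1 (h1 x hx),
    fun b hb => algLE_iff.1 (h2 b fun x hx => algLE_iff.2 (hb hx))⟩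

theorem exists_isLUB {X : Set S} (hX : BddAbove X) : ∃ a, IsLUB X a := by
  obtain ⟨a, ha⟩ := exists_isGLB hX
  exact ⟨a, isGLB_upperBounds.1 ha⟩

theorem refinement {a₀ a₁ b₀ b₁ s : S} (ha : (a₀ + a₁ : Ext S) = s) (hb : (b₀ + b₁ : Ext S) = s) :
    ∃ c₀₀ c₀₁ c₁₀ c₁₁ : S, (c₀₀ + c₀₁ : Ext S) = a₀ ∧ (c₁₀ + c₁₁ : Ext S) = a₁ ∧
      (c₀₀ + c₁₀ : Ext S) = b₀ ∧ (c₀₁ + c₁₁ : Ext S) = b₁ :=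
  hS.1.refinement _ _ _ _ _ ha hb

theorem exists_add_of_le_add {a b c s : S} (h : a ≤ s) (hs : (b + c : Ext S) = s) :
    ∃ b' c' : S, b' ≤ b ∧ c' ≤ c ∧ (b' + c' : Ext S) = a := by
  obtain ⟨d, hd⟩ := le_iff_exists.1 h
  obtain ⟨x, y, z, w, h1, h2, h3, h4⟩ := refinement hd hs
  exact ⟨x, y, ⟨z, h3⟩, ⟨w, h4⟩, h1⟩

/-! ## Orthogonality -/

theorem orth_iff {a b : S} : Orth a b ↔ ∀ x, x ≤ a → x ≤ b → x = 0 := by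
  simp only [Orth, algLE_iff]

theorem Orth.symm {a b : S} (h : Orth a b) : Orth b a := fun x h1 h2 => h x h2 h1

theorem Orth.mono {a b a' b' : S} (h : Orth a b) (ha : a' ≤ a) (hb : b' ≤ b) : Orth a' b' :=
  orth_iff.2 fun x h1 h2 => orth_iff.1 h x (h1.trans ha) (h2.trans hb)

theorem Orth.eq_zero {a b : S} (h : Orth a b) (hab : a ≤ b) : a = 0 :=
  orth_iff.1 h a le_rfl hab

theorem perp_lower {X : Set S} {a b : S} (h : a ≤ b) (hb : b ∈ perp X) : a ∈ perp X :=
  fun x hx => (hb x hx).mono h le_rfl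

theorem zero_mem_perp (X : Set S) : (0 : S) ∈ perp X := fun _ _ =>
  orth_iff.2 fun _ h _ => eq_zero_of_le_zero h

theorem perp_anti {X Y : Set S} (h : X ⊆ Y) : perp Y ⊆ perp X := fun _ hs x hx => hs x (h hx)

theorem subset_perp_perp (X : Set S) : X ⊆ perp (perp X) := fun _ hx _ hy => (hy _ hx).symm

theorem perp_perp_perp (X : Set S) : perp (perp (perp X)) = perp X :=
  (perp_anti (subset_perp_perp X)).antisymm (subset_perp_perp _)

/-- Refinement splits a lower bound of the sum into lower bounds of the summands, and each of these
vanishes. -/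
theorem add_mem_perp {X : Set S} {a b c : S} (ha : a ∈ perp X) (hb : b ∈ perp X)
    (h : (a + b : Ext S) = c) : c ∈ perp X := by
  refine fun x hx => orth_iff.2 fun y hy hyx => ?_
  obtain ⟨a', b', h1, h2, h3⟩ := exists_add_of_le_add hy h
  have h4 := orth_iff.1 (ha x hx) a' h1 ((le_of_add_eq h3).trans hyx)
  have h5 := orth_iff.1 (hb x hx) b' h2 ((le_of_add_eq' h3).trans hyx)
  subst h4 h5
  rw [Ext.of_zero, add_zero, ← Ext.of_zero, Ext.of_inj] at h3
  exact h3.symm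

/-- In a common refinement, each cross term lies below one element of `X^⊥` and one of `X^⊥⊥`, so it
is `0`. -/
theorem perp_decomp_unique {X : Set S} {u v u' v' x : S} (hu : u ∈ perp X) (hv : v ∈ perp (perp X))
    (hu' : u' ∈ perp X) (hv' : v' ∈ perp (perp X)) (h : (u + v : Ext S) = x)
    (h' : (u' + v' : Ext S) = x) : u = u' := by
  obtain ⟨c00, c01, c10, c11, h1, h2, h3, h4⟩ := refinement h h'
  have e1 : c01 = 0 := orth_iff.1 (hv' u hu) _ (le_of_add_eq h4) (le_of_add_eq' h1)
  have e2 : c10 = 0 := orth_iff.1 (hv u' hu') _ (le_of_add_eq h2) (le_of_add_eq' h3)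
  rw [e1, Ext.of_zero, add_zero] at h1
  rw [e2, Ext.of_zero, add_zero] at h3
  exact Ext.of_injective (h1.symm.trans h3)

/-! ## Projections -/

namespace Projection

theorem add (p : Projection S) {a b c : S} (h : (a + b : Ext S) = c) :
    (p a + p b : Ext S) = p c := p.isHom.map_add a b c h

@[simp] theorem map_zero (p : Projection S) : p 0 = 0 := p.isHom.map_zero

theorem mono (p : Projection S) {a b : S} (h : a ≤ b) : p a ≤ p b := by
  obtain ⟨c, hc⟩ := le_iff_exists.1 h
  exact ⟨p c, p.add hc⟩

theorem split' (p : Projection S) (x : S) :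
    ∃ y ∈ perp (Set.range p), (p x + y : Ext S) = x := p.split x

theorem apply_le (p : Projection S) (x : S) : p x ≤ x := by
  obtain ⟨y, -, h⟩ := p.split' x
  exact le_of_add_eq h

theorem apply_eq_of_le (p : Projection S) {x y : S} (h : x ≤ p y) : p x = x := by
  obtain ⟨z, hz, hs⟩ := p.split' x
  have h0 : z = 0 := (hz (p y) ⟨y, rfl⟩).eq_zero ((le_of_add_eq' hs).trans h)
  rw [h0, Ext.of_zero, add_zero, Ext.of_inj] at hs
  exact hs

theorem mem_range (p : Projection S) {x : S} : x ∈ Set.range p ↔ p x = x :=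
  ⟨fun ⟨y, hy⟩ => by rw [← hy, p.idem], fun h => ⟨x, h⟩⟩

theorem mem_perp_range (p : Projection S) {x : S} : x ∈ perp (Set.range p) ↔ p x = 0 := by
  constructor
  · intro h
    exact ((h (p x) ⟨x, rfl⟩).symm).eq_zero (p.apply_le x)
  · intro h
    obtain ⟨y, hy, hs⟩ := p.split' x
    rw [h, Ext.of_zero, zero_add, Ext.of_inj] at hs
    exact hs ▸ hy

theorem range_eq_perp_perp (p : Projection S) : perp (perp (Set.range p)) = Set.range p := by
  refine Set.Subset.antisymm (fun x hx => ?_) (subset_perp_perp _)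
  obtain ⟨y, hy, hs⟩ := p.split' x
  have h0 : y = 0 := (perp_lower (le_of_add_eq' hs) hx y hy).eq_zero le_rfl
  rw [h0, Ext.of_zero, add_zero, Ext.of_inj] at hs
  exact ⟨x, hs⟩

/-- If the ranges are nested, `p` kills the remainder of `x` modulo `q`, so `p q = p`. The order of
projections is therefore inclusion of ranges, and a projection is determined by its range. -/
theorem le_iff_range {p q : Projection S} : p ≤ q ↔ Set.range p ⊆ Set.range q := by
  constructor
  · rintro h _ ⟨x, rfl⟩
    exact ⟨p x, (h x).2⟩
  · intro h x
    refine ⟨?_, q.mem_range.1 (h ⟨x, rfl⟩)⟩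
    obtain ⟨y, hy, hs⟩ := q.split' x
    have := p.add hs
    rw [p.mem_perp_range.1 (perp_anti h hy), Ext.of_zero, add_zero, Ext.of_inj] at this
    exact this

end Projection

/-- The candidate is the largest `p` with `p a ≤ p 0`. Comparing `a` with some `x` orthogonal to it
gives a projection that kills `a` and fixes `x`; maximality puts it below `p`. -/
theorem exists_projection_perp_singleton (a : S) : ∃ p : Projection S, Set.range p = perp {a} := by
  obtain ⟨p, hp, hmax⟩ := hS.1.booleanValued a 0
  rw [Set.mem_ofPred_eq, algLE_iff, p.map_zero] at hp
  have hp0 := eq_zero_of_le_zero hp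
  refine ⟨p, Set.Subset.antisymm ?_ fun x hx => ?_⟩
  · rintro _ ⟨x, rfl⟩ _ rfl
    exact (p.mem_perp_range.2 hp0 _ ⟨x, rfl⟩).symm
  · obtain ⟨r, q, ⟨-, hrq⟩, h1, h2⟩ := hS.1.generalComparability a x
    rw [algLE_iff] at h1 h2
    have hx' := orth_iff.1 (hx a rfl)
    have e1 : r a = 0 := hx' _ (h1.trans (r.apply_le x)) (r.apply_le a)
    have e2 : q x = 0 := hx' _ (q.apply_le x) (h2.trans (q.apply_le a))
    have e3 : x ∈ Set.range r := hrq ▸ e2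
    have hle : r ≤ p := hmax (show AlgLE (r a) (r 0) by rw [algLE_iff, e1]; exact DimScale.zero_le _)
    exact Projection.le_iff_range.1 hle e3

/-- The infimum `u` of `x` and all its projections to `a^⊥`, `a ∈ X`, detects the `X^⊥` part of `x`.
Splitting `x` along `u^⊥` gives a component in `u^⊥⊥ ⊆ X^⊥` and a component that turns out to lie in
`X^⊥⊥`. -/
theorem exists_perp_decomp (X : Set S) (x : S) :
    ∃ u ∈ perp X, ∃ v ∈ perp (perp X), (u + v : Ext S) = x := by
  choose P hP using exists_projection_perp_singleton (S := S)
  obtain ⟨u, hu⟩ := exists_isGLB (X := insert x ((fun a => P a x) '' X)) ⟨x, Or.inl rfl⟩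
  have huX : u ∈ perp X := fun a ha => by
    have : P a x ∈ perp {a} := hP a ▸ ⟨x, rfl⟩
    exact perp_lower (hu.1 (Or.inr ⟨a, ha, rfl⟩)) this a rfl
  obtain ⟨y, hy, hs⟩ := (P u).split' x
  refine ⟨y, ?_, P u x, ?_, (add_comm _ _).trans hs⟩
  · rw [hP] at hy
    have h1 : ({u} : Set S) ⊆ perp X := Set.singleton_subset_iff.2 huX
    have h2 := perp_anti (perp_anti h1) hy
    rwa [perp_perp_perp] at h2
  -- An element `z` of `X^⊥` below `x` is fixed by every `P a`, hence lies below `u`; being also in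
  -- `u^⊥`, it is `0`.
  · refine fun w hw => orth_iff.2 fun z hz hzw => ?_
    have hzX : z ∈ perp X := perp_lower hzw hw
    have hzx : z ≤ x := hz.trans ((P u).apply_le x)
    have hzu : z ≤ u := hu.2 <| by
      rintro _ (rfl | ⟨a, ha, rfl⟩)
      · exact hzx
      · have : z ∈ Set.range (P a) := hP a ▸ fun b hb => by
          rw [Set.mem_singleton_iff.1 hb]; exact hzX a ha
        have h := (P a).mono hzx
        rwa [(P a).mem_range.1 this] at h
    have hz' : z ∈ perp {u} := by
      have : P u x ∈ perp {u} := hP u ▸ ⟨x, rfl⟩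
      exact perp_lower hz this
    exact (hz' u rfl).eq_zero hzu

/-- Taking the `X^⊥` component is additive because the decomposition is unique. -/
theorem exists_projection_range_eq_perp (X : Set S) :
    ∃ p : Projection S, Set.range p = perp X := by
  choose f hf g hg hfg using exists_perp_decomp X
  have hid : ∀ x ∈ perp X, f x = x := fun x hx =>
    perp_decomp_unique (hf x) (hg x) hx (zero_mem_perp _) (hfg x) (by rw [Ext.of_zero, add_zero])
  have hr : Set.range f = perp X := by
    refine Set.Subset.antisymm ?_ fun x hx => ⟨x, hid x hx⟩
    rintro _ ⟨x, rfl⟩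
    exact hf x
  refine ⟨⟨f, ⟨?_, fun a b c h => ?_⟩, fun x => ⟨g x, hr ▸ hg x, hfg x⟩⟩, hr⟩
  · exact hid 0 (zero_mem_perp _)
  · rw [Ext.isSum_iff] at h
    have e : ((f a + f b : Ext S) + (g a + g b)) = c := by
      rw [add_add_add_comm, hfg, hfg, h]
    obtain ⟨u, v, hu, hv⟩ := Ext.exists_of_add_eq e
    rw [hu, hv] at e
    have := perp_decomp_unique (hf c) (hg c) (add_mem_perp (hf a) (hf b) hu)
      (add_mem_perp (hg a) (hg b) hv) (hfg c) e
    rw [Ext.isSum_iff, this, hu]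

/-- The projection with range `X^⊥`. -/
noncomputable def perpProj (X : Set S) : Projection S := (exists_projection_range_eq_perp X).choose

theorem range_perpProj (X : Set S) : Set.range (perpProj X) = perp X :=
  (exists_projection_range_eq_perp X).choose_spec

namespace Projection

/-- Ranges are closed under `⊥⊥`, so orthogonality to all the complements amounts to membership in
all the ranges. The infimum thus has the intersection as its range. -/
theorem isGLB_perpProj (P : Set (Projection S)) :
    IsGLB P (perpProj (⋃ p ∈ P, perp (Set.range p))) := by
  constructor
  · intro p hp
    rw [le_iff_range, range_perpProj]
    refine (perp_anti (Set.subset_biUnion_of_mem hp)).trans ?_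
    rw [range_eq_perp_perp]
  · intro q hq
    rw [le_iff_range, range_perpProj]
    intro x hx y hy
    obtain ⟨p, hp, hy⟩ := Set.mem_iUnion₂.1 hy
    exact (hy x (le_iff_range.1 (hq hp) hx)).symm

noncomputable instance : CompleteLattice (Projection S) :=
  letI : InfSet (Projection S) := ⟨fun P => perpProj (⋃ p ∈ P, perp (Set.range p))⟩
  completeLatticeOfInf _ isGLB_perpProj

/-- The part `w'` of `w` off `q` is orthogonal to the ranges of both `p` and `q`, hence to that of
`p ⊔ q`. But `w'` lies in that range, so it is orthogonal to itself. -/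
theorem sup_mem_right {p q : Projection S} {w : S} (hw : w ∈ Set.range ⇑(p ⊔ q)) (hp : p w = 0) :
    w ∈ Set.range q := by
  obtain ⟨w', hw', hs⟩ := q.split' w
  have hle : w' ≤ w := le_of_add_eq' hs
  have h1 : p w' = 0 := eq_zero_of_le_zero (hp ▸ p.mono hle)
  have h2 : p ⊔ q ≤ perpProj {w'} := by
    refine sup_le ?_ ?_ <;> rw [le_iff_range, range_perpProj] <;> rintro y hy _ rfl
    · exact (p.mem_perp_range.2 h1 y hy).symm
    · exact (hw' y hy).symm
  have h3 : w' ∈ Set.range ⇑(p ⊔ q) := by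
    obtain ⟨y, rfl⟩ := hw
    exact (p ⊔ q).mem_range.2 ((p ⊔ q).apply_eq_of_le hle)
  have h4 := le_iff_range.1 h2 h3
  rw [range_perpProj] at h4
  have h0 := (h4 w' rfl).eq_zero le_rfl
  rw [h0, Ext.of_zero, add_zero, Ext.of_inj] at hs
  exact q.mem_range.2 hs

/-- The projection onto `x^⊥⊥` is below both `p` and `q`. -/
theorem mem_range_inf {p q : Projection S} {x : S} (hp : x ∈ Set.range p) (hq : x ∈ Set.range q) :
    x ∈ Set.range ⇑(p ⊓ q) := by
  have : perpProj (perp {x}) ≤ p ⊓ q := by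
    refine le_inf ?_ ?_ <;> rw [le_iff_range, range_perpProj]
    · exact (perp_anti (perp_anti (Set.singleton_subset_iff.2 hp))).trans p.range_eq_perp_perp.le
    · exact (perp_anti (perp_anti (Set.singleton_subset_iff.2 hq))).trans q.range_eq_perp_perp.le
  refine le_iff_range.1 this ?_
  rw [range_perpProj]
  exact subset_perp_perp _ rfl

noncomputable instance : CompleteBooleanAlgebra (Projection S) where
  __ := (inferInstance : CompleteLattice (Projection S))
  compl p := perpProj (Set.range p)
  -- Split `x` along `p`: the part killed by `p` lies in the ranges of both `q` and `r` by
  -- `sup_mem_right`.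
  le_sup_inf p q r := by
    rw [le_iff_range]
    intro x hx
    have h1 := le_iff_range.1 inf_le_left hx
    have h2 := le_iff_range.1 inf_le_right hx
    obtain ⟨y, hy, hs⟩ := p.split' x
    have hyx : y ≤ x := le_of_add_eq' hs
    have hpy := p.mem_perp_range.1 hy
    have h3 := sup_mem_right ((p ⊔ q).mem_range.2 ((p ⊔ q).apply_eq_of_le
      (hyx.trans_eq ((p ⊔ q).mem_range.1 h1).symm))) hpy
    have h4 := sup_mem_right ((p ⊔ r).mem_range.2 ((p ⊔ r).apply_eq_of_le
      (hyx.trans_eq ((p ⊔ r).mem_range.1 h2).symm))) hpy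
    have h5 : y ∈ Set.range ⇑(p ⊔ q ⊓ r) :=
      le_iff_range.1 le_sup_right (mem_range_inf h3 h4)
    have h6 : p x ∈ Set.range ⇑(p ⊔ q ⊓ r) := le_iff_range.1 le_sup_left ⟨x, rfl⟩
    rw [← range_eq_perp_perp] at h5 h6 ⊢
    exact add_mem_perp h6 h5 hs
  inf_compl_le_bot p := by
    refine le_iff_range.2 fun x hx => ?_
    have h1 := le_iff_range.1 inf_le_left hx
    have h2 := le_iff_range.1 inf_le_right hx
    rw [range_perpProj] at h2
    rw [(h2 x h1).eq_zero le_rfl]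
    exact ⟨0, map_zero _⟩
  top_le_sup_compl p := by
    refine le_iff_range.2 fun x _ => ?_
    obtain ⟨y, hy, hs⟩ := p.split' x
    have h5 : y ∈ Set.range ⇑(p ⊔ perpProj (Set.range p)) :=
      le_iff_range.1 le_sup_right (by rwa [range_perpProj])
    have h6 : p x ∈ Set.range ⇑(p ⊔ perpProj (Set.range p)) := le_iff_range.1 le_sup_left ⟨x, rfl⟩
    rw [← range_eq_perp_perp] at h5 h6 ⊢
    exact add_mem_perp h6 h5 hs
  le_top _ := le_top
  bot_le _ := bot_le

theorem range_compl (p : Projection S) : Set.range ⇑pᶜ = perp (Set.range p) := range_perpProj _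

theorem compl_apply_eq_self_iff {p : Projection S} {x : S} : pᶜ x = x ↔ p x = 0 := by
  rw [← mem_range, range_compl, mem_perp_range]

theorem compl_apply_eq_zero_iff {p : Projection S} {x : S} : pᶜ x = 0 ↔ p x = x := by
  rw [← compl_apply_eq_self_iff, compl_compl]

theorem add_compl (p : Projection S) (x : S) : (p x + pᶜ x : Ext S) = x := by
  obtain ⟨y, hy, hs⟩ := p.split' x
  have h := pᶜ.add hs
  rw [compl_apply_eq_zero_iff.2 (p.idem x), Ext.of_zero, zero_add,
    compl_apply_eq_self_iff.2 (p.mem_perp_range.1 hy), Ext.of_inj] at h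
  rw [← h, hs]

theorem apply_of_le {p q : Projection S} (h : p ≤ q) (x : S) : p (q x) = p x := (h x).1

@[simp] theorem bot_apply (x : S) : (⊥ : Projection S) x = 0 := by
  have h1 : (⊥ : Projection S) x ∈ Set.range ⇑(⊥ : Projection S) := ⟨x, rfl⟩
  have h2 : ⊥ ≤ perpProj (Set.univ : Set S) := bot_le
  have h3 := le_iff_range.1 h2 h1
  rw [range_perpProj] at h3
  exact (h3 _ trivial).eq_zero le_rfl

@[simp] theorem top_apply (x : S) : (⊤ : Projection S) x = x := by
  rw [← compl_bot, compl_apply_eq_self_iff, bot_apply]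

theorem compl_apply_self (p : Projection S) (x : S) : pᶜ (p x) = 0 :=
  compl_apply_eq_zero_iff.2 (p.idem x)

theorem apply_compl_self (p : Projection S) (x : S) : p (pᶜ x) = 0 := by
  rw [← compl_apply_eq_self_iff, idem]

theorem inf_apply (p q : Projection S) (x : S) : (p ⊓ q) x = p (q x) := by
  have h1 : p (q x) ∈ Set.range ⇑(p ⊓ q) :=
    mem_range_inf ⟨_, rfl⟩ (q.mem_range.2 (q.apply_eq_of_le (p.apply_le _)))
  have h2 := (p ⊓ q).mem_range.1 h1
  rw [← h2, apply_of_le inf_le_left, apply_of_le inf_le_right]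

theorem eq_of_apply {p : Projection S} {x y : S} (h : p x = p y) (h' : pᶜ x = pᶜ y) : x = y := by
  rw [← Ext.of_inj, ← p.add_compl x, h, h', p.add_compl]

theorem le_of_apply {p : Projection S} {x y : S} (h : p x ≤ p y) (h' : pᶜ x ≤ pᶜ y) : x ≤ y := by
  rw [← Ext.of_le_of, ← p.add_compl x, ← p.add_compl y]
  exact add_le_add h h'

/-- Gluing of two elements with a common upper bound along a projection. -/
theorem exists_glue (p : Projection S) {x y c : S} (hx : p x ≤ c) (hy : pᶜ y ≤ c) :
    ∃ z ≤ c, p z = p x ∧ pᶜ z = pᶜ y := by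
  have h1 : (p x + pᶜ y : Ext S) ≤ c := by
    rw [← p.add_compl c]
    refine add_le_add (Ext.of_le_of.2 ?_) (Ext.of_le_of.2 ?_)
    · simpa only [idem] using p.mono hx
    · simpa only [idem] using pᶜ.mono hy
  obtain ⟨z, hz, hzc⟩ := Ext.exists_of_le h1
  refine ⟨z, hzc, ?_, ?_⟩
  · have := p.add hz
    rw [idem, apply_compl_self, Ext.of_zero, add_zero, Ext.of_inj] at this
    exact this.symm
  · have := pᶜ.add hz
    rw [idem, compl_apply_self, Ext.of_zero, zero_add, Ext.of_inj] at this
    exact this.symm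

end Projection

/-! ## Boolean values -/

/-- The largest projection `p` with `p x ≤ p y`. -/
noncomputable def leProj (x y : S) : Projection S := (hS.1.booleanValued x y).choose

theorem le_leProj_iff {x y : S} {p : Projection S} : p ≤ leProj x y ↔ p x ≤ p y := by
  have h := (hS.1.booleanValued x y).choose_spec
  constructor
  · intro hp
    have h1 : leProj x y x ≤ leProj x y y := algLE_iff.1 h.1
    have := p.mono h1
    rwa [p.apply_of_le hp, p.apply_of_le hp] at this
  · intro hp
    exact h.2 (algLE_iff.2 hp)

theorem leProj_apply_le (x y : S) : leProj x y x ≤ leProj x y y := le_leProj_iff.1 le_rfl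

/-- This is general comparability in Boolean form; the projection `q` of that axiom is `pᶜ`, because
the two have the same range. -/
theorem leProj_sup_leProj (x y : S) : leProj x y ⊔ leProj y x = ⊤ := by
  obtain ⟨p, q, ⟨hq, -⟩, h1, h2⟩ := hS.1.generalComparability x y
  rw [algLE_iff] at h1 h2
  have : q = pᶜ := le_antisymm (Projection.le_iff_range.2 (by rw [hq, p.range_compl]))
    (Projection.le_iff_range.2 (by rw [hq, p.range_compl]))
  subst this
  rw [eq_top_iff, ← sup_compl_eq_top (x := p)]
  exact sup_le_sup (le_leProj_iff.2 h1) (le_leProj_iff.2 h2)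

theorem compl_leProj_le (x y : S) : (leProj x y)ᶜ ≤ leProj y x := by
  rw [← codisjoint_iff_compl_le_right.{u}, codisjoint_iff]
  exact leProj_sup_leProj x y

/-- The support of an element. -/
noncomputable def supp (x : S) : Projection S := (leProj x 0)ᶜ

theorem le_compl_supp_iff {x : S} {p : Projection S} : p ≤ (supp x)ᶜ ↔ p x = 0 := by
  rw [supp, compl_compl, le_leProj_iff, p.map_zero]
  exact ⟨eq_zero_of_le_zero, fun h => h.le⟩

theorem supp_le_iff {x : S} {p : Projection S} : supp x ≤ p ↔ p x = x := by
  rw [← compl_le_compl_iff_le, le_compl_supp_iff, Projection.compl_apply_eq_zero_iff]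

theorem supp_apply (x : S) : supp x x = x := supp_le_iff.1 le_rfl

theorem inf_supp_eq_bot_iff {x : S} {p : Projection S} : p ⊓ supp x = ⊥ ↔ p x = 0 := by
  rw [← le_compl_supp_iff, le_compl_iff_disjoint_right, disjoint_iff]

theorem supp_mono {x y : S} (h : x ≤ y) : supp x ≤ supp y := by
  rw [supp_le_iff]
  exact (supp y).apply_eq_of_le (h.trans_eq (supp_apply y).symm)

theorem supp_projection_apply (p : Projection S) (x : S) : supp (p x) = p ⊓ supp x := by
  refine le_antisymm ?_ ?_
  · refine le_inf (supp_le_iff.2 (p.idem x)) (supp_mono (p.apply_le x))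
  · rw [← compl_le_compl_iff_le, le_compl_iff_disjoint_right, disjoint_iff, ← inf_assoc,
      inf_supp_eq_bot_iff, Projection.inf_apply]
    exact le_compl_supp_iff.1 le_rfl

@[simp] theorem supp_zero : supp (0 : S) = ⊥ := by
  rw [← top_inf_eq (supp (0 : S)), inf_supp_eq_bot_iff, Projection.map_zero]

theorem supp_eq_bot_iff {x : S} : supp x = ⊥ ↔ x = 0 := by
  rw [← top_inf_eq (supp x), inf_supp_eq_bot_iff, Projection.top_apply]

/-- The projection onto `y^⊥` kills `y`, and it dominates `supp x` when `x` is orthogonal to `y`. -/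
theorem orth_iff_supp {x y : S} : Orth x y ↔ supp x ⊓ supp y = ⊥ := by
  constructor
  · intro h
    rw [inf_supp_eq_bot_iff]
    obtain ⟨p, hp⟩ := exists_projection_perp_singleton y
    have h1 : supp x ≤ p := by
      rw [supp_le_iff, ← p.mem_range, hp]
      rintro _ rfl
      exact h
    have h2 : p y = 0 := by
      rw [← p.mem_perp_range, hp]
      exact subset_perp_perp _ rfl
    rw [← (supp x).apply_of_le h1, h2, Projection.map_zero]
  · refine fun h => orth_iff.2 fun z h1 h2 => ?_
    rw [← supp_eq_bot_iff, eq_bot_iff, ← h]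
    exact le_inf (supp_mono h1) (supp_mono h2)

end Basic

end DimScale

namespace DimScale

/-! ### Directly finite and purely infinite parts -/

section FiniteInfinite

variable {S : Type u} [PartialCommMonoid S] [hS : Fact (IsContinuousDimensionScale S)]

/-! ## Directly finite elements -/

theorem Projection.add_le (p : Projection S) {a b c : S} (h : (a + b : Ext S) ≤ c) :
    (p a + p b : Ext S) ≤ p c := by
  obtain ⟨d, hd, hdc⟩ := Ext.exists_of_le h
  rw [p.add hd]
  exact p.mono hdc

theorem DirectlyFinite.mono {a c : S} (hc : DirectlyFinite c) (h : a ≤ c) : DirectlyFinite a := by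
  obtain ⟨d, hd⟩ := le_iff_exists.1 h
  refine fun x hx => hc x ?_
  rw [Ext.isSum_iff] at hx ⊢
  rw [← hd, ← add_assoc, hx]

/-- On `leProj x y` and on its complement the elements are comparable, so an equality may be proved
under the assumption of a local comparison. -/
theorem eq_of_forall_le {x y : S} (h : ∀ p : Projection S, p x ≤ p y → p x = p y)
    (h' : ∀ p : Projection S, p y ≤ p x → p x = p y) : x = y :=
  (leProj x y).eq_of_apply (h _ (leProj_apply_le x y))
    (h' _ (le_leProj_iff.1 (compl_leProj_le x y)))

/-- Where `u ≤ v`, the difference is absorbed by `c`, so it is `0`. -/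
theorem DirectlyFinite.cancel_summand {u v w c : S} (hc : DirectlyFinite c)
    (hu : (u + w : Ext S) = c) (hv : (v + w : Ext S) = c) : u = v := by
  have key : ∀ u v : S, (u + w : Ext S) = c → (v + w : Ext S) = c → ∀ p : Projection S,
      p u ≤ p v → p u = p v := by
    intro u v hu hv p h
    obtain ⟨t, ht⟩ := le_iff_exists.1 h
    have : (t + c : Ext S) = c := by
      have e1 := p.add hu
      have e2 := p.add hv
      rw [← ht, add_right_comm, e1] at e2
      rw [← p.add_compl c, ← add_assoc, add_comm (t : Ext S), e2]
    rw [hc t this, Ext.of_zero, add_zero, Ext.of_inj] at ht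
    exact ht
  exact eq_of_forall_le (key u v hu hv) fun p h => (key v u hv hu p h).symm

/-- Refinement gives `c = c01 + c11 = c10 + c11`, and the off-diagonal entries agree by the case in
which both sums equal `c`. -/
theorem DirectlyFinite.cancel {a b c s : S} (hc : DirectlyFinite c)
    (ha : (a + c : Ext S) = s) (hb : (b + c : Ext S) = s) : a = b := by
  obtain ⟨c00, c01, c10, c11, h1, h2, h3, h4⟩ := refinement ha hb
  have := hc.cancel_summand h2 h4
  subst this
  exact Ext.of_injective (h1.symm.trans h3)

theorem DirectlyFinite.ext_cancel {x y : Ext S} {c s : S} (hc : DirectlyFinite c)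
    (hx : x + c = s) (hy : y + c = s) : x = y := by
  obtain ⟨a, _, rfl, -⟩ := Ext.exists_of_add_eq hx
  obtain ⟨b, _, rfl, -⟩ := Ext.exists_of_add_eq hy
  rw [hc.cancel hx hy]

theorem DirectlyFinite.le_of_add_le {x y : Ext S} {c s : S} (hc : DirectlyFinite c)
    (hy : y + c = s) (h : x + c ≤ y + c) : x ≤ y := by
  obtain ⟨z, hz⟩ := h
  refine ⟨z, hc.ext_cancel ?_ hy⟩
  rw [← hy, ← hz, add_right_comm]

theorem DirectlyFinite.add {a b c : S} (ha : DirectlyFinite a) (hb : DirectlyFinite b)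
    (h : (a + b : Ext S) = c) : DirectlyFinite c := by
  refine fun x hx => ha x (Ext.isSum_iff.2 (hb.ext_cancel (s := c) ?_ h))
  rw [add_assoc, h]
  exact hx

theorem directlyFinite_zero : DirectlyFinite (0 : S) := fun x hx => by
  rw [Ext.isSum_iff, Ext.of_zero, add_zero, ← Ext.of_zero, Ext.of_inj] at hx
  exact hx

theorem DirectlyFinite.projection {a : S} (ha : DirectlyFinite a) (p : Projection S) :
    DirectlyFinite (p a) := ha.mono (p.apply_le a)

/-- A directly finite element has no nonzero part all of whose multiples it bounds. -/
theorem DirectlyFinite.eq_zero_of_nsmul_le {d e : S} (he : DirectlyFinite e)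
    (h : ∀ n : ℕ, n • (d : Ext S) ≤ e) : d = 0 := by
  have hX : BddAbove {x : S | ∃ n : ℕ, n • (d : Ext S) = x} := by
    refine ⟨e, ?_⟩
    rintro x ⟨n, hn⟩
    exact Ext.of_le_of.1 (hn ▸ h n)
  obtain ⟨s, hs⟩ := exists_isLUB hX
  have hse : s ≤ e := hs.2 <| by
    rintro x ⟨n, hn⟩
    exact Ext.of_le_of.1 (hn ▸ h n)
  have hds : d ≤ s := hs.1 ⟨1, one_nsmul _⟩
  obtain ⟨s', hs'⟩ := le_iff_exists.1 hds
  have hsf := he.mono hse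
  -- Cancelling `d` from `(n + 1) d ≤ s = d + s'` gives `n d ≤ s'`. The supremum `s` then equals
  -- `s'`, so it absorbs `d`.
  have hle : s ≤ s' := hs.2 <| by
    rintro x ⟨n, hn⟩
    refine Ext.of_le_of.1 ((hsf.mono hds).le_of_add_le ((add_comm _ _).trans hs') ?_)
    obtain ⟨y, hy, -⟩ := Ext.exists_of_le (h (n + 1))
    rw [add_comm (s' : Ext S), hs', ← hn, ← succ_nsmul, hy]
    exact hs.1 ⟨n + 1, hy⟩
  have : s' = s := le_antisymm (le_of_add_eq' hs') hle
  subst this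
  exact hsf d hs'

theorem MultipleFree.mono {a b : S} (hb : MultipleFree b) (h : a ≤ b) : MultipleFree a :=
  fun x s hx hs => hb x s hx (algLE_iff.2 ((algLE_iff.1 hs).trans h))

theorem multipleFree_iff {a : S} : MultipleFree a ↔ ∀ x : S, (x + x : Ext S) ≤ a → x = 0 := by
  constructor
  · intro h x hx
    obtain ⟨s, hs, hsa⟩ := Ext.exists_of_le hx
    exact h x s hs (algLE_iff.2 hsa)
  · intro h x s hx hs
    refine h x ?_
    rw [Ext.isSum_iff.1 hx]
    exact algLE_iff.1 hs

theorem MultipleFree.directlyFinite {a : S} (h : MultipleFree a) : DirectlyFinite a := by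
  intro x hx
  rw [Ext.isSum_iff] at hx
  refine multipleFree_iff.1 h x ?_
  calc (x + x : Ext S) ≤ x + (x + a) := add_le_add le_rfl le_self_add
    _ = a := by rw [hx, hx]

/-- The half is the supremum `s` of all `x` with `2x ≤ e`. What `2s` leaves of `e` is multiple-free,
hence `0`. -/
theorem exists_half {e : S} (he : DirectlyFinite e) (h2 : e ∈ perp (mfSet S)) :
    ∃ s : S, (s + s : Ext S) = e := by
  set X : Set S := {x | (x + x : Ext S) ≤ e} with hX
  -- Locally one of `x`, `y` is the larger, and its double bounds `x + y`.
  have hdir : ∀ x ∈ X, ∀ y ∈ X, (x + y : Ext S) ≤ e := by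
    have key : ∀ x y : S, y ∈ X → ∀ p : Projection S, p x ≤ p y → (p x + p y : Ext S) ≤ p e :=
      fun x y hy p h => (add_le_add (Ext.of_le_of.2 h) le_rfl).trans (p.add_le hy)
    intro x hx y hy
    rw [← (leProj x y).add_compl x, ← (leProj x y).add_compl y, ← (leProj x y).add_compl e,
      add_add_add_comm]
    refine add_le_add (key x y hy _ (leProj_apply_le x y)) ?_
    rw [add_comm]
    exact key y x hx _ (le_leProj_iff.1 (compl_leProj_le x y))
  have hle : ∀ x ∈ X, x ≤ e := fun x hx => Ext.of_le_of.1 (le_self_add.trans hx)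
  obtain ⟨s, hs⟩ := exists_isLUB ⟨e, hle⟩
  -- Cancelling `x` from `x + x' = e` moves the bound to the other side, so the supremum may be
  -- taken in one summand. Applying this twice gives `2s ≤ e`.
  have hadd : ∀ x : S, x ≤ e → (∀ y ∈ X, (x + y : Ext S) ≤ e) → (x + s : Ext S) ≤ e := by
    intro x hx h
    obtain ⟨x', hx'⟩ := le_iff_exists.1 hx
    have : s ≤ x' := hs.2 fun y hy => Ext.of_le_of.1 <|
      (he.mono hx).le_of_add_le ((add_comm _ _).trans hx') (by
        rw [add_comm (x' : Ext S), hx', add_comm]; exact h y hy)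
    rw [← hx']
    exact add_le_add le_rfl this
  have hss : (s + s : Ext S) ≤ e := by
    refine hadd s (hs.2 hle) fun y hy => ?_
    rw [add_comm]
    exact hadd y (hle y hy) fun z hz => hdir y hy z hz
  obtain ⟨z, hz⟩ := hss
  obtain ⟨w, t, hw, rfl⟩ := Ext.exists_of_add_eq hz
  -- If `2y ≤ t`, then `s + y` also belongs to `X`, so it equals `s` and `y` is absorbed.
  have ht : MultipleFree t := multipleFree_iff.2 fun y hy => by
    obtain ⟨v, hv, -⟩ := Ext.exists_of_le (show (s + y : Ext S) ≤ e from by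
      rw [← hz]
      refine add_le_add le_self_add (le_self_add.trans hy))
    have hvX : v ∈ X := by
      change (v + v : Ext S) ≤ e
      rw [← hv, add_add_add_comm, ← hz]
      exact add_le_add le_rfl hy
    have hvs : v = s := le_antisymm (hs.1 hvX) (le_of_add_eq hv)
    rw [hvs, add_comm] at hv
    exact he.mono (hs.2 hle) y hv
  have h0 : t = 0 := (h2 t ht).symm.eq_zero (le_of_add_eq' (hw ▸ hz))
  exact ⟨s, by rw [← hz, h0, Ext.of_zero, add_zero]⟩

/-! ## Multiples -/

/-- Induction on `k`: on `leProj h a` write `a = h + a'`. By cancellation, `k + 1` copies fit into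
`a` exactly where `k` copies fit into `a'`. -/
theorem exists_nsmul_le_projection {h : S} (hf : DirectlyFinite h) (k : ℕ) (a : S) :
    ∃ P : Projection S, ∀ p : Projection S, p ≤ P ↔ k • (p h : Ext S) ≤ p a := by
  induction k generalizing a with
  | zero => exact ⟨⊤, fun p => by simp⟩
  | succ k ih =>
    obtain ⟨a', ha'⟩ := le_iff_exists.1 (leProj_apply_le h a)
    obtain ⟨P, hP⟩ := ih a'
    refine ⟨leProj h a ⊓ P, fun p => ?_⟩
    have key : p ≤ leProj h a → (k • (p h : Ext S) ≤ p a' ↔ (k + 1) • (p h : Ext S) ≤ p a) := by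
      intro hp
      have e := p.add ha'
      rw [p.apply_of_le hp, p.apply_of_le hp, add_comm] at e
      constructor
      · intro h1
        rw [← e, succ_nsmul]
        exact add_le_add h1 le_rfl
      · intro h1
        refine (hf.projection p).le_of_add_le e ?_
        rw [e, ← succ_nsmul]
        exact h1
    rw [le_inf_iff, hP]
    constructor
    · rintro ⟨h1, h2⟩
      exact (key h1).1 h2
    · intro h1
      have h2 : p ≤ leProj h a := le_leProj_iff.2 (Ext.of_le_of.1 (le_trans (by
        rw [succ_nsmul]; exact le_add_self) h1))
      exact ⟨h2, (key h2).2 h1⟩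

/-! ## Purely infinite elements -/

theorem purelyInfinite_iff {a : S} : PurelyInfinite a ↔ (a + a : Ext S) = a := Iff.rfl

theorem PurelyInfinite.add_eq {a b : S} (ha : PurelyInfinite a) (h : a ≤ b) :
    (a + b : Ext S) = b := by
  obtain ⟨c, hc⟩ := le_iff_exists.1 h
  rw [← hc, ← add_assoc, purelyInfinite_iff.1 ha]

theorem purelyInfinite_zero : PurelyInfinite (0 : S) := by
  rw [purelyInfinite_iff, Ext.of_zero, add_zero]

theorem purelyInfinite_of_add_le {a : S} (h : (a + a : Ext S) ≤ a) : PurelyInfinite a :=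
  purelyInfinite_iff.2 (le_antisymm h le_self_add)

theorem PurelyInfinite.projection {a : S} (ha : PurelyInfinite a) (p : Projection S) :
    PurelyInfinite (p a) := p.add ha

theorem PurelyInfinite.of_projection {a : S} (p : Projection S) (h : PurelyInfinite (p a))
    (h' : PurelyInfinite (pᶜ a)) : PurelyInfinite a := by
  rw [purelyInfinite_iff, ← p.add_compl a, add_add_add_comm, purelyInfinite_iff.1 h,
    purelyInfinite_iff.1 h']

theorem PurelyInfinite.eq_zero {a : S} (ha : PurelyInfinite a) (h : DirectlyFinite a) : a = 0 :=
  h a ha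

/-- Twice the infimum is defined and is still a lower bound. -/
theorem PurelyInfinite.of_isGLB {X : Set S} (hX : ∀ x ∈ X, PurelyInfinite x) {a : S}
    (ha : IsGLB X a) (hne : X.Nonempty) : PurelyInfinite a := by
  obtain ⟨x, hx⟩ := hne
  have h1 : ∀ x ∈ X, (a + a : Ext S) ≤ x := fun x hx =>
    (add_le_add (Ext.of_le_of.2 (ha.1 hx)) (Ext.of_le_of.2 (ha.1 hx))).trans (purelyInfinite_iff.1 (hX x hx)).le
  obtain ⟨b, hb, -⟩ := Ext.exists_of_le (h1 x hx)
  refine purelyInfinite_of_add_le ?_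
  rw [hb]
  exact ha.2 fun y hy => Ext.of_le_of.1 (hb ▸ h1 y hy)

/-- Where `x ≤ y` fails, `y ≤ x` makes `y` directly finite as well as purely infinite, hence `0`. -/
theorem PurelyInfinite.supp_le_leProj {x y : S} (hy : PurelyInfinite y) (hx : DirectlyFinite x) :
    supp y ≤ leProj x y := by
  rw [← compl_le_compl_iff_le, le_compl_supp_iff]
  have h1 : (leProj x y)ᶜ y ≤ (leProj x y)ᶜ x := le_leProj_iff.1 (compl_leProj_le x y)
  exact (hy.projection _).eq_zero ((hx.projection _).mono h1)

/-- On the support of the purely infinite summand `y`, the directly finite summand is below `y` and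
is absorbed; off that support only the directly finite summand remains. -/
theorem exists_infProj (a : S) : ∃ q : Projection S, PurelyInfinite (q a) ∧ q ≤ supp a ∧
    DirectlyFinite (qᶜ a) := by
  obtain ⟨x, y, h, hx, hy⟩ := hS.1.exists_decomp a
  rw [Ext.isSum_iff] at h
  have h1 : supp y x ≤ y := by
    simpa only [supp_apply] using le_leProj_iff.1 (hy.supp_le_leProj hx)
  have h2 : supp y a = y := by
    have := (supp y).add h
    rw [supp_apply] at this
    rw [← Ext.of_inj, ← this]
    refine le_antisymm ?_ le_add_self
    exact (add_le_add (Ext.of_le_of.2 h1) le_rfl).trans (purelyInfinite_iff.1 hy).le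
  refine ⟨supp y, by rwa [h2], supp_mono (le_of_add_eq' h), ?_⟩
  have := (supp y)ᶜ.add h
  rw [Projection.compl_apply_eq_zero_iff.2 (supp_apply y), Ext.of_zero, add_zero, Ext.of_inj] at this
  rw [← this]
  exact hx.projection _

/-- The projection that splits off the purely infinite part of an element. -/
noncomputable def infProj (a : S) : Projection S := (exists_infProj a).choose

theorem purelyInfinite_infProj_apply (a : S) : PurelyInfinite (infProj a a) :=
  (exists_infProj a).choose_spec.1

theorem infProj_le_supp (a : S) : infProj a ≤ supp a := (exists_infProj a).choose_spec.2.1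

theorem directlyFinite_compl_infProj_apply (a : S) : DirectlyFinite ((infProj a)ᶜ a) :=
  (exists_infProj a).choose_spec.2.2

theorem le_infProj_iff {a : S} {p : Projection S} :
    p ≤ infProj a ↔ p ≤ supp a ∧ PurelyInfinite (p a) := by
  constructor
  · intro h
    refine ⟨h.trans (infProj_le_supp a), ?_⟩
    rw [← p.apply_of_le h]
    exact (purelyInfinite_infProj_apply a).projection p
  · rintro ⟨h1, h2⟩
    rw [← disjoint_compl_right_iff, disjoint_iff]
    have h3 : (p ⊓ (infProj a)ᶜ) a = 0 := by
      refine PurelyInfinite.eq_zero (a := (p ⊓ (infProj a)ᶜ) a) ?_ ?_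
      · rw [inf_comm, Projection.inf_apply]
        exact h2.projection _
      · rw [Projection.inf_apply]
        exact (directlyFinite_compl_infProj_apply a).projection _
    have h4 := inf_supp_eq_bot_iff.2 h3
    rwa [inf_eq_left.2 (inf_le_left.trans h1)] at h4

theorem le_compl_infProj_iff {a : S} {p : Projection S} :
    p ≤ (infProj a)ᶜ ↔ DirectlyFinite (p a) := by
  constructor
  · intro h
    rw [← p.apply_of_le h]
    exact (directlyFinite_compl_infProj_apply a).projection p
  · intro h
    rw [le_compl_iff_disjoint_right, disjoint_iff]
    have h3 : (p ⊓ infProj a) a = 0 := by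
      refine PurelyInfinite.eq_zero (a := (p ⊓ infProj a) a) ?_ ?_
      · rw [Projection.inf_apply]
        exact (purelyInfinite_infProj_apply a).projection _
      · rw [inf_comm, Projection.inf_apply]
        exact h.projection _
    have h4 := inf_supp_eq_bot_iff.2 h3
    rwa [inf_eq_left.2 (inf_le_right.trans (infProj_le_supp a))] at h4

/-! ## Strict comparison -/

/-- The largest projection on which `x` is smaller than `y` everywhere. -/
noncomputable def ltProj (x y : S) : Projection S := (leProj y x)ᶜ

theorem le_ltProj_iff {x y : S} {p : Projection S} :
    p ≤ ltProj x y ↔ ∀ q ≤ p, q y ≤ q x → q = ⊥ := by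
  rw [ltProj, le_compl_iff_disjoint_right]
  constructor
  · intro h q hq hle
    exact le_bot_iff.1 (h hq (le_leProj_iff.2 hle))
  · intro h q hq hle
    exact (h q hq (le_leProj_iff.1 hle)).le

theorem ltProj_le_leProj (x y : S) : ltProj x y ≤ leProj x y := compl_leProj_le y x

theorem apply_le_of_le_ltProj {x y : S} {p : Projection S} (h : p ≤ ltProj x y) : p x ≤ p y :=
  le_leProj_iff.1 (h.trans (ltProj_le_leProj x y))

theorem ltProj_le_supp (x y : S) : ltProj x y ≤ supp y := by
  rw [ltProj, ← compl_le_compl_iff_le, compl_compl, le_leProj_iff, le_compl_supp_iff.1 le_rfl]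
  exact DimScale.zero_le _

theorem le_ltProj_of_le {x y x' y' : S} {p : Projection S} (h : p ≤ ltProj x y)
    (hx : p x' ≤ p x) (hy : p y ≤ p y') : p ≤ ltProj x' y' := by
  rw [le_ltProj_iff] at h ⊢
  intro q hq hle
  refine h q hq ?_
  have h1 := q.mono hx
  have h2 := q.mono hy
  rw [q.apply_of_le hq, q.apply_of_le hq] at h1 h2
  exact (h2.trans hle).trans h1

/-- Let `y ≤ z + x`. Where `x ≤ z` the sum is at most `z`, which strictness permits only off the
support of `y`; where `z ≤ x` the sum is `x`. With the next lemma this rewrites removability, the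
relation of (M6), as local strict inequality. -/
theorem PurelyInfinite.removable {z y : S} (hz : PurelyInfinite z) (hzy : z ≤ y)
    (h : supp y ≤ ltProj z y) : Removable z y := by
  refine ⟨algLE_iff.2 hzy, fun x s hs hys => ?_⟩
  rw [algLE_iff] at hys ⊢
  rw [Ext.isSum_iff] at hs
  refine (leProj x z).le_of_apply ?_ ?_
  · set r := leProj x z with hr
    have h1 : r y ≤ r z := by
      refine (r.mono hys).trans (Ext.of_le_of.1 ?_)
      rw [← r.add hs]
      refine (add_le_add le_rfl (Ext.of_le_of.2 (leProj_apply_le x z))).trans ?_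
      exact (purelyInfinite_iff.1 (hz.projection r)).le
    have h2 : r ⊓ supp y = ⊥ := by
      have := le_ltProj_iff.1 h (r ⊓ supp y) inf_le_right
      rw [inf_comm, Projection.inf_apply, Projection.inf_apply] at this
      rw [inf_comm]
      exact this ((supp y).mono h1)
    rw [inf_supp_eq_bot_iff.1 h2]
    exact DimScale.zero_le _
  · set r := (leProj x z)ᶜ with hr
    have h1 : r z ≤ r x := le_leProj_iff.1 (compl_leProj_le x z)
    refine (r.mono hys).trans (Ext.of_le_of.1 ?_)
    rw [← r.add hs]
    exact ((hz.projection r).add_eq h1).le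

/-- If `y ≤ z` on `p`, removability applied to `y ≤ z + pᶜ y` gives `y ≤ pᶜ y`, so `y` vanishes on
`p`. -/
theorem Removable.supp_le_ltProj {z y : S} (hy : PurelyInfinite y) (h : Removable z y) :
    supp y ≤ ltProj z y := by
  rw [le_ltProj_iff]
  intro p hp hle
  have hzy := algLE_iff.1 h.1
  obtain ⟨s, hs, -⟩ := Ext.exists_of_le (show (z + pᶜ y : Ext S) ≤ y from
    (add_le_add (Ext.of_le_of.2 hzy) (Ext.of_le_of.2 (pᶜ.apply_le y))).trans
      (purelyInfinite_iff.1 hy).le)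
  have h1 : y ≤ s := by
    rw [← Ext.of_le_of, ← hs, ← p.add_compl y]
    exact add_le_add (hle.trans (p.apply_le z)) le_rfl
  have h2 := p.mono (algLE_iff.1 (h.2 _ _ hs (algLE_iff.2 h1)))
  rw [Projection.apply_compl_self] at h2
  have h3 := inf_supp_eq_bot_iff.2 (eq_zero_of_le_zero h2)
  rwa [inf_eq_left.2 hp] at h3

end FiniteInfinite

end DimScale

namespace DimScale

/-! ### Boolean-valued ranks of purely infinite elements -/

section Rank

variable {S : Type u} [PartialCommMonoid S] [hS : Fact (IsContinuousDimensionScale S)]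

/-- This turns membership in a supremum into local existence: below any nonzero part of `p` there is
a nonzero part inside a single term. -/
theorem Projection.le_iSup_iff_dense {ι : Sort*} {f : ι → Projection S} {p : Projection S} :
    p ≤ ⨆ i, f i ↔ ∀ q ≤ p, q ≠ ⊥ → ∃ r ≤ q, r ≠ ⊥ ∧ ∃ i, r ≤ f i := by
  constructor
  · intro h q hq h0
    by_contra! hcon
    refine h0 ?_
    rw [← inf_eq_left.2 (hq.trans h), inf_iSup_eq, iSup_eq_bot]
    intro i
    by_contra hi
    exact hcon (q ⊓ f i) inf_le_left hi i inf_le_right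
  · intro h
    by_contra hp
    have h0 : p ⊓ (⨆ i, f i)ᶜ ≠ ⊥ := fun h => hp (by
      rwa [← disjoint_iff, disjoint_compl_right_iff] at h)
    obtain ⟨r, hr, hr0, i, hi⟩ := h _ inf_le_left h0
    refine hr0 (le_bot_iff.1 ?_)
    rw [← inf_compl_eq_bot (a := ⨆ i, f i)]
    exact le_inf (hi.trans (le_iSup f i)) (hr.trans inf_le_right)

theorem supp_eq_of_perp_eq {a b : S} (h : perp {a} = perp {b}) : supp a = supp b := by
  have key : ∀ a b : S, perp {a} = perp {b} → supp a ≤ supp b := by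
    intro a b h
    rw [supp_le_iff, ← Projection.compl_apply_eq_zero_iff, ← inf_supp_eq_bot_iff,
      ← compl_compl (supp b), compl_compl, ← supp_projection_apply, supp_eq_bot_iff]
    -- The part of `a` off `supp b` is orthogonal to `b`, hence to `a`, hence to itself.
    have h1 : (supp b)ᶜ a ∈ perp {b} := by
      rintro _ rfl
      rw [orth_iff_supp, inf_supp_eq_bot_iff, supp_projection_apply, ← inf_supp_eq_bot_iff]
      rw [inf_right_comm, compl_inf_eq_bot, bot_inf_eq]
    rw [← h] at h1
    exact (h1 a rfl).eq_zero (Projection.apply_le _ _)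
  exact le_antisymm (key a b h) (key b a h.symm)

theorem perp_eq_of_supp_eq {a b : S} (h : supp a = supp b) : perp {a} = perp {b} := by
  ext x
  simp only [perp, Set.mem_singleton_iff, forall_eq, orth_iff_supp, h]

/-- `rankProj ξ x` is the largest projection below the support of `x` on which the purely infinite
element `x` has rank at least `ξ` for the ordering of the purely infinite elements. -/
noncomputable def rankProj (ξ : Ordinal.{u}) (x : S) : Projection S :=
  supp x ⊓ ⨅ η : Ordinal.{u}, ⨅ _ : η < ξ, ⨆ y : {y : S // PurelyInfinite y},
    ltProj y.1 x ⊓ rankProj η y.1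
termination_by ξ

/-- The largest projection on which `x` has rank greater than `ξ`. -/
noncomputable def succProj (ξ : Ordinal.{u}) (x : S) : Projection S :=
  ⨆ y : {y : S // PurelyInfinite y}, ltProj y.1 x ⊓ rankProj ξ y.1

theorem le_rankProj_iff {ξ : Ordinal.{u}} {x : S} {p : Projection S} :
    p ≤ rankProj ξ x ↔ p ≤ supp x ∧ ∀ η < ξ, p ≤ succProj η x := by
  rw [rankProj, le_inf_iff, le_iInf₂_iff]
  rfl

theorem rankProj_le_supp (ξ : Ordinal.{u}) (x : S) : rankProj ξ x ≤ supp x :=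
  (le_rankProj_iff.1 le_rfl).1

theorem rankProj_le_succProj {η ξ : Ordinal.{u}} (h : η < ξ) (x : S) :
    rankProj ξ x ≤ succProj η x :=
  (le_rankProj_iff.1 le_rfl).2 η h

theorem rankProj_anti {η ξ : Ordinal.{u}} (h : η ≤ ξ) (x : S) : rankProj ξ x ≤ rankProj η x :=
  le_rankProj_iff.2 ⟨rankProj_le_supp ξ x, fun _ hζ => rankProj_le_succProj (hζ.trans_le h) x⟩

theorem succProj_anti {η ξ : Ordinal.{u}} (h : η ≤ ξ) (x : S) : succProj ξ x ≤ succProj η x :=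
  iSup_mono fun y => inf_le_inf le_rfl (rankProj_anti h y.1)

theorem succProj_le_supp (ξ : Ordinal.{u}) (x : S) : succProj ξ x ≤ supp x :=
  iSup_le fun _ => inf_le_left.trans (ltProj_le_supp _ _)

theorem succProj_le_rankProj (ξ : Ordinal.{u}) (x : S) : succProj ξ x ≤ rankProj ξ x :=
  le_rankProj_iff.2 ⟨succProj_le_supp ξ x, fun _ hη => succProj_anti hη.le x⟩

theorem le_succProj {ξ : Ordinal.{u}} {x y : S} {p : Projection S} (hy : PurelyInfinite y)
    (h : p ≤ ltProj y x) (h' : p ≤ rankProj ξ y) : p ≤ succProj ξ x :=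
  (le_inf h h').trans (le_iSup (fun y : {y : S // PurelyInfinite y} =>
    ltProj y.1 x ⊓ rankProj ξ y.1) ⟨y, hy⟩)

theorem exists_of_le_succProj {ξ : Ordinal.{u}} {x : S} {q : Projection S} (h : q ≤ succProj ξ x)
    (h0 : q ≠ ⊥) : ∃ r ≤ q, r ≠ ⊥ ∧ ∃ y, PurelyInfinite y ∧ r ≤ ltProj y x ∧
      r ≤ rankProj ξ y := by
  obtain ⟨r, hr, hr0, ⟨y, hy⟩, hle⟩ := Projection.le_iSup_iff_dense.1 h q le_rfl h0
  exact ⟨r, hr, hr0, y, hy, hle.trans inf_le_left, hle.trans inf_le_right⟩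

theorem le_succProj_of_apply_le {ξ : Ordinal.{u}} {x x' : S} {p : Projection S} (h : p x ≤ p x')
    (hp : p ≤ succProj ξ x) : p ≤ succProj ξ x' := by
  refine Projection.le_iSup_iff_dense.2 fun q hq h0 => ?_
  obtain ⟨r, hr, hr0, y, hy, h1, h2⟩ := exists_of_le_succProj (hq.trans hp) h0
  refine ⟨r, hr, hr0, ⟨y, hy⟩, le_inf (le_ltProj_of_le h1 le_rfl ?_) h2⟩
  have := r.mono h
  rwa [r.apply_of_le (hr.trans hq), r.apply_of_le (hr.trans hq)] at this

theorem le_supp_of_apply_le {x x' : S} {p : Projection S} (h : p x ≤ p x') (hp : p ≤ supp x) :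
    p ≤ supp x' := by
  have := supp_mono h
  rw [supp_projection_apply, supp_projection_apply, inf_eq_left.2 hp] at this
  exact this.trans inf_le_right

theorem le_rankProj_of_apply_le {ξ : Ordinal.{u}} {x x' : S} {p : Projection S} (h : p x ≤ p x')
    (hp : p ≤ rankProj ξ x) : p ≤ rankProj ξ x' := by
  rw [le_rankProj_iff] at hp ⊢
  exact ⟨le_supp_of_apply_le h hp.1, fun η hη => le_succProj_of_apply_le h (hp.2 η hη)⟩

theorem Projection.le_of_inf_le {p q r : Projection S} (h : p ⊓ r ≤ q) (h' : p ⊓ rᶜ ≤ q) :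
    p ≤ q := by
  rw [← sup_inf_inf_compl (x := p) (y := r)]
  exact sup_le h h'

/-- A purely infinite element may be replaced by a smaller one below a projection. -/
theorem exists_purelyInfinite_glue {w z : S} (hw : PurelyInfinite w) (hz : PurelyInfinite z)
    {r : Projection S} (h : r w ≤ r z) :
    ∃ z' ≤ z, PurelyInfinite z' ∧ r z' = r w ∧ rᶜ z' = rᶜ z := by
  obtain ⟨z', h1, h2, h3⟩ := r.exists_glue (h.trans (r.apply_le z)) (rᶜ.apply_le z)
  refine ⟨z', h1, .of_projection r ?_ ?_, h2, h3⟩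
  · rw [h2]; exact hw.projection r
  · rw [h3]; exact hz.projection _

theorem le_rankProj_glue {ξ : Ordinal.{u}} {w z z' : S} {p r : Projection S}
    (hw : r ≤ rankProj ξ w) (hz : p ≤ rankProj ξ z) (h1 : r z' = r w) (h2 : rᶜ z' = rᶜ z) :
    p ≤ rankProj ξ z' := by
  refine Projection.le_of_inf_le (r := r) ?_ ?_
  · exact inf_le_right.trans (le_rankProj_of_apply_le h1.ge hw)
  · refine le_rankProj_of_apply_le ?_ (inf_le_left.trans hz)
    rw [Projection.inf_apply, Projection.inf_apply, h2]

/-- A local minimality principle: a lower bound of the purely infinite elements of rank at least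
`ξ` on `p` that has itself this property is smaller than all those elements locally. -/
theorem apply_le_of_minimal {ξ : Ordinal.{u}} {p r : Projection S} {z w : S}
    (hz : PurelyInfinite z) (hzp : p ≤ rankProj ξ z)
    (hmin : ∀ y, PurelyInfinite y → p ≤ rankProj ξ y → z ≤ y) (hw : PurelyInfinite w)
    (hwr : r ≤ rankProj ξ w) (h : r w ≤ r z) : r z ≤ r w := by
  -- Replacing `z` by `w` on `r` yields a competitor `z'` for the minimality of `z`.
  obtain ⟨z', -, h1, h2, h3⟩ := exists_purelyInfinite_glue hw hz h
  exact (r.mono (hmin z' h1 (le_rankProj_glue hwr hzp h2 h3))).trans_eq h2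

/-- This is where (M6) enters. Cut down to `p`, all elements of `Y` have the same support, so the
least `c₀` strictly above `z` with that support is below all of them. Then `c₀ ≤ c`, and strictness
passes to `c`. -/
theorem le_ltProj_of_isGLB {z c : S} (hz : PurelyInfinite z) {p : Projection S} {Y : Set S}
    (hne : Y.Nonempty) (hY : ∀ y ∈ Y, PurelyInfinite y) (h : ∀ y ∈ Y, p ≤ ltProj z y)
    (hc : IsGLB Y c) : p ≤ ltProj z c := by
  have hsupp : ∀ y ∈ Y, supp (p y) = p := fun y hy => by
    rw [supp_projection_apply, inf_eq_left]
    exact (h y hy).trans (ltProj_le_supp _ _)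
  have hrem : ∀ y ∈ Y, Removable (p z) (p y) := fun y hy => by
    refine (hz.projection p).removable (apply_le_of_le_ltProj (h y hy)) ?_
    rw [hsupp y hy]
    exact le_ltProj_of_le (h y hy) (p.idem z).le (p.idem y).ge
  obtain ⟨y₀, hy₀⟩ := hne
  obtain ⟨c₀, ⟨h1, h2, h3⟩, h4⟩ := hS.1.exists_least _ _ (hz.projection p)
    ((hY y₀ hy₀).projection p) (hrem y₀ hy₀)
  have h5 := h2.supp_le_ltProj h1
  rw [supp_eq_of_perp_eq h3, hsupp y₀ hy₀] at h5
  have h6 : c₀ ≤ c := hc.2 fun y hy => by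
    refine (algLE_iff.1 (h4 (p y) ((hY y hy).projection p) (hrem y hy) ?_)).trans (p.apply_le y)
    exact perp_eq_of_supp_eq (by rw [hsupp y hy, hsupp y₀ hy₀])
  exact le_ltProj_of_le h5 (p.idem z).ge (p.mono h6)

/-- For `η < θ` the infimum `z` of all elements of rank at least `η` on `p` has the same property by
induction. It is strictly below each `y ∈ Y`, hence strictly below `c`, and so witnesses that `c`
has rank greater than `η`. -/
theorem le_rankProj_of_isGLB (θ : Ordinal.{u}) : ∀ {p : Projection S} {Y : Set S} {c : S},
    Y.Nonempty → (∀ y ∈ Y, PurelyInfinite y) → (∀ y ∈ Y, p ≤ rankProj θ y) → IsGLB Y c →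
    p ≤ rankProj θ c := by
  induction θ using WellFoundedLT.induction with
  | ind θ ih =>
  intro p Y c hne hY hp hc
  rw [le_rankProj_iff]
  constructor
  -- Being strictly above `0` on `p` means having `p` below the support.
  · refine (le_ltProj_of_isGLB purelyInfinite_zero hne hY (fun y hy => ?_) hc).trans
      (ltProj_le_supp _ _)
    exact (hp y hy).trans (rankProj_le_supp _ _)
  · intro η hη
    set W : Set S := {w | PurelyInfinite w ∧ p ≤ rankProj η w} with hW
    have hWne : W.Nonempty := by
      obtain ⟨y, hy⟩ := hne
      exact ⟨y, hY y hy, (hp y hy).trans (rankProj_anti hη.le y)⟩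
    obtain ⟨z, hz⟩ := exists_isGLB hWne
    have hzp : p ≤ rankProj η z := ih η hη hWne (fun w hw => hw.1) (fun w hw => hw.2) hz
    have hzI : PurelyInfinite z := .of_isGLB (fun w hw => hw.1) hz hWne
    refine le_succProj hzI (le_ltProj_of_isGLB hzI hne hY (fun y hy => ?_) hc) hzp
    rw [le_ltProj_iff]
    intro q hq hle
    by_contra h0
    -- If `y ≤ z` on `q`, an element `w` of rank at least `η` strictly below `y` on `r` is also
    -- below `z` there. Minimality of `z` gives `y ≤ z ≤ w` on `r`, a contradiction.
    obtain ⟨r, hr, hr0, w, hw, h1, h2⟩ :=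
      exists_of_le_succProj (hq.trans ((hp y hy).trans (rankProj_le_succProj hη y))) h0
    have h3 : r y ≤ r z := by
      simpa only [r.apply_of_le hr] using r.mono hle
    have h4 : r w ≤ r z := (apply_le_of_le_ltProj h1).trans h3
    have h5 := apply_le_of_minimal hzI hzp (fun y h h' => hz.1 ⟨h, h'⟩) hw h2 h4
    exact hr0 (le_ltProj_iff.1 h1 r le_rfl (h3.trans h5))

/-- The ordinals of universe `u` do not inject into the type `S → Projection S` of that universe, so
the functions `rankProj ξ` repeat. -/
theorem exists_rankProj_eq_succ :
    ∃ θ : Ordinal.{u}, ∀ x : S, rankProj θ x ≤ succProj θ x := by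
  have h := not_injective_of_ordinal.{u} (fun ξ : Ordinal.{u} => (rankProj ξ : S → Projection S))
  rw [Function.not_injective_iff] at h
  obtain ⟨ξ, η, he, hne⟩ := h
  wlog hlt : ξ < η generalizing ξ η
  · exact this η ξ he.symm hne.symm (lt_of_le_of_ne (not_lt.1 hlt) hne.symm)
  exact ⟨ξ, fun x => (congrFun he x).le.trans (rankProj_le_succProj hlt x)⟩

/-- At a stable rank `θ`, the infimum of the elements of rank at least `θ` on `p` has rank greater
than `θ`. This gives a strictly smaller element of rank at least `θ` somewhere below `p`, against
minimality. -/
theorem eq_bot_of_forall_le_succProj {x : S} (hx : PurelyInfinite x) {p : Projection S}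
    (h : ∀ ξ, p ≤ succProj ξ x) : p = ⊥ := by
  obtain ⟨θ, hθ⟩ := exists_rankProj_eq_succ (S := S)
  set Y : Set S := {y | PurelyInfinite y ∧ p ≤ rankProj θ y} with hY
  have hne : Y.Nonempty := ⟨x, hx, (h θ).trans (succProj_le_rankProj θ x)⟩
  obtain ⟨c, hc⟩ := exists_isGLB hne
  have hcp : p ≤ rankProj θ c :=
    le_rankProj_of_isGLB θ hne (fun w hw => hw.1) (fun w hw => hw.2) hc
  have hcI : PurelyInfinite c := .of_isGLB (fun w hw => hw.1) hc hne
  by_contra h0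
  obtain ⟨r, hr, hr0, z, hz, h1, h2⟩ := exists_of_le_succProj (hcp.trans (hθ c)) h0
  have h5 := apply_le_of_minimal hcI hcp (fun y h h' => hc.1 ⟨h, h'⟩) hz h2
    (apply_le_of_le_ltProj h1)
  exact hr0 (le_ltProj_iff.1 h1 r le_rfl h5)

/-- `x` has constant rank `ξ` on `p`. -/
structure HasRank (ξ : Ordinal.{u}) (x : S) (p : Projection S) : Prop where
  le_rank : p ≤ rankProj ξ x
  le_compl : p ≤ (succProj ξ x)ᶜ

theorem HasRank.mono {ξ : Ordinal.{u}} {x : S} {p q : Projection S} (h : HasRank ξ x p)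
    (hq : q ≤ p) : HasRank ξ x q := ⟨hq.trans h.1, hq.trans h.2⟩

theorem HasRank.not_le_succProj {ξ : Ordinal.{u}} {x : S} {p q : Projection S}
    (h : HasRank ξ x p) (hq : q ≤ p) (hq' : q ≤ succProj ξ x) : q = ⊥ :=
  le_bot_iff.1 ((le_inf hq' (hq.trans h.2)).trans inf_compl_eq_bot.le)

theorem HasRank.congr {ξ : Ordinal.{u}} {x x' : S} {p : Projection S} (h : HasRank ξ x p)
    (hx : p x = p x') : HasRank ξ x' p := by
  refine ⟨le_rankProj_of_apply_le hx.le h.1, ?_⟩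
  rw [le_compl_iff_disjoint_right, disjoint_iff]
  refine h.not_le_succProj inf_le_left (le_succProj_of_apply_le ?_ inf_le_right)
  rw [inf_comm, Projection.inf_apply, Projection.inf_apply, hx]

theorem HasRank.lt {ξ ζ : Ordinal.{u}} {x y : S} {p : Projection S} (hx : HasRank ξ x p)
    (hy : HasRank ζ y p) (hyI : PurelyInfinite y) (hlt : p ≤ ltProj y x) (h0 : p ≠ ⊥) : ζ < ξ := by
  by_contra! hle
  exact h0 (hx.not_le_succProj le_rfl (le_succProj hyI hlt (hy.1.trans (rankProj_anti hle y))))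

/-- Take the least `ξ` for which the rank does not exceed `ξ` throughout `p`, and keep the part of
`p` where it does not. -/
theorem exists_hasRank {x : S} (hx : PurelyInfinite x) {p : Projection S} (hp : p ≤ supp x)
    (h0 : p ≠ ⊥) : ∃ ξ, ∃ q ≤ p, q ≠ ⊥ ∧ HasRank ξ x q := by
  have hne : {ξ | ¬ p ≤ succProj ξ x}.Nonempty := by
    by_contra! hcon
    refine h0 (eq_bot_of_forall_le_succProj hx fun ξ => ?_)
    by_contra hξ
    exact (hcon ▸ hξ : ξ ∈ (∅ : Set Ordinal.{u}))
  have h1 : ¬ p ≤ succProj (sInf {ξ | ¬ p ≤ succProj ξ x}) x := csInf_mem hne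
  refine ⟨sInf {ξ | ¬ p ≤ succProj ξ x}, p ⊓ (succProj (sInf {ξ | ¬ p ≤ succProj ξ x}) x)ᶜ,
    inf_le_left, fun h => h1 ?_, inf_le_left.trans (le_rankProj_iff.2 ⟨hp, fun η hη => ?_⟩),
    inf_le_right⟩
  · rwa [← disjoint_iff, disjoint_compl_right_iff] at h
  · by_contra hcon
    exact absurd (csInf_le' (show η ∈ {ξ | ¬ p ≤ succProj ξ x} from hcon)) (not_le.2 hη)

/-- Among the elements below `x` that have rank at least `ξ` and constant rank on some nonzero part
of `p`, minimize that rank. If the minimum exceeded `ξ`, a strictly smaller element would have a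
lower one. -/
theorem exists_hasRank_le {ξ : Ordinal.{u}} {x : S} (hx : PurelyInfinite x) {p : Projection S}
    (hp : p ≤ rankProj ξ x) (h0 : p ≠ ⊥) :
    ∃ q ≤ p, q ≠ ⊥ ∧ ∃ y ≤ x, PurelyInfinite y ∧ HasRank ξ y q := by
  set Z : Set Ordinal.{u} := {ζ | ∃ q ≤ p, q ≠ ⊥ ∧ ∃ y ≤ x, PurelyInfinite y ∧
    q ≤ rankProj ξ y ∧ HasRank ζ y q} with hZ
  have hne : Z.Nonempty := by
    obtain ⟨ζ, q, hq, hq0, hr⟩ := exists_hasRank hx (hp.trans (rankProj_le_supp ξ x)) h0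
    exact ⟨ζ, q, hq, hq0, x, le_rfl, hx, hq.trans hp, hr⟩
  obtain ⟨q, hq, hq0, y, hyx, hy, hqy, hr⟩ : sInf Z ∈ Z := csInf_mem hne
  rcases lt_trichotomy (sInf Z) ξ with hlt | heq | hlt
  · exact absurd (hr.not_le_succProj le_rfl (hqy.trans (rankProj_le_succProj hlt y))) hq0
  · exact ⟨q, hq, hq0, y, hyx, hy, heq ▸ hr⟩
  · obtain ⟨r, hrq, hr0, z, hz, h1, h2⟩ :=
      exists_of_le_succProj (hr.1.trans (rankProj_le_succProj hlt y)) hq0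
    obtain ⟨ζ, r', hr', hr0', h3⟩ := exists_hasRank hz (h2.trans (rankProj_le_supp ξ z)) hr0
    have h4 := (hr.mono (hr'.trans hrq)).lt h3 hz (hr'.trans h1) hr0'
    have h5 : ζ ∈ Z := by
      refine ⟨r', (hr'.trans hrq).trans hq, hr0', r' z, ?_, hz.projection r', ?_,
        h3.congr (r'.idem z).symm⟩
      · exact ((apply_le_of_le_ltProj (hr'.trans h1)).trans (r'.apply_le y)).trans hyx
      · exact le_rankProj_of_apply_le (r'.idem z).ge (hr'.trans h2)
    exact absurd (csInf_le' h5) (not_le.2 h4)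

end Rank

end DimScale

namespace DimScale

section Ultrafilters

variable {S : Type u} [PartialCommMonoid S] [hS : Fact (IsContinuousDimensionScale S)]

/-! ## The ultrafilter space -/

theorem basicSet_mono {p q : Projection S} (h : p ≤ q) : basicSet p ⊆ basicSet q :=
  fun _ hω => Order.PFilter.mem_of_le h hω

theorem mem_basicSet_inf {p q : Projection S} {ω : UltrafilterSpace S} :
    ω ∈ basicSet (p ⊓ q) ↔ ω ∈ basicSet p ∧ ω ∈ basicSet q :=
  Order.PFilter.inf_mem_iff

theorem mem_basicSet_top (ω : UltrafilterSpace S) : ω ∈ basicSet (⊤ : Projection S) :=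
  Order.PFilter.top_mem

theorem notMem_basicSet_bot (ω : UltrafilterSpace S) : ω ∉ basicSet (⊥ : Projection S) :=
  fun h => ω.2.1 (Set.eq_univ_of_forall fun _ => Order.PFilter.mem_of_le bot_le h)

/-- If `p` is not in the maximal filter, adjoining it generates an improper filter, so some member
of the filter is disjoint from `p`. -/
theorem mem_basicSet_compl {p : Projection S} {ω : UltrafilterSpace S} :
    ω ∈ basicSet pᶜ ↔ ω ∉ basicSet p := by
  constructor
  · intro h h'
    refine notMem_basicSet_bot ω ?_
    rw [← inf_compl_eq_bot (a := p)]
    exact mem_basicSet_inf.2 ⟨h', h⟩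
  · intro h
    have hF : Order.IsPFilter {x : Projection S | ∃ f ∈ ω.1, f ⊓ p ≤ x} := by
      refine .of_def ⟨⊤, ⊤, Order.PFilter.top_mem, le_top⟩ ?_ ?_
      · rintro x ⟨f, hf, hx⟩ y ⟨g, hg, hy⟩
        exact ⟨x ⊓ y, ⟨f ⊓ g, Order.PFilter.inf_mem hf hg,
          le_inf ((inf_le_inf_right p inf_le_left).trans hx)
            ((inf_le_inf_right p inf_le_right).trans hy)⟩, inf_le_left, inf_le_right⟩
      · rintro x y hxy ⟨f, hf, hx⟩
        exact ⟨f, hf, hx.trans hxy⟩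
    have hle : ω.1 ≤ hF.toPFilter := fun x hx => ⟨x, hx, inf_le_left⟩
    have hbot : ⊥ ∈ hF.toPFilter := by
      by_contra hcon
      have h1 : (hF.toPFilter : Set (Projection S)) ≠ Set.univ := fun h =>
        hcon (by rw [← SetLike.mem_coe, h]; trivial)
      exact h (ω.2.2 h1 hle ⟨⊤, Order.PFilter.top_mem, inf_le_right⟩)
    obtain ⟨f, hf, hfp⟩ := hbot
    exact Order.PFilter.mem_of_le (disjoint_iff_inf_le.2 hfp).le_compl_right hf

theorem mem_basicSet_sup {p q : Projection S} {ω : UltrafilterSpace S} :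
    ω ∈ basicSet (p ⊔ q) ↔ ω ∈ basicSet p ∨ ω ∈ basicSet q := by
  rw [← not_iff_not, ← mem_basicSet_compl, compl_sup, mem_basicSet_inf, mem_basicSet_compl,
    mem_basicSet_compl, not_or]

/-- The complement of a prime ideal that avoids `p` is an ultrafilter containing `p`. -/
theorem exists_mem_basicSet {p : Projection S} (hp : p ≠ ⊥) :
    ∃ ω : UltrafilterSpace S, ω ∈ basicSet p := by
  have hd : Disjoint (Order.PFilter.principal p : Set (Projection S))
      (Order.Ideal.principal (⊥ : Projection S) : Set (Projection S)) := by
    rw [Set.disjoint_left]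
    intro q hq hq'
    exact hp (le_bot_iff.1 (le_trans (Order.PFilter.mem_principal.1 hq)
      (Order.Ideal.mem_principal.1 hq')))
  obtain ⟨J, hJ, -, hdJ⟩ := DistribLattice.prime_ideal_of_disjoint_filter_ideal hd
  have hmem : ∀ x, x ∈ hJ.compl_filter.toPFilter ↔ x ∉ J := fun x => Iff.rfl
  refine ⟨⟨hJ.compl_filter.toPFilter, ?_, ?_⟩, ?_⟩
  · intro h
    exact (hmem ⊥).1 (h ▸ Set.mem_univ _ : (⊥ : Projection S) ∈
      (hJ.compl_filter.toPFilter : Set (Projection S))) (Order.Ideal.bot_mem J)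
  · intro G hG hle q hq
    rw [hmem]
    intro hqJ
    have h1 : qᶜ ∈ G := hle <| (hmem _).2 fun h => hJ.toIsProper.top_notMem (by
      rw [← sup_compl_eq_top (x := q)]
      exact Order.Ideal.sup_mem hqJ h)
    refine hG (Set.eq_univ_of_forall fun x => ?_)
    have h2 := Order.PFilter.inf_mem hq h1
    rw [inf_compl_eq_bot] at h2
    exact Order.PFilter.mem_of_le bot_le h2
  · exact (hmem p).2 fun h => Set.disjoint_left.1 hdJ (Order.PFilter.mem_principal.2 le_rfl) h

theorem isOpen_basicSet (p : Projection S) : IsOpen (basicSet p) :=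
  TopologicalSpace.isOpen_generateFrom_of_mem ⟨p, rfl⟩

theorem basicSet_compl (p : Projection S) : basicSet pᶜ = (basicSet p)ᶜ :=
  Set.ext fun _ => mem_basicSet_compl

theorem isClopen_basicSet (p : Projection S) : IsClopen (basicSet p) := by
  refine ⟨⟨?_⟩, isOpen_basicSet p⟩
  rw [← basicSet_compl]
  exact isOpen_basicSet _

theorem isTopologicalBasis_basicSet : TopologicalSpace.IsTopologicalBasis
    (Set.range (basicSet : Projection S → Set (UltrafilterSpace S))) where
  exists_subset_inter := by
    rintro _ ⟨p, rfl⟩ _ ⟨q, rfl⟩ ω hω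
    exact ⟨basicSet (p ⊓ q), ⟨_, rfl⟩, mem_basicSet_inf.2 hω, fun _ h => mem_basicSet_inf.1 h⟩
  sUnion_eq := Set.eq_univ_of_forall fun ω => ⟨_, ⟨⊤, rfl⟩, mem_basicSet_top ω⟩
  eq_generateFrom := rfl

theorem exists_basicSet_subset {U : Set (UltrafilterSpace S)} (hU : IsOpen U)
    {ω : UltrafilterSpace S} (hω : ω ∈ U) : ∃ p : Projection S, ω ∈ basicSet p ∧ basicSet p ⊆ U := by
  obtain ⟨_, ⟨p, rfl⟩, h1, h2⟩ := isTopologicalBasis_basicSet.exists_subset_of_mem_open hω hU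
  exact ⟨p, h1, h2⟩

theorem ne_bot_of_mem_basicSet {p : Projection S} {ω : UltrafilterSpace S} (h : ω ∈ basicSet p) :
    p ≠ ⊥ := by
  rintro rfl
  exact notMem_basicSet_bot ω h

theorem le_of_basicSet_subset {p q : Projection S} (h : basicSet p ⊆ basicSet q) : p ≤ q := by
  by_contra hpq
  have h0 : p ⊓ qᶜ ≠ ⊥ := fun h => hpq (by
    rwa [← disjoint_iff, disjoint_compl_right_iff] at h)
  obtain ⟨ω, hω⟩ := exists_mem_basicSet h0
  rw [mem_basicSet_inf, mem_basicSet_compl] at hω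
  exact hω.2 (h hω.1)

theorem exists_le_basicSet_subset {U : Set (UltrafilterSpace S)} (hU : IsOpen U)
    {ω : UltrafilterSpace S} (hω : ω ∈ U) {p : Projection S} (hp : ω ∈ basicSet p) :
    ∃ q ≤ p, q ≠ ⊥ ∧ ω ∈ basicSet q ∧ basicSet q ⊆ U := by
  obtain ⟨q, h1, h2⟩ := exists_basicSet_subset hU hω
  have h3 := mem_basicSet_inf.2 ⟨hp, h1⟩
  exact ⟨p ⊓ q, inf_le_left, ne_bot_of_mem_basicSet h3, h3, (basicSet_mono inf_le_right).trans h2⟩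

/-- Continuous functions need only be compared at one point of each nonempty `Ω_p`; this permits
passing to a smaller nonzero projection as often as needed. -/
theorem eq_of_dense_basicSet {X : Type*} [TopologicalSpace X] [T2Space X]
    {f g : UltrafilterSpace S → X} (hf : Continuous f) (hg : Continuous g)
    (h : ∀ p : Projection S, p ≠ ⊥ → ∃ ω ∈ basicSet p, f ω = g ω) : f = g := by
  refine hf.ext_on (s := {ω | f ω = g ω}) ?_ hg fun ω hω => hω
  rw [isTopologicalBasis_basicSet.dense_iff]
  rintro _ ⟨p, rfl⟩ ⟨ω, hω⟩
  obtain ⟨ω', h1, h2⟩ := h p (ne_bot_of_mem_basicSet hω)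
  exact ⟨ω', h1, h2⟩

theorem summandSet_eq (p : Projection S) : summandSet (Set.range p) = basicSet p := by
  ext ω
  constructor
  · rintro ⟨q, hq, hω⟩
    exact basicSet_mono (Projection.le_iff_range.2 hq.le) hω
  · intro hω
    exact ⟨p, rfl, hω⟩

/-! ## The type decomposition -/

variable (S) in
/-- The projection onto `S_I`. -/
noncomputable def projI : Projection S := perpProj (perp (mfSet S))

variable (S) in
/-- The projection onto `S_III`. -/
noncomputable def projIII : Projection S := perpProj (finSet S)

variable (S) in
/-- The projection onto `S_II`. -/
noncomputable def projII : Projection S := (projI S)ᶜ ⊓ (projIII S)ᶜ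

theorem range_projI : Set.range (projI S) = typeI S := range_perpProj _

theorem range_projIII : Set.range (projIII S) = typeIII S := range_perpProj _

theorem Projection.range_inf (p q : Projection S) :
    Set.range ⇑(p ⊓ q) = Set.range p ∩ Set.range q := by
  ext x
  exact ⟨fun h => ⟨le_iff_range.1 inf_le_left h, le_iff_range.1 inf_le_right h⟩,
    fun h => mem_range_inf h.1 h.2⟩

theorem range_projII : Set.range (projII S) = typeII S := by
  rw [projII, Projection.range_inf, Projection.range_compl, Projection.range_compl, range_projI,
    range_projIII, typeI, perp_perp_perp]
  rfl

theorem summandSet_typeI : summandSet (typeI S) = basicSet (projI S) := by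
  rw [← range_projI, summandSet_eq]

theorem summandSet_typeII : summandSet (typeII S) = basicSet (projII S) := by
  rw [← range_projII, summandSet_eq]

theorem summandSet_typeIII : summandSet (typeIII S) = basicSet (projIII S) := by
  rw [← range_projIII, summandSet_eq]

theorem le_projIII_iff {p : Projection S} :
    p ≤ projIII S ↔ ∀ x, DirectlyFinite (p x) → p x = 0 := by
  rw [Projection.le_iff_range, range_projIII, typeIII]
  constructor
  · intro h x hx
    exact (h ⟨x, rfl⟩ _ hx).eq_zero le_rfl
  · rintro h _ ⟨x, rfl⟩ y hy
    refine orth_iff.2 fun z hz hzy => ?_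
    have hz' := p.apply_eq_of_le hz
    rw [← hz']
    refine h z ?_
    rw [hz']
    exact DirectlyFinite.mono hy hzy

theorem supp_le_projI {x : S} (h : MultipleFree x) : supp x ≤ projI S := by
  rw [supp_le_iff, ← Projection.mem_range, range_projI]
  exact subset_perp_perp _ h

theorem supp_le_compl_projIII {x : S} (h : DirectlyFinite x) : supp x ≤ (projIII S)ᶜ := by
  rw [supp_le_iff, ← Projection.mem_range, Projection.range_compl, range_projIII]
  exact subset_perp_perp _ h

theorem projI_le_compl_projIII : projI S ≤ (projIII S)ᶜ := by
  rw [Projection.le_iff_range, Projection.range_compl, range_projI, range_projIII]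
  exact perp_anti (perp_anti fun x (hx : MultipleFree x) => hx.directlyFinite)

theorem mem_type_cases (ω : UltrafilterSpace S) :
    ω ∈ basicSet (projI S) ∨ ω ∈ basicSet (projII S) ∨ ω ∈ basicSet (projIII S) := by
  by_cases h : ω ∈ basicSet (projI S)
  · exact Or.inl h
  by_cases h' : ω ∈ basicSet (projIII S)
  · exact Or.inr (Or.inr h')
  · exact Or.inr (Or.inl (mem_basicSet_inf.2 ⟨mem_basicSet_compl.2 h, mem_basicSet_compl.2 h'⟩))

end Ultrafilters

/-! ## Values -/

namespace AlephExt

theorem continuous_iff {X F : Type*} [TopologicalSpace X] [LinearOrder F] {f : X → F}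
    [TopologicalSpace F] [OrderTopology F] : Continuous f ↔
      ∀ a, IsOpen {x | a < f x} ∧ IsOpen {x | f x < a} :=
  OrderTopology.continuous_iff

theorem _root_.DimScale.ZInf.strictMono_toRInf : StrictMono ZInf.toRInf.{u} := by
  rintro (a | α) (b | β) h <;> simp_all [ZInf.toRInf, map]

theorem _root_.DimScale.TwoInf.strictMono_toRInf : StrictMono TwoInf.toRInf.{u} := by
  rintro (a | α) (b | β) h
  · exact absurd h (by simp)
  all_goals simp_all [TwoInf.toRInf, map]

theorem _root_.DimScale.ZInf.continuous_toRInf : Continuous ZInf.toRInf.{u} := by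
  refine continuous_iff.2 ?_
  rintro (r | ξ)
  · constructor
    -- A natural number exceeds `r` iff it exceeds `⌊r⌋₊`, and is less than `r` iff it is less than
    -- `⌈r⌉₊`; so rays pull back to rays.
    · convert isOpen_Ioi (a := (fin ⌊r⌋₊ : ZInf.{u})) using 1
      ext (n | ξ) <;> simp [ZInf.toRInf, map, Nat.floor_lt]
    · convert isOpen_Iio (a := (fin ⌈r⌉₊ : ZInf.{u})) using 1
      ext (n | ξ) <;> simp [ZInf.toRInf, map, Nat.lt_ceil]
  · constructor
    · convert isOpen_Ioi (a := (aleph ξ : ZInf.{u})) using 1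
      ext (n | ξ) <;> simp [ZInf.toRInf, map]
    · convert isOpen_Iio (a := (aleph ξ : ZInf.{u})) using 1
      ext (n | ξ) <;> simp [ZInf.toRInf, map]

theorem _root_.DimScale.TwoInf.continuous_toRInf : Continuous TwoInf.toRInf.{u} := by
  refine continuous_iff.2 ?_
  rintro (r | ξ)
  · constructor
    · convert isOpen_Ioi (a := (fin PUnit.unit : TwoInf.{u})) using 1
      ext (n | ξ) <;> simp [TwoInf.toRInf, map]
    -- Nothing lies below `0`, and for `r > 0` only `0` has its image below `r`.
    · rcases eq_or_ne r 0 with rfl | hr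
      · convert isOpen_empty
        ext (n | ξ) <;> simp [TwoInf.toRInf, map]
      · convert isOpen_Iio (a := (aleph 0 : TwoInf.{u})) using 1
        ext (n | ξ) <;> simp [TwoInf.toRInf, map, pos_iff_ne_zero, hr]
  · constructor
    · convert isOpen_Ioi (a := (aleph ξ : TwoInf.{u})) using 1
      ext (n | ξ) <;> simp [TwoInf.toRInf, map]
    · convert isOpen_Iio (a := (aleph ξ : TwoInf.{u})) using 1
      ext (n | ξ) <;> simp [TwoInf.toRInf, map]

/-- A strictly monotone map between linear orders reflects `<`, so open rays of `F` pull back along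
`f` to preimages of open rays of `G`. Continuity of `φ` plays no role. -/
theorem continuous_of_strictMono_comp {X F G : Type*} [TopologicalSpace X] [LinearOrder F]
    [TopologicalSpace F] [OrderTopology F] [LinearOrder G] [TopologicalSpace G] [OrderTopology G]
    {φ : F → G} (hφ : StrictMono φ) {f : X → F} (h : Continuous fun x => φ (f x)) :
    Continuous f := by
  refine continuous_iff.2 fun a => ?_
  have := continuous_iff.1 h (φ a)
  simpa only [hφ.lt_iff_lt] using this

end AlephExt

/-! ### The function monoid as a set of continuous `ℝ_∞`-valued maps -/

section MixedC

variable {S : Type u} [PartialCommMonoid S] [hS : Fact (IsContinuousDimensionScale S)]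

theorem continuousAt_of_eq_comp {X Y Z : Type*} [TopologicalSpace X] [TopologicalSpace Y]
    [TopologicalSpace Z] {f : X → Y} {U : Set X} (hU : IsOpen U) {φ : Z → Y} (hφ : Continuous φ)
    (g : C(U, Z)) (h : ∀ ω : U, f ω = φ (g ω)) {ω : X} (hω : ω ∈ U) : ContinuousAt f ω := by
  have h1 : (f ∘ Subtype.val : U → Y) = φ ∘ g := funext h
  have h2 : ContinuousAt (f ∘ Subtype.val : U → Y) ⟨ω, hω⟩ := by
    rw [h1]
    exact (hφ.comp g.continuous).continuousAt
  exact hU.isOpenEmbedding_subtypeVal.continuousAt_iff.1 h2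

theorem exists_continuousMap_of_strictMono {X F G : Type*} [TopologicalSpace X] [LinearOrder F]
    [TopologicalSpace F] [OrderTopology F] [LinearOrder G] [TopologicalSpace G] [OrderTopology G]
    {φ : F → G} (hφ : StrictMono φ) {f : X → G} (hf : Continuous f) {U : Set X}
    (h : ∀ x ∈ U, f x ∈ Set.range φ) : ∃ g : C(U, F), ∀ x : U, f x = φ (g x) := by
  choose g hg using fun x : U => h x x.2
  refine ⟨⟨g, AlephExt.continuous_of_strictMono_comp hφ ?_⟩, fun x => (hg x).symm⟩
  simp only [hg]
  exact hf.comp continuous_subtype_val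

/-- The three summands are open and cover `Ω`, so continuity on the pieces is continuity on `Ω`.
Conversely, the strictly monotone inclusions allow the codomain to be restricted. -/
theorem mem_scaleFunctions_iff {f : UltrafilterSpace S → RInf.{u}} : f ∈ ScaleFunctions S ↔
    Continuous f ∧ (∀ ω ∈ basicSet (projI S), f ω ∈ Set.range ZInf.toRInf) ∧
      (∀ ω ∈ basicSet (projIII S), f ω ∈ Set.range TwoInf.toRInf) := by
  have hI : IsOpen (summandSet (typeI S)) := summandSet_typeI (S := S) ▸ isOpen_basicSet _
  have hII : IsOpen (summandSet (typeII S)) := summandSet_typeII (S := S) ▸ isOpen_basicSet _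
  have hIII : IsOpen (summandSet (typeIII S)) := summandSet_typeIII (S := S) ▸ isOpen_basicSet _
  rw [← summandSet_typeI, ← summandSet_typeIII]
  constructor
  · rintro ⟨⟨g₁, h₁⟩, ⟨g₂, h₂⟩, ⟨g₃, h₃⟩⟩
    refine ⟨continuous_iff_continuousAt.2 fun ω => ?_, fun ω hω => ⟨_, (h₁ ⟨ω, hω⟩).symm⟩,
      fun ω hω => ⟨_, (h₃ ⟨ω, hω⟩).symm⟩⟩
    rcases mem_type_cases ω with h | h | h
    · rw [← summandSet_typeI] at h
      exact continuousAt_of_eq_comp hI ZInf.continuous_toRInf g₁ h₁ h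
    · rw [← summandSet_typeII] at h
      exact continuousAt_of_eq_comp hII continuous_id g₂ h₂ h
    · rw [← summandSet_typeIII] at h
      exact continuousAt_of_eq_comp hIII TwoInf.continuous_toRInf g₃ h₃ h
  · rintro ⟨hf, h1, h3⟩
    exact ⟨exists_continuousMap_of_strictMono ZInf.strictMono_toRInf hf h1,
      ⟨⟨fun x => f x, hf.comp continuous_subtype_val⟩, fun _ => rfl⟩,
      exists_continuousMap_of_strictMono TwoInf.strictMono_toRInf hf h3⟩

end MixedC

end DimScale

namespace DimScale

open scoped ENNReal

/-! ### Counting how often units fit into an element -/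

section Multiples

variable {S : Type u} [PartialCommMonoid S] [hS : Fact (IsContinuousDimensionScale S)]

theorem Projection.map_nsmul (p : Projection S) {k : ℕ} {a c : S} (h : k • (a : Ext S) = c) :
    k • (p a : Ext S) = p c := by
  induction k generalizing c with
  | zero =>
    rw [zero_nsmul, ← Ext.of_zero, Ext.of_inj] at h
    rw [zero_nsmul, ← h, p.map_zero, Ext.of_zero]
  | succ k ih =>
    rw [succ_nsmul] at h
    obtain ⟨b, -, hb, -⟩ := Ext.exists_of_add_eq h
    rw [hb] at h
    rw [succ_nsmul, ih hb, p.add h]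

theorem DirectlyFinite.nsmul {a c : S} (ha : DirectlyFinite a) {k : ℕ}
    (h : k • (a : Ext S) = c) : DirectlyFinite c := by
  induction k generalizing c with
  | zero =>
    rw [zero_nsmul, ← Ext.of_zero, Ext.of_inj] at h
    exact h ▸ directlyFinite_zero
  | succ k ih =>
    rw [succ_nsmul] at h
    obtain ⟨b, -, hb, -⟩ := Ext.exists_of_add_eq h
    rw [hb] at h
    exact (ih hb).add ha h

/-- An orthogonal family of directly finite elements whose supports cover the complement of the
type III part. -/
structure IsUnitFamily {ι : Type*} (h : ι → S) : Prop where
  fin : ∀ i, DirectlyFinite (h i)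
  orth : ∀ i j, i ≠ j → supp (h i) ⊓ supp (h j) = ⊥
  cover : ∀ p : Projection S, p ≤ (projIII S)ᶜ → p ≠ ⊥ → ∃ i, p ⊓ supp (h i) ≠ ⊥

variable {ι : Type*} {h : ι → S}

/-- The largest projection on which `k` times each element of the family `h` is below `a`. -/
noncomputable def multProj (h : ι → S) (k : ℕ) (a : S) : Projection S :=
  sSup {p | ∀ i, k • (p (h i) : Ext S) ≤ p a}

/-- Each index has its own largest projection; the supremum defining `multProj` equals the infimum
of these, so it has the defining property itself. -/
theorem IsUnitFamily.le_multProj_iff (hu : IsUnitFamily h) {k : ℕ} {a : S} {p : Projection S} :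
    p ≤ multProj h k a ↔ ∀ i, k • (p (h i) : Ext S) ≤ p a := by
  choose P hP using fun i => exists_nsmul_le_projection (hu.fin i) k a
  have : multProj h k a = ⨅ i, P i := by
    refine le_antisymm (sSup_le fun q hq => le_iInf fun i => (hP i q).2 (hq i)) (le_sSup fun i => ?_)
    exact (hP i _).1 (iInf_le P i)
  rw [this, le_iInf_iff]
  exact forall_congr' fun i => hP i p

theorem IsUnitFamily.multProj_apply (hu : IsUnitFamily h) {k : ℕ} {a : S} {p : Projection S}
    (hp : p ≤ multProj h k a) (i : ι) : k • (p (h i) : Ext S) ≤ p a := hu.le_multProj_iff.1 hp i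

theorem IsUnitFamily.multProj_anti (hu : IsUnitFamily h) {k l : ℕ} (hkl : k ≤ l) (a : S) :
    multProj h l a ≤ multProj h k a :=
  hu.le_multProj_iff.2 fun i => (nsmul_le_nsmul_left (zero_le) hkl).trans (hu.multProj_apply le_rfl i)

theorem IsUnitFamily.le_multProj_of_apply_le (hu : IsUnitFamily h) {k : ℕ} {a b : S}
    {p : Projection S} (hab : p a ≤ p b) (hp : p ≤ multProj h k a) : p ≤ multProj h k b :=
  hu.le_multProj_iff.2 fun i => (hu.multProj_apply hp i).trans hab

/-- On the support of `h i` all other members vanish, so a single index decides. -/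
theorem IsUnitFamily.le_multProj_of_le_supp (hu : IsUnitFamily h) {k : ℕ} {a : S} {i : ι}
    {p : Projection S} (hp : p ≤ supp (h i)) (hk : k • (p (h i) : Ext S) ≤ p a) :
    p ≤ multProj h k a := by
  refine hu.le_multProj_iff.2 fun j => ?_
  by_cases hij : j = i
  · rwa [hij]
  · have h0 : p (h j) = 0 := by
      rw [← inf_supp_eq_bot_iff, eq_bot_iff, ← hu.orth i j (Ne.symm hij)]
      exact inf_le_inf_right _ hp
    rw [h0, Ext.of_zero, smul_zero]
    exact zero_le

theorem IsUnitFamily.multProj_add (hu : IsUnitFamily h) {a b c : S} (hc : (a + b : Ext S) = c)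
    (k l : ℕ) : multProj h k a ⊓ multProj h l b ≤ multProj h (k + l) c := by
  refine hu.le_multProj_iff.2 fun i => ?_
  rw [add_nsmul, ← Projection.add _ hc]
  exact add_le_add (hu.multProj_apply inf_le_left i) (hu.multProj_apply inf_le_right i)

theorem multProj_zero (a : S) : multProj h 0 a = ⊤ :=
  top_le_iff.1 (le_sSup fun i => by rw [zero_nsmul]; exact zero_le)

/-- Division with remainder. -/
theorem IsUnitFamily.exists_remainder (hu : IsUnitFamily h) {k : ℕ} {a : S} {i : ι}
    {p : Projection S} (hp : p ≤ supp (h i)) (hk : p ≤ multProj h k a)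
    (hk' : p ≤ (multProj h (k + 1) a)ᶜ) :
    ∃ r : S, k • (p (h i) : Ext S) + r = p a ∧ r ≤ p (h i) ∧ p ≤ ltProj r (h i) := by
  obtain ⟨z, hz⟩ := hu.multProj_apply hk i
  obtain ⟨b, r, hb, rfl⟩ := Ext.exists_of_add_eq hz
  have hr : p r = r := p.apply_eq_of_le (le_of_add_eq' (hb ▸ hz))
  -- Where the remainder is at least `h i`, a further copy would fit, against `hk'`.
  have hlt : p ≤ ltProj r (h i) := by
    rw [le_ltProj_iff]
    intro q hq hle
    refine le_bot_iff.1 ((le_inf (hu.le_multProj_of_le_supp (hq.trans hp) ?_)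
      (hq.trans hk')).trans inf_compl_eq_bot.le)
    rw [hb] at hz
    have h1 := q.add hz
    rw [← q.map_nsmul hb, q.apply_of_le hq, q.apply_of_le hq] at h1
    rw [← h1, succ_nsmul]
    exact add_le_add le_rfl hle
  refine ⟨r, hz, ?_, hlt⟩
  have := apply_le_of_le_ltProj hlt
  rwa [hr] at this

/-- A common lower bound of `r` and its complement in `p e` has its double below `e`, so the two are
orthogonal. Hence `r` and `e` agree on `supp r`, which strictness forbids unless `r = 0`. -/
theorem MultipleFree.remainder_eq_zero {e r : S} {p : Projection S} (he : MultipleFree e)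
    (hr : r ≤ p e) (hlt : p ≤ ltProj r e) : r = 0 := by
  obtain ⟨t, ht⟩ := le_iff_exists.1 hr
  have horth : Orth r t := orth_iff.2 fun x hx hx' => multipleFree_iff.1 he x <| by
    refine (add_le_add (Ext.of_le_of.2 hx) (Ext.of_le_of.2 hx')).trans ?_
    rw [ht]
    exact p.apply_le e
  have hsp : supp r ≤ p := supp_le_iff.2 (p.apply_eq_of_le hr)
  have h1 := (supp r).add ht
  rw [inf_supp_eq_bot_iff.1 (orth_iff_supp.1 horth), Ext.of_zero, add_zero, Ext.of_inj,
    Projection.apply_of_le hsp] at h1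
  exact supp_eq_bot_iff.1 (le_ltProj_iff.1 hlt _ hsp h1.ge)

/-- Counting is additive up to one unit. If `k + l + 2` copies of `h` fitted into `k h + r + l h +
r'` with `r' ≤ h`, cancelling `k + l + 1` copies would leave `h ≤ r`, against `r < h`. -/
theorem IsUnitFamily.inf_multProj_eq_bot (hu : IsUnitFamily h) {a b c : S}
    (hc : (a + b : Ext S) = c) (k l : ℕ) {q : Projection S} (hq : q ≤ (projIII S)ᶜ)
    (ha : q ≤ multProj h k a) (ha' : q ≤ (multProj h (k + 1) a)ᶜ)
    (hb : q ≤ multProj h l b) (hb' : q ≤ (multProj h (l + 1) b)ᶜ)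
    (hq' : q ≤ multProj h (k + l + 2) c) : q = ⊥ := by
  by_contra h0
  obtain ⟨i, hi⟩ := hu.cover q hq h0
  set p := q ⊓ supp (h i) with hp
  have hpq : p ≤ q := inf_le_left
  have hps : p ≤ supp (h i) := inf_le_right
  obtain ⟨r, hr, hrh, hrlt⟩ := hu.exists_remainder hps (hpq.trans ha) (hpq.trans ha')
  obtain ⟨r', hr', hrh', -⟩ := hu.exists_remainder hps (hpq.trans hb) (hpq.trans hb')
  have h1 := hu.multProj_apply (hpq.trans hq') i
  obtain ⟨w, hw, -⟩ := Ext.exists_of_le ((nsmul_le_nsmul_left (zero_le)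
    (show k + l + 1 ≤ k + l + 2 by omega)).trans h1)
  have h2 : (r + w : Ext S) ≤ p c := by
    refine le_trans ?_ h1
    rw [← hw, succ_nsmul _ (k + l + 1), add_comm]
    exact add_le_add le_rfl hrh
  obtain ⟨s, hs, -⟩ := Ext.exists_of_le h2
  have hwf : DirectlyFinite w := ((hu.fin i).projection p).nsmul hw
  have h3 : (p (h i) : Ext S) ≤ r := by
    refine hwf.le_of_add_le hs ?_
    calc (p (h i) + w : Ext S) = (k + l + 2) • (p (h i) : Ext S) := by
          rw [← hw, succ_nsmul _ (k + l + 1), add_comm]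
      _ ≤ p c := h1
      _ = (k • (p (h i) : Ext S) + r) + (l • (p (h i) : Ext S) + r') := by
          rw [hr, hr', p.add hc]
      _ = r + ((k + l) • (p (h i) : Ext S) + r') := by rw [add_nsmul]; abel
      _ ≤ r + w := by
          rw [← hw, succ_nsmul]
          exact add_le_add le_rfl (add_le_add le_rfl hrh')
  refine hi (le_ltProj_iff.1 hrlt p le_rfl ?_)
  have h4 := p.mono (Ext.of_le_of.1 h3)
  rwa [p.idem] at h4

/-- For multiple-free units both remainders vanish, so `c` is exactly `k + l` copies, and one more
copy would be absorbed by a directly finite element. -/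
theorem IsUnitFamily.inf_multProj_eq_bot' (hu : IsUnitFamily h) {a b c : S}
    (hc : (a + b : Ext S) = c) (k l : ℕ) {q : Projection S} (hq : q ≤ (projIII S)ᶜ)
    (hmf : ∀ i, q ⊓ supp (h i) ≠ ⊥ → MultipleFree (h i))
    (ha : q ≤ multProj h k a) (ha' : q ≤ (multProj h (k + 1) a)ᶜ)
    (hb : q ≤ multProj h l b) (hb' : q ≤ (multProj h (l + 1) b)ᶜ)
    (hq' : q ≤ multProj h (k + l + 1) c) : q = ⊥ := by
  by_contra h0
  obtain ⟨i, hi⟩ := hu.cover q hq h0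
  have hmi := hmf i hi
  set p := q ⊓ supp (h i) with hp
  have hpq : p ≤ q := inf_le_left
  have hps : p ≤ supp (h i) := inf_le_right
  obtain ⟨r, hr, hrh, hrlt⟩ := hu.exists_remainder hps (hpq.trans ha) (hpq.trans ha')
  obtain ⟨r', hr', hrh', hrlt'⟩ := hu.exists_remainder hps (hpq.trans hb) (hpq.trans hb')
  rw [hmi.remainder_eq_zero hrh hrlt, Ext.of_zero, add_zero] at hr
  rw [hmi.remainder_eq_zero hrh' hrlt', Ext.of_zero, add_zero] at hr'
  have h1 := hu.multProj_apply (hpq.trans hq') i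
  have h2 : (k + l) • (p (h i) : Ext S) = p c := by rw [add_nsmul, hr, hr', p.add hc]
  have hwf : DirectlyFinite (p c) := ((hu.fin i).projection p).nsmul h2
  have h3 : p (h i) = 0 := by
    refine hwf _ (Ext.isSum_iff.2 (le_antisymm ?_ le_add_self))
    rwa [succ_nsmul, h2, add_comm] at h1
  have h4 := inf_supp_eq_bot_iff.2 h3
  rw [inf_eq_left.2 hps] at h4
  exact hi h4

/-- The number of times that the family `h` fits into `a`, at an ultrafilter. -/
noncomputable def floorAt (h : ι → S) (a : S) (ω : UltrafilterSpace S) : ℝ≥0∞ :=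
  ⨆ k : ℕ, ⨆ _ : ω ∈ basicSet (multProj h k a), (k : ℝ≥0∞)

theorem le_floorAt {k : ℕ} {a : S} {ω : UltrafilterSpace S} (hk : ω ∈ basicSet (multProj h k a)) :
    (k : ℝ≥0∞) ≤ floorAt h a ω :=
  le_iSup₂ (f := fun (k : ℕ) (_ : ω ∈ basicSet (multProj h k a)) => (k : ℝ≥0∞)) k hk

theorem IsUnitFamily.floorAt_le (hu : IsUnitFamily h) {k : ℕ} {a : S} {ω : UltrafilterSpace S}
    (hk : ω ∉ basicSet (multProj h (k + 1) a)) : floorAt h a ω ≤ k := by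
  refine iSup₂_le fun l hl => Nat.cast_le.2 ?_
  by_contra! hlt
  exact hk (basicSet_mono (hu.multProj_anti hlt a) hl)

theorem IsUnitFamily.floorAt_cases (hu : IsUnitFamily h) (a : S) (ω : UltrafilterSpace S) :
    (floorAt h a ω = ∞ ∧ ∀ k, ω ∈ basicSet (multProj h k a)) ∨
      ∃ k : ℕ, floorAt h a ω = k ∧ ω ∈ basicSet (multProj h k a) ∧
        ω ∈ basicSet (multProj h (k + 1) a)ᶜ := by
  by_cases hall : ∀ k, ω ∈ basicSet (multProj h k a)
  · refine Or.inl ⟨ENNReal.eq_top_of_forall_nnreal_le fun r => ?_, hall⟩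
    obtain ⟨n, hn⟩ := exists_nat_ge r
    exact le_trans (by exact_mod_cast hn) (le_floorAt (hall n))
  · right
    push Not at hall
    classical
    have hpos : Nat.find hall ≠ 0 := fun h0 => by
      have := Nat.find_spec hall
      rw [h0, multProj_zero] at this
      exact this (mem_basicSet_top ω)
    obtain ⟨k, hk⟩ := Nat.exists_eq_succ_of_ne_zero hpos
    have h1 : ω ∉ basicSet (multProj h (k + 1) a) := by
      have := Nat.find_spec hall
      rwa [hk] at this
    have h2 : ω ∈ basicSet (multProj h k a) := by
      by_contra hcon
      exact absurd (Nat.find_min' hall hcon) (by omega)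
    exact ⟨k, le_antisymm (hu.floorAt_le h1) (le_floorAt h2), h2, mem_basicSet_compl.2 h1⟩

theorem IsUnitFamily.floorAt_mono (hu : IsUnitFamily h) {a b : S} {p : Projection S}
    (hab : p a ≤ p b) {ω : UltrafilterSpace S} (hω : ω ∈ basicSet p) :
    floorAt h a ω ≤ floorAt h b ω := by
  refine iSup₂_le fun k hk => le_floorAt ?_
  refine basicSet_mono (hu.le_multProj_of_apply_le ?_ inf_le_right) (mem_basicSet_inf.2 ⟨hω, hk⟩)
  rw [inf_comm, Projection.inf_apply, Projection.inf_apply]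
  exact Projection.mono _ hab

theorem IsUnitFamily.floorAt_add_le (hu : IsUnitFamily h) {a b c : S} (hc : (a + b : Ext S) = c)
    (ω : UltrafilterSpace S) : floorAt h a ω + floorAt h b ω ≤ floorAt h c ω := by
  have hac : floorAt h a ω ≤ floorAt h c ω :=
    hu.floorAt_mono ((⊤ : Projection S).mono (le_of_add_eq hc)) (mem_basicSet_top ω)
  have hbc : floorAt h b ω ≤ floorAt h c ω :=
    hu.floorAt_mono ((⊤ : Projection S).mono (le_of_add_eq' hc)) (mem_basicSet_top ω)
  rcases hu.floorAt_cases a ω with ⟨ha, -⟩ | ⟨k, hk, hk1, -⟩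
  · rw [ha] at hac
    rw [top_le_iff.1 hac]
    exact le_top
  rcases hu.floorAt_cases b ω with ⟨hb, -⟩ | ⟨l, hl, hl1, -⟩
  · rw [hb] at hbc
    rw [top_le_iff.1 hbc]
    exact le_top
  rw [hk, hl, ← Nat.cast_add]
  exact le_floorAt (basicSet_mono (hu.multProj_add hc k l) (mem_basicSet_inf.2 ⟨hk1, hl1⟩))

theorem IsUnitFamily.floorAt_le_add_one (hu : IsUnitFamily h) {a b c : S}
    (hc : (a + b : Ext S) = c) {ω : UltrafilterSpace S} (hω : ω ∉ basicSet (projIII S)) :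
    floorAt h c ω ≤ floorAt h a ω + floorAt h b ω + 1 := by
  rcases hu.floorAt_cases a ω with ⟨ha, -⟩ | ⟨k, hk, hk1, hk2⟩
  · simp [ha]
  rcases hu.floorAt_cases b ω with ⟨hb, -⟩ | ⟨l, hl, hl1, hl2⟩
  · simp [hb]
  have : floorAt h c ω ≤ (k + l + 1 : ℕ) := hu.floorAt_le fun hcon => by
    have h1 := mem_basicSet_inf.2 ⟨mem_basicSet_compl.2 hω, mem_basicSet_inf.2 ⟨mem_basicSet_inf.2
      ⟨hk1, hk2⟩, mem_basicSet_inf.2 ⟨mem_basicSet_inf.2 ⟨hl1, hl2⟩, hcon⟩⟩⟩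
    refine ne_bot_of_mem_basicSet h1 (hu.inf_multProj_eq_bot hc k l inf_le_left ?_ ?_ ?_ ?_ ?_)
    · exact inf_le_right.trans (inf_le_left.trans inf_le_left)
    · exact inf_le_right.trans (inf_le_left.trans inf_le_right)
    · exact inf_le_right.trans (inf_le_right.trans (inf_le_left.trans inf_le_left))
    · exact inf_le_right.trans (inf_le_right.trans (inf_le_left.trans inf_le_right))
    · exact inf_le_right.trans (inf_le_right.trans inf_le_right)
  rw [hk, hl]
  exact_mod_cast this

theorem IsUnitFamily.floorAt_le_add (hu : IsUnitFamily h) {a b c : S}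
    (hc : (a + b : Ext S) = c) {p : Projection S} (hp : p ≤ (projIII S)ᶜ)
    (hmf : ∀ i, p ⊓ supp (h i) ≠ ⊥ → MultipleFree (h i)) {ω : UltrafilterSpace S}
    (hω : ω ∈ basicSet p) : floorAt h c ω ≤ floorAt h a ω + floorAt h b ω := by
  rcases hu.floorAt_cases a ω with ⟨ha, -⟩ | ⟨k, hk, hk1, hk2⟩
  · simp [ha]
  rcases hu.floorAt_cases b ω with ⟨hb, -⟩ | ⟨l, hl, hl1, hl2⟩
  · simp [hb]
  have : floorAt h c ω ≤ (k + l : ℕ) := hu.floorAt_le fun hcon => by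
    have h1 := mem_basicSet_inf.2 ⟨hω, mem_basicSet_inf.2 ⟨mem_basicSet_inf.2
      ⟨hk1, hk2⟩, mem_basicSet_inf.2 ⟨mem_basicSet_inf.2 ⟨hl1, hl2⟩, hcon⟩⟩⟩
    refine ne_bot_of_mem_basicSet h1
      (hu.inf_multProj_eq_bot' hc k l (inf_le_left.trans hp) ?_ ?_ ?_ ?_ ?_ ?_)
    · intro i hi
      exact hmf i fun h0 => hi (le_bot_iff.1 (h0 ▸ inf_le_inf_right _ inf_le_left))
    · exact inf_le_right.trans (inf_le_left.trans inf_le_left)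
    · exact inf_le_right.trans (inf_le_left.trans inf_le_right)
    · exact inf_le_right.trans (inf_le_right.trans (inf_le_left.trans inf_le_left))
    · exact inf_le_right.trans (inf_le_right.trans (inf_le_left.trans inf_le_right))
    · exact inf_le_right.trans (inf_le_right.trans inf_le_right)
  rw [hk, hl]
  exact_mod_cast this

/-- By the archimedean property, not every multiple of a unit that is nonzero on `p` fits into a
directly finite element; cut `p` at the first multiple that fails. -/
theorem IsUnitFamily.exists_not_le_multProj (hu : IsUnitFamily h) {a : S} {p : Projection S}
    (ha : DirectlyFinite (p a)) (hp : p ≤ (projIII S)ᶜ) (h0 : p ≠ ⊥) :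
    ∃ k, ∃ q ≤ p, q ≠ ⊥ ∧ q ≤ multProj h k a ∧ q ≤ (multProj h (k + 1) a)ᶜ := by
  have hex : ∃ k, ¬ p ≤ multProj h k a := by
    by_contra! hall
    obtain ⟨i, hi⟩ := hu.cover p hp h0
    refine hi ?_
    have h1 : (p ⊓ supp (h i)) (h i) = 0 := by
      rw [Projection.inf_apply, supp_apply]
      exact ha.eq_zero_of_nsmul_le fun n => hu.multProj_apply (hall n) i
    have h2 := inf_supp_eq_bot_iff.2 h1
    rwa [inf_assoc, inf_idem] at h2
  classical
  have hpos : Nat.find hex ≠ 0 := fun h0 => by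
    have := Nat.find_spec hex
    rw [h0, multProj_zero] at this
    exact this le_top
  obtain ⟨k, hk⟩ := Nat.exists_eq_succ_of_ne_zero hpos
  have h1 : ¬ p ≤ multProj h (k + 1) a := by
    have := Nat.find_spec hex
    rwa [hk] at this
  have h2 : p ≤ multProj h k a := by
    by_contra hcon
    exact absurd (Nat.find_min' hex hcon) (by omega)
  refine ⟨k, p ⊓ (multProj h (k + 1) a)ᶜ, inf_le_left, fun h => h1 ?_, inf_le_left.trans h2,
    inf_le_right⟩
  rwa [← disjoint_iff, disjoint_compl_right_iff] at h

end Multiples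

end DimScale

namespace DimScale

open scoped ENNReal

/-! ### Values of directly finite parts -/

section FiniteValues

variable {S : Type u} [PartialCommMonoid S] [hS : Fact (IsContinuousDimensionScale S)]

theorem supp_of_add_eq {a b c : S} (h : (a + b : Ext S) = c) : supp c = supp a ⊔ supp b := by
  refine le_antisymm ?_ (sup_le (supp_mono (le_of_add_eq h)) (supp_mono (le_of_add_eq' h)))
  rw [← compl_le_compl_iff_le, le_compl_supp_iff, compl_sup]
  have h1 := ((supp a)ᶜ ⊓ (supp b)ᶜ).add h
  rw [le_compl_supp_iff.1 inf_le_left, le_compl_supp_iff.1 inf_le_right, Ext.of_zero, add_zero,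
    ← Ext.of_zero, Ext.of_inj] at h1
  exact h1.symm

open Classical in
/-- The half of an element, or the element itself if there is none. -/
noncomputable def half (x : S) : S := if h : ∃ s : S, (s + s : Ext S) = x then h.choose else x

theorem half_cases (x : S) : (half x + half x : Ext S) = x ∨ half x = x := by
  by_cases h : ∃ s : S, (s + s : Ext S) = x
  · left
    rw [half, dif_pos h]
    exact h.choose_spec
  · right
    rw [half, dif_neg h]

theorem half_le (x : S) : half x ≤ x := by
  rcases half_cases x with h | h
  · exact le_of_add_eq h
  · exact h.le

theorem supp_half (x : S) : supp (half x) = supp x := by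
  rcases half_cases x with h | h
  · rw [supp_of_add_eq h, sup_idem]
  · rw [h]

/-- Multiple-free units are thus the same at every scale `n`; only the type II units are really
divided. -/
theorem half_eq_self {x : S} (hx : MultipleFree x) : half x = x := by
  rcases half_cases x with h | h
  · have h0 := multipleFree_iff.1 hx _ h.le
    rw [h0, Ext.of_zero, add_zero, ← Ext.of_zero, Ext.of_inj] at h
    rw [h0, h]
  · exact h

theorem half_add_half {x : S} (hx : DirectlyFinite x) (h2 : x ∈ perp (mfSet S)) :
    (half x + half x : Ext S) = x := by
  rw [half, dif_pos (exists_half hx h2)]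
  exact (exists_half hx h2).choose_spec

theorem iterate_half_le (n : ℕ) (x : S) : half^[n] x ≤ x := by
  induction n with
  | zero => exact le_rfl
  | succ n ih =>
    rw [Function.iterate_succ_apply']
    exact (half_le _).trans ih

theorem supp_iterate_half (n : ℕ) (x : S) : supp (half^[n] x) = supp x := by
  induction n with
  | zero => rfl
  | succ n ih => rw [Function.iterate_succ_apply', supp_half, ih]

theorem iterate_half_eq_self {x : S} (hx : MultipleFree x) (n : ℕ) : half^[n] x = x :=
  Function.iterate_fixed (half_eq_self hx) n

theorem iterate_half_add {x : S} (hx : DirectlyFinite x) (h2 : x ∈ perp (mfSet S)) (n : ℕ) :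
    (half^[n + 1] x + half^[n + 1] x : Ext S) = half^[n] x := by
  rw [Function.iterate_succ_apply']
  exact half_add_half (hx.mono (iterate_half_le n x)) (perp_lower (iterate_half_le n x) h2)

theorem two_pow_nsmul_iterate_half {x : S} (hx : DirectlyFinite x) (h2 : x ∈ perp (mfSet S))
    (n : ℕ) : 2 ^ n • ((half^[n] x : S) : Ext S) = x := by
  induction n with
  | zero => simp
  | succ n ih =>
    rw [pow_succ, mul_nsmul', two_nsmul, iterate_half_add hx h2, ih]

variable {E : Set S}

/-- The family of the `2^n`-th parts of the elements of a finitary unit. -/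
noncomputable def unitFamily (E : Set S) (n : ℕ) (e : E) : S := half^[n] e.1

theorem mem_typeII_iff {x : S} : x ∈ typeII S ↔ supp x ≤ projII S := by
  rw [← range_projII, Projection.mem_range, supp_le_iff]

theorem IsFinitaryUnit.cases (hE : IsFinitaryUnit E) {e : S} (he : e ∈ E) :
    MultipleFree e ∨ e ∈ typeII S := by
  refine (hE.pure e he).imp id fun h => ⟨fun y hy => orth_iff.2 fun x hx hxy => ?_,
    subset_perp_perp _ (hE.subset_fin he)⟩
  exact h x (algLE_iff.2 hx) (MultipleFree.mono hy hxy)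

theorem IsFinitaryUnit.isUnitFamily (hE : IsFinitaryUnit E) (n : ℕ) :
    IsUnitFamily (unitFamily E n) where
  fin e := DirectlyFinite.mono (hE.subset_fin e.2) (iterate_half_le n _)
  orth e e' h := by
    rw [unitFamily, unitFamily, supp_iterate_half, supp_iterate_half, ← orth_iff_supp]
    exact hE.orth _ e.2 _ e'.2 (fun h' => h (Subtype.ext h'))
  cover p hp h0 := by
    have h1 : ¬ p ≤ projIII S := fun h =>
      h0 (le_bot_iff.1 ((le_inf h hp).trans inf_compl_eq_bot.le))
    rw [le_projIII_iff] at h1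
    push Not at h1
    obtain ⟨x, hx, hx0⟩ := h1
    obtain ⟨e, he, hor⟩ := hE.maximal _ hx hx0
    refine ⟨⟨e, he⟩, fun h => hor ?_⟩
    rw [unitFamily, supp_iterate_half] at h
    rw [orth_iff_supp, eq_bot_iff, ← h]
    refine inf_le_inf_right _ (supp_le_iff.2 (p.idem x))

theorem IsFinitaryUnit.multipleFree_of_inf_ne_bot (hE : IsFinitaryUnit E) (e : E) {n : ℕ}
    {p : Projection S} (hp : p ≤ projI S) (h : p ⊓ supp (unitFamily E n e) ≠ ⊥) :
    MultipleFree (unitFamily E n e) := by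
  rcases hE.cases e.2 with h1 | h1
  · exact MultipleFree.mono h1 (iterate_half_le n _)
  · refine absurd ?_ h
    rw [unitFamily, supp_iterate_half, eq_bot_iff, ← inf_compl_eq_bot (a := projI S)]
    exact inf_le_inf hp ((mem_typeII_iff.1 h1).trans inf_le_left)

/-- On type II the multiple-free units vanish, and each remaining `2^n`-th part is the sum of two
`2^(n+1)`-th parts. -/
theorem IsFinitaryUnit.le_multProj_iff (hE : IsFinitaryUnit E) {n k : ℕ} {a : S}
    {p : Projection S} (hp : p ≤ projII S) (m : ℕ) :
    p ≤ multProj (unitFamily E n) k a ↔ p ≤ multProj (unitFamily E (n + m)) (2 ^ m * k) a := by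
  have step : ∀ n k, p ≤ multProj (unitFamily E n) k a ↔
      p ≤ multProj (unitFamily E (n + 1)) (2 * k) a := by
    intro n k
    rw [(hE.isUnitFamily n).le_multProj_iff, (hE.isUnitFamily (n + 1)).le_multProj_iff]
    refine forall_congr' fun e => ?_
    rcases hE.cases e.2 with h1 | h1
    · have h0 : ∀ n, p (unitFamily E n e) = 0 := fun n => by
        rw [unitFamily, iterate_half_eq_self h1, ← inf_supp_eq_bot_iff, eq_bot_iff,
          ← inf_compl_eq_bot (a := projI S), inf_comm]
        exact inf_le_inf (supp_le_projI h1) (hp.trans inf_le_left)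
      simp only [h0, Ext.of_zero, smul_zero]
    · rw [mul_nsmul, two_nsmul]
      have := p.add (iterate_half_add (hE.subset_fin e.2) h1.1 n)
      rw [unitFamily, unitFamily, this]
  induction m with
  | zero => simp
  | succ m ih => exact ih.trans ((step _ _).trans (by rw [← add_assoc, pow_succ', mul_assoc]))

theorem IsFinitaryUnit.mem_multProj_iff (hE : IsFinitaryUnit E) {n k : ℕ} {a : S}
    {ω : UltrafilterSpace S} (hω : ω ∈ basicSet (projII S)) (m : ℕ) :
    ω ∈ basicSet (multProj (unitFamily E n) k a) ↔
      ω ∈ basicSet (multProj (unitFamily E (n + m)) (2 ^ m * k) a) := by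
  constructor
  · intro h
    exact basicSet_mono ((hE.le_multProj_iff inf_le_left m).1 inf_le_right)
      (mem_basicSet_inf.2 ⟨hω, h⟩)
  · intro h
    exact basicSet_mono ((hE.le_multProj_iff inf_le_left m).2 inf_le_right)
      (mem_basicSet_inf.2 ⟨hω, h⟩)

/-- The supremum of the approximations of an element by multiples of `2^n`-th parts of units. -/
noncomputable def floorSup (E : Set S) (a : S) (ω : UltrafilterSpace S) : ℝ≥0∞ :=
  ⨆ n : ℕ, floorAt (unitFamily E n) a ω / 2 ^ n

open Classical in
/-- The value of the finite part of an element with respect to a finitary unit. -/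
noncomputable def finVal (E : Set S) (a : S) (ω : UltrafilterSpace S) : ℝ≥0∞ :=
  if ω ∈ basicSet (projIII S) then 0
  else if ω ∈ basicSet (projI S) then floorAt (unitFamily E 0) a ω
  else floorSup E a ω

theorem finVal_of_mem_III {a : S} {ω : UltrafilterSpace S} (h : ω ∈ basicSet (projIII S)) :
    finVal E a ω = 0 := if_pos h

theorem notMem_III_of_mem_I {ω : UltrafilterSpace S} (h : ω ∈ basicSet (projI S)) :
    ω ∉ basicSet (projIII S) :=
  mem_basicSet_compl.1 (basicSet_mono projI_le_compl_projIII h)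

theorem notMem_III_of_mem_II {ω : UltrafilterSpace S} (h : ω ∈ basicSet (projII S)) :
    ω ∉ basicSet (projIII S) :=
  mem_basicSet_compl.1 (basicSet_mono inf_le_right h)

theorem notMem_I_of_mem_II {ω : UltrafilterSpace S} (h : ω ∈ basicSet (projII S)) :
    ω ∉ basicSet (projI S) :=
  mem_basicSet_compl.1 (basicSet_mono inf_le_left h)

theorem finVal_of_mem_I {a : S} {ω : UltrafilterSpace S} (h : ω ∈ basicSet (projI S)) :
    finVal E a ω = floorAt (unitFamily E 0) a ω := by
  rw [finVal, if_neg (notMem_III_of_mem_I h), if_pos h]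

theorem finVal_of_mem_II {a : S} {ω : UltrafilterSpace S} (h : ω ∈ basicSet (projII S)) :
    finVal E a ω = floorSup E a ω := by
  rw [finVal, if_neg (notMem_III_of_mem_II h), if_neg (notMem_I_of_mem_II h)]

theorem IsFinitaryUnit.mul_floorAt_le (hE : IsFinitaryUnit E) (a : S) {ω : UltrafilterSpace S}
    (hω : ω ∈ basicSet (projII S)) (n m : ℕ) :
    2 ^ m * floorAt (unitFamily E n) a ω ≤ floorAt (unitFamily E (n + m)) a ω := by
  rcases (hE.isUnitFamily n).floorAt_cases a ω with ⟨h1, h2⟩ | ⟨k, h1, h2, -⟩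
  · rcases (hE.isUnitFamily (n + m)).floorAt_cases a ω with ⟨h3, -⟩ | ⟨k, -, -, h3⟩
    · rw [h3]; exact le_top
    · refine absurd ?_ (mem_basicSet_compl.1 h3)
      refine basicSet_mono ((hE.isUnitFamily (n + m)).multProj_anti (l := 2 ^ m * (k + 1)) ?_ a)
        ((hE.mem_multProj_iff hω m).1 (h2 (k + 1)))
      exact Nat.le_mul_of_pos_left _ (by positivity)
  · rw [h1]
    have := le_floorAt ((hE.mem_multProj_iff hω m).1 h2)
    exact_mod_cast this

/-- If `k + 1` copies fail to fit at scale `n`, then `2^m (k + 1)` copies fail at scale `n + m`. -/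
theorem IsFinitaryUnit.floorAt_add_one_le (hE : IsFinitaryUnit E) (a : S)
    {ω : UltrafilterSpace S} (hω : ω ∈ basicSet (projII S)) (n m : ℕ) :
    floorAt (unitFamily E (n + m)) a ω ≤ 2 ^ m * (floorAt (unitFamily E n) a ω + 1) := by
  rcases (hE.isUnitFamily n).floorAt_cases a ω with ⟨h1, h2⟩ | ⟨k, h1, -, h2⟩
  · rw [h1]
    simp [ENNReal.mul_top]
  · rw [h1]
    have h3 : ω ∉ basicSet (multProj (unitFamily E (n + m)) (2 ^ m * (k + 1) - 1 + 1) a) := by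
      rw [Nat.sub_add_cancel (Nat.one_le_iff_ne_zero.2 (by positivity)),
        ← hE.mem_multProj_iff hω m]
      exact mem_basicSet_compl.1 h2
    refine ((hE.isUnitFamily (n + m)).floorAt_le h3).trans ?_
    have : 2 ^ m * (k + 1) - 1 ≤ 2 ^ m * (k + 1) := Nat.sub_le _ _
    exact_mod_cast this

theorem floorAt_div_le (a : S) (ω : UltrafilterSpace S) (n : ℕ) :
    floorAt (unitFamily E n) a ω / 2 ^ n ≤ floorSup E a ω :=
  le_iSup (fun n : ℕ => floorAt (unitFamily E n) a ω / 2 ^ n) n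

theorem ENNReal_div_two_pow (x : ℝ≥0∞) (n m : ℕ) : x / 2 ^ n = 2 ^ m * x / 2 ^ (n + m) := by
  rw [pow_add, mul_comm ((2 : ℝ≥0∞) ^ n), ENNReal.mul_div_mul_left] <;> simp

theorem IsFinitaryUnit.monotone_floorAt_div (hE : IsFinitaryUnit E) (a : S)
    {ω : UltrafilterSpace S} (hω : ω ∈ basicSet (projII S)) :
    Monotone fun n : ℕ => floorAt (unitFamily E n) a ω / 2 ^ n := by
  refine monotone_nat_of_le_succ fun n => ?_
  rw [ENNReal_div_two_pow _ n 1]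
  exact ENNReal.div_le_div_right (hE.mul_floorAt_le a hω n 1) _

/-- Stage `n` determines the value up to `2^(-n)`, uniformly in `ω`. Additivity and continuity on
type II rest on this bound. -/
theorem IsFinitaryUnit.floorSup_le (hE : IsFinitaryUnit E) (a : S)
    {ω : UltrafilterSpace S} (hω : ω ∈ basicSet (projII S)) (n : ℕ) :
    floorSup E a ω ≤ (floorAt (unitFamily E n) a ω + 1) / 2 ^ n := by
  refine iSup_le fun m => ?_
  refine (hE.monotone_floorAt_div a hω (Nat.le_add_left m n)).trans ?_
  rw [ENNReal_div_two_pow (_ + _) n m]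
  exact ENNReal.div_le_div_right (hE.floorAt_add_one_le a hω n m) _

theorem exists_two_div_two_pow_le {ε : ℝ≥0} (hε : 0 < ε) : ∃ n : ℕ, (2 : ℝ≥0∞) / 2 ^ n ≤ ε := by
  obtain ⟨n, hn⟩ := ENNReal.exists_inv_two_pow_lt (a := (ε : ℝ≥0∞)) (by exact_mod_cast hε.ne')
  refine ⟨n + 1, le_trans (le_of_eq ?_) hn.le⟩
  have := ENNReal_div_two_pow 1 n 1
  rw [pow_one, mul_one] at this
  rw [← this, one_div, ENNReal.inv_pow]

/-- On type I the count itself is additive. On type II superadditivity passes to the monotone limit,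
and the defect in the other direction is at most `2 / 2^n` for every `n`. -/
theorem IsFinitaryUnit.finVal_add (hE : IsFinitaryUnit E) {a b c : S} (hc : (a + b : Ext S) = c)
    (ω : UltrafilterSpace S) : finVal E c ω = finVal E a ω + finVal E b ω := by
  rcases mem_type_cases ω with h | h | h
  · rw [finVal_of_mem_I h, finVal_of_mem_I h, finVal_of_mem_I h]
    refine le_antisymm ?_ ((hE.isUnitFamily 0).floorAt_add_le hc ω)
    exact (hE.isUnitFamily 0).floorAt_le_add hc projI_le_compl_projIII
      (fun e he => hE.multipleFree_of_inf_ne_bot e le_rfl he) h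
  · rw [finVal_of_mem_II h, finVal_of_mem_II h, finVal_of_mem_II h]
    refine le_antisymm (ENNReal.le_of_forall_pos_le_add fun ε hε _ => ?_) ?_
    · obtain ⟨n, hn⟩ := exists_two_div_two_pow_le hε
      refine (hE.floorSup_le c h n).trans ?_
      have h1 := (hE.isUnitFamily n).floorAt_le_add_one hc (notMem_III_of_mem_II h)
      calc (floorAt (unitFamily E n) c ω + 1) / 2 ^ n
          ≤ (floorAt (unitFamily E n) a ω + floorAt (unitFamily E n) b ω + 2) / 2 ^ n := by
            refine ENNReal.div_le_div_right ((add_le_add h1 le_rfl).trans ?_) _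
            rw [add_assoc _ 1 1, one_add_one_eq_two]
        _ = floorAt (unitFamily E n) a ω / 2 ^ n + floorAt (unitFamily E n) b ω / 2 ^ n
            + 2 / 2 ^ n := by rw [ENNReal.add_div, ENNReal.add_div]
        _ ≤ _ := add_le_add (add_le_add (floorAt_div_le a ω n) (floorAt_div_le b ω n)) hn
    · rw [floorSup, floorSup, ENNReal.iSup_add_iSup_of_monotone (hE.monotone_floorAt_div a h)
        (hE.monotone_floorAt_div b h)]
      refine iSup_le fun n => le_trans ?_ (floorAt_div_le c ω n)
      rw [← ENNReal.add_div]
      exact ENNReal.div_le_div_right ((hE.isUnitFamily n).floorAt_add_le hc ω) _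
  · rw [finVal_of_mem_III h, finVal_of_mem_III h, finVal_of_mem_III h, add_zero]

theorem IsFinitaryUnit.finVal_mono (hE : IsFinitaryUnit E) {a b : S} {p : Projection S}
    (hab : p a ≤ p b) {ω : UltrafilterSpace S} (hω : ω ∈ basicSet p) :
    finVal E a ω ≤ finVal E b ω := by
  rcases mem_type_cases ω with h | h | h
  · rw [finVal_of_mem_I h, finVal_of_mem_I h]
    exact (hE.isUnitFamily 0).floorAt_mono hab hω
  · rw [finVal_of_mem_II h, finVal_of_mem_II h]
    exact iSup_mono fun n => ENNReal.div_le_div_right ((hE.isUnitFamily n).floorAt_mono hab hω) _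
  · rw [finVal_of_mem_III h, finVal_of_mem_III h]

theorem IsUnitFamily.continuous_floorAt {ι : Type*} {h : ι → S} (hu : IsUnitFamily h) (a : S) :
    Continuous (floorAt h a) := by
  refine OrderTopology.continuous_iff.2 fun t => ⟨?_, ?_⟩
  · refine isOpen_iff_mem_nhds.2 fun ω hω => ?_
    obtain ⟨k, hk⟩ := lt_iSup_iff.1 (show t < floorAt h a ω from hω)
    obtain ⟨hk1, hk2⟩ := lt_iSup_iff.1 hk
    filter_upwards [(isOpen_basicSet _).mem_nhds hk1] with ω' hω'
    exact lt_of_lt_of_le hk2 (le_floorAt hω')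
  · refine isOpen_iff_mem_nhds.2 fun ω hω => ?_
    rcases hu.floorAt_cases a ω with ⟨h1, -⟩ | ⟨k, h1, -, h2⟩
    · rw [Set.mem_preimage, h1, Set.mem_Iio] at hω
      exact absurd hω not_top_lt
    · rw [Set.mem_preimage, h1, Set.mem_Iio] at hω
      filter_upwards [(isOpen_basicSet _).mem_nhds h2] with ω' hω'
      exact lt_of_le_of_lt (hu.floorAt_le (mem_basicSet_compl.1 hω')) hω

/-- Counts are locally constant where finite. On type II the stages give lower bounds that persist
nearby, and `(floorAt + 1) / 2^n` gives the upper ones. -/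
theorem IsFinitaryUnit.continuous_finVal (hE : IsFinitaryUnit E) (a : S) :
    Continuous (finVal E a) := by
  refine continuous_iff_continuousAt.2 fun ω => ?_
  rcases mem_type_cases ω with h | h | h
  · refine ContinuousAt.congr ((hE.isUnitFamily 0).continuous_floorAt a).continuousAt ?_
    filter_upwards [(isOpen_basicSet _).mem_nhds h] with ω' hω'
    exact (finVal_of_mem_I hω').symm
  · have hev : ∀ᶠ ω' in nhds ω, ω' ∈ basicSet (projII S) := (isOpen_basicSet _).mem_nhds h
    refine tendsto_order.2 ⟨fun t ht => ?_, fun t ht => ?_⟩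
    · rw [finVal_of_mem_II h] at ht
      obtain ⟨n, hn⟩ := lt_iSup_iff.1 ht
      have h1 : Continuous fun ω => floorAt (unitFamily E n) a ω / 2 ^ n :=
        (ENNReal.continuous_div_const _ (by simp)).comp ((hE.isUnitFamily n).continuous_floorAt a)
      filter_upwards [h1.continuousAt.eventually (lt_mem_nhds hn), hev] with ω' h2 h3
      rw [finVal_of_mem_II h3]
      exact lt_of_lt_of_le h2 (floorAt_div_le a ω' n)
    · rw [finVal_of_mem_II h] at ht
      obtain ⟨ε, hε, hlt⟩ := ENNReal.lt_iff_exists_add_pos_lt.1 ht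
      obtain ⟨n, hn⟩ := exists_two_div_two_pow_le hε
      have h1 : Continuous fun ω => (floorAt (unitFamily E n) a ω + 1) / 2 ^ n :=
        (ENNReal.continuous_div_const _ (by simp)).comp
          (((hE.isUnitFamily n).continuous_floorAt a).add continuous_const)
      have h2 : (floorAt (unitFamily E n) a ω + 1) / 2 ^ n < t := by
        refine lt_of_le_of_lt ?_ hlt
        rw [ENNReal.add_div]
        refine add_le_add (floorAt_div_le a ω n) (le_trans ?_ hn)
        exact ENNReal.div_le_div_right one_le_two _
      filter_upwards [h1.continuousAt.eventually (gt_mem_nhds h2), hev] with ω' h3 h4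
      rw [finVal_of_mem_II h4]
      exact lt_of_le_of_lt (hE.floorSup_le a h4 n) h3
  · refine ContinuousAt.congr (continuousAt_const (y := (0 : ℝ≥0∞))) ?_
    filter_upwards [(isOpen_basicSet _).mem_nhds h] with ω' hω'
    exact (finVal_of_mem_III hω').symm

theorem IsFinitaryUnit.exists_finVal_ne_top (hE : IsFinitaryUnit E) {a : S} {p : Projection S}
    (ha : DirectlyFinite (p a)) (h0 : p ≠ ⊥) :
    ∃ q ≤ p, q ≠ ⊥ ∧ ∀ ω ∈ basicSet q, finVal E a ω ≠ ∞ := by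
  by_cases hp : p ≤ projIII S
  · refine ⟨p, le_rfl, h0, fun ω hω => ?_⟩
    rw [finVal_of_mem_III (basicSet_mono hp hω)]
    exact ENNReal.zero_ne_top
  · have h1 : p ⊓ (projIII S)ᶜ ≠ ⊥ := fun h => hp (by
      rwa [← disjoint_iff, disjoint_compl_right_iff] at h)
    obtain ⟨k, q, hq, hq0, -, hq2⟩ := (hE.isUnitFamily 0).exists_not_le_multProj
      (p := p ⊓ (projIII S)ᶜ) (a := a)
      (by rw [inf_comm, Projection.inf_apply]; exact ha.projection _) inf_le_right h1
    refine ⟨q, hq.trans inf_le_left, hq0, fun ω hω => ?_⟩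
    have h2 := (hE.isUnitFamily 0).floorAt_le (mem_basicSet_compl.1 (basicSet_mono hq2 hω))
    have h3 : floorAt (unitFamily E 0) a ω ≠ ∞ := ne_top_of_le_ne_top (ENNReal.natCast_ne_top k) h2
    rcases mem_type_cases ω with h | h | h
    · rwa [finVal_of_mem_I h]
    · rw [finVal_of_mem_II h]
      refine ne_top_of_le_ne_top ?_ (hE.floorSup_le a h 0)
      simpa using h3
    · rw [finVal_of_mem_III h]
      exact ENNReal.zero_ne_top

/-- Otherwise `d` would be strictly below every `2^n`-th part of a unit on a nonzero projection, and
would vanish there: as a remainder for a multiple-free unit, by the archimedean property for a type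
II unit. -/
theorem IsFinitaryUnit.exists_finVal_ne_zero (hE : IsFinitaryUnit E) {d : S} {p : Projection S}
    (hp : p ≤ (projIII S)ᶜ) (hd : p ≤ supp d) (h0 : p ≠ ⊥) :
    ∃ q ≤ p, q ≠ ⊥ ∧ ∀ ω ∈ basicSet q, finVal E d ω ≠ 0 := by
  obtain ⟨e, he⟩ := (hE.isUnitFamily 0).cover p hp h0
  set p₁ := p ⊓ supp (unitFamily E 0 e) with hp₁
  have hpe : p₁ ≤ supp e.1 := inf_le_right
  have hsupp : ∀ n, p₁ ≤ supp (unitFamily E n e) := fun n => by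
    rw [unitFamily, supp_iterate_half]; exact hpe
  have hex : ∃ n, p₁ ⊓ leProj (unitFamily E n e) d ≠ ⊥ := by
    by_contra! hcon
    have hlt : ∀ n, p₁ ≤ ltProj d (unitFamily E n e) := fun n => by
      rw [ltProj, le_compl_iff_disjoint_right, disjoint_iff]
      exact hcon n
    have hd0 : p₁ d = 0 := by
      rcases hE.cases e.2 with h1 | h1
      · refine h1.remainder_eq_zero (p := p₁) (apply_le_of_le_ltProj (hlt 0)) ?_
        exact le_ltProj_of_le (hlt 0) (p₁.idem d).le le_rfl
      · refine ((hE.subset_fin e.2 : DirectlyFinite e.1).projection p₁).eq_zero_of_nsmul_le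
          fun n => ?_
        rw [← p₁.map_nsmul (two_pow_nsmul_iterate_half (hE.subset_fin e.2) h1.1 n)]
        refine (nsmul_le_nsmul_left zero_le n.lt_two_pow_self.le).trans ?_
        exact nsmul_le_nsmul_right (Ext.of_le_of.2 (apply_le_of_le_ltProj (hlt n))) _
    have h2 := inf_supp_eq_bot_iff.2 hd0
    rw [inf_eq_left.2 (inf_le_left.trans hd)] at h2
    exact he h2
  obtain ⟨n, hn⟩ := hex
  set q := p₁ ⊓ leProj (unitFamily E n e) d with hq
  have hq1 : q ≤ multProj (unitFamily E n) 1 d := by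
    refine (hE.isUnitFamily n).le_multProj_of_le_supp (inf_le_left.trans (hsupp n)) ?_
    rw [one_nsmul]
    exact le_leProj_iff.1 inf_le_right
  refine ⟨q, inf_le_left.trans inf_le_left, hn, fun ω hω => ?_⟩
  have h3 := le_floorAt (basicSet_mono hq1 hω)
  rcases mem_type_cases ω with h | h | h
  · rw [finVal_of_mem_I h]
    -- On type I the value is read off at scale `0`, not `n`; multiple-free units do not depend on
    -- the scale, and type II units are absent.
    have h4 : q ⊓ projI S ≤ multProj (unitFamily E 0) 1 d := by
      rcases hE.cases e.2 with h1 | h1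
      · have h5 : unitFamily E n e = unitFamily E 0 e := by
          rw [unitFamily, unitFamily, iterate_half_eq_self h1, iterate_half_eq_self h1]
        refine (hE.isUnitFamily 0).le_multProj_of_le_supp (i := e)
          (inf_le_left.trans (inf_le_left.trans (hsupp 0))) ?_
        rw [← h5, one_nsmul]
        exact le_leProj_iff.1 (inf_le_left.trans inf_le_right)
      · refine le_trans (le_of_eq ?_) bot_le
        rw [eq_bot_iff, ← inf_compl_eq_bot (a := projI S), inf_comm]
        exact inf_le_inf le_rfl ((inf_le_left.trans hpe).trans
          ((mem_typeII_iff.1 h1).trans inf_le_left))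
    have h5 := le_floorAt (basicSet_mono h4 (mem_basicSet_inf.2 ⟨hω, h⟩))
    intro h6
    rw [h6] at h5
    simp at h5
  · rw [finVal_of_mem_II h]
    have h4 := floorAt_div_le (E := E) d ω n
    intro h5
    rw [h5] at h4
    have h6 := (ENNReal.div_eq_zero_iff.1 (le_antisymm h4 zero_le)).resolve_right (by simp)
    rw [h6] at h3
    simp at h3
  · have h4 := basicSet_mono ((inf_le_left.trans inf_le_left).trans hp : q ≤ _) hω
    exact absurd h (mem_basicSet_compl.1 h4)

/-- The elements of a finitary unit have the value `1` on their support. -/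
theorem IsFinitaryUnit.finVal_unit (hE : IsFinitaryUnit E) {e : S} (he : e ∈ E)
    {ω : UltrafilterSpace S} (hω : ω ∈ basicSet (supp e)) : finVal E e ω = 1 := by
  -- If `k` copies of the part make up `e`, a further copy would be absorbed by the directly finite
  -- `e`, so the count is exactly `k`.
  have key : ∀ n k : ℕ, k • ((half^[n] e : S) : Ext S) = e → floorAt (unitFamily E n) e ω = k := by
    intro n k hk
    refine le_antisymm ((hE.isUnitFamily n).floorAt_le fun h1 => ?_) (le_floorAt ?_)
    · have h2 := mem_basicSet_inf.2 ⟨hω, h1⟩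
      refine ne_bot_of_mem_basicSet h2 ?_
      set p := supp e ⊓ multProj (unitFamily E n) (k + 1) e with hp
      have h3 := (hE.isUnitFamily n).multProj_apply (p := p) inf_le_right ⟨e, he⟩
      rw [unitFamily, succ_nsmul, p.map_nsmul hk, add_comm] at h3
      have h4 : p (half^[n] e) = 0 :=
        (hE.subset_fin he : DirectlyFinite e).projection p _
          (Ext.isSum_iff.2 (le_antisymm h3 le_add_self))
      have h5 := inf_supp_eq_bot_iff.2 h4
      rwa [supp_iterate_half, inf_eq_left.2 inf_le_left] at h5
    · refine basicSet_mono ((hE.isUnitFamily n).le_multProj_of_le_supp (i := ⟨e, he⟩) ?_ ?_) hω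
      · rw [unitFamily, supp_iterate_half]
      · exact ((supp e).map_nsmul hk).le
  rcases hE.cases he with h1 | h1
  · rw [finVal_of_mem_I (basicSet_mono (supp_le_projI h1) hω), key 0 1 (one_nsmul _)]
    simp
  · rw [finVal_of_mem_II (basicSet_mono (mem_typeII_iff.1 h1) hω), floorSup]
    have : ∀ n : ℕ, floorAt (unitFamily E n) e ω / 2 ^ n = 1 := fun n => by
      rw [key n _ (two_pow_nsmul_iterate_half (hE.subset_fin he) h1.1 n)]
      push_cast
      exact ENNReal.div_self (by simp) (by simp)
    simp [this]

end FiniteValues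

end DimScale

namespace DimScale

open scoped ENNReal

/-! ### The inclusion of `[0, ∞]` into `ℝ_∞` -/

namespace AlephExt

/-- The inclusion of `[0, ∞]` into `ℝ_∞` that maps `∞` to `ℵ₀`. -/
noncomputable def ofENNReal (x : ℝ≥0∞) : RInf.{u} :=
  if x = ∞ then aleph 0 else fin x.toNNReal

@[simp] theorem ofENNReal_top : ofENNReal.{u} ∞ = aleph 0 := if_pos rfl

@[simp] theorem ofENNReal_coe (r : ℝ≥0) : ofENNReal.{u} r = fin r := by
  rw [ofENNReal, if_neg ENNReal.coe_ne_top, ENNReal.toNNReal_coe]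

theorem zero_eq_fin : (0 : RInf.{u}) = fin 0 := rfl

@[simp] theorem ofENNReal_zero : ofENNReal.{u} 0 = 0 := ofENNReal_coe 0

@[simp] theorem ofENNReal_natCast (n : ℕ) : ofENNReal.{u} n = fin (n : ℝ≥0) :=
  ofENNReal_coe n

@[simp] theorem ofENNReal_one : ofENNReal.{u} 1 = fin 1 := ofENNReal_coe 1

theorem ofENNReal_add (x y : ℝ≥0∞) : ofENNReal.{u} (x + y) = ofENNReal x + ofENNReal y := by
  induction x with
  | top => induction y with
    | top => simp
    | coe y => simp
  | coe x => induction y with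
    | top => simp
    | coe y => rw [← ENNReal.coe_add, ofENNReal_coe]; simp

theorem strictMono_ofENNReal : StrictMono ofENNReal.{u} := by
  intro x y h
  induction x with
  | top => exact absurd h not_top_lt
  | coe x => induction y with
    | top => simp
    | coe y => simpa using h

theorem ofENNReal_le_aleph (x : ℝ≥0∞) (ξ : Ordinal.{u}) : ofENNReal x ≤ aleph ξ := by
  refine (strictMono_ofENNReal.monotone (le_top (a := x))).trans ?_
  simp

theorem continuous_ofENNReal : Continuous ofENNReal.{u} := by
  refine continuous_iff.2 ?_
  rintro (r | ξ)
  · constructor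
    · convert isOpen_Ioi (a := (r : ℝ≥0∞)) using 1
      ext x
      simp [← ofENNReal_coe.{u}, strictMono_ofENNReal.lt_iff_lt]
    · convert isOpen_Iio (a := (r : ℝ≥0∞)) using 1
      ext x
      simp [← ofENNReal_coe.{u}, strictMono_ofENNReal.lt_iff_lt]
  · constructor
    · convert isOpen_empty
      ext x
      simpa using ofENNReal_le_aleph x ξ
    · rcases eq_or_ne ξ 0 with rfl | hξ
      · convert isOpen_Iio (a := ∞) using 1
        ext x
        rw [← ofENNReal_top]
        simp only [Set.mem_ofPred_eq, Set.mem_Iio, strictMono_ofENNReal.lt_iff_lt]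
      · convert isOpen_univ
        ext x
        simp only [Set.mem_ofPred_eq, Set.mem_univ, iff_true]
        exact (ofENNReal_le_aleph x 0).trans_lt (by simpa [pos_iff_ne_zero] using hξ)

theorem aleph_add_of_le {ξ : Ordinal.{u}} {y : RInf.{u}} (h : y ≤ aleph ξ) :
    aleph ξ + y = aleph ξ := by
  rcases y with r | η
  · rfl
  · simpa using h

end AlephExt

open AlephExt

/-! ### The scale map: additivity, continuity, reflection of the order -/

section ScaleMap

variable {S : Type u} [PartialCommMonoid S] [hS : Fact (IsContinuousDimensionScale S)]

/-- From a stable `θ` on, rank at least `θ` implies every rank, by induction; so ranks greater than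
`θ` do not occur. The bound is uniform in `x`, which makes `rankAt` meaningful at single
ultrafilters, as these need not be closed under infinite meets. -/
theorem exists_succProj_eq_bot :
    ∃ θ : Ordinal.{u}, ∀ x : S, PurelyInfinite x → succProj θ x = ⊥ := by
  obtain ⟨θ, hθ⟩ := exists_rankProj_eq_succ (S := S)
  have key : ∀ ξ : Ordinal.{u}, ∀ x : S, rankProj θ x ≤ rankProj ξ x := by
    intro ξ
    induction ξ using WellFoundedLT.induction with
    | ind ξ ih =>
    intro x
    refine le_rankProj_iff.2 ⟨rankProj_le_supp θ x, fun η hη => (hθ x).trans ?_⟩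
    exact iSup_mono fun y => inf_le_inf le_rfl (ih η hη y)
  refine ⟨θ, fun x hx => eq_bot_of_forall_le_succProj hx fun ξ => ?_⟩
  exact (succProj_le_rankProj θ x).trans ((key (Order.succ ξ) x).trans
    (rankProj_le_succProj (Order.lt_succ ξ) x))

/-- The rank of the purely infinite part of an element at an ultrafilter. -/
noncomputable def rankAt (x : S) (ω : UltrafilterSpace S) : Ordinal.{u} :=
  sInf {ξ | ω ∉ basicSet (succProj ξ x)}

theorem succProj_apply_of_le {ξ : Ordinal.{u}} {x y : S} {p : Projection S} (h : p x ≤ p y)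
    {ω : UltrafilterSpace S} (hω : ω ∈ basicSet p) (hx : ω ∈ basicSet (succProj ξ x)) :
    ω ∈ basicSet (succProj ξ y) := by
  refine basicSet_mono (le_succProj_of_apply_le ?_ inf_le_right) (mem_basicSet_inf.2 ⟨hω, hx⟩)
  rw [inf_comm, Projection.inf_apply, Projection.inf_apply]
  exact Projection.mono _ h

theorem notMem_succProj_rankAt {x : S} {ω : UltrafilterSpace S} (hω : ω ∈ basicSet (infProj x)) :
    ω ∉ basicSet (succProj (rankAt x ω) x) := by
  have hne : {ξ | ω ∉ basicSet (succProj ξ x)}.Nonempty := by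
    obtain ⟨θ, hθ⟩ := exists_succProj_eq_bot (S := S)
    refine ⟨θ, fun h => ?_⟩
    have := succProj_apply_of_le (y := infProj x x) ((infProj x).idem x).ge hω h
    rw [hθ _ (purelyInfinite_infProj_apply x)] at this
    exact notMem_basicSet_bot ω this
  exact csInf_mem hne

theorem lt_rankAt_iff {x : S} {ω : UltrafilterSpace S} (hω : ω ∈ basicSet (infProj x))
    {ξ : Ordinal.{u}} : ξ < rankAt x ω ↔ ω ∈ basicSet (succProj ξ x) := by
  constructor
  · intro h
    by_contra hcon
    exact absurd (csInf_le' (show ξ ∈ {ξ | ω ∉ basicSet (succProj ξ x)} from hcon)) (not_le.2 h)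
  · intro h
    by_contra! hle
    exact notMem_succProj_rankAt hω (basicSet_mono (succProj_anti hle x) h)

theorem HasRank.rankAt_eq {ξ : Ordinal.{u}} {x : S} {q : Projection S} (h : HasRank ξ x q)
    (hq : q ≤ infProj x) {ω : UltrafilterSpace S} (hω : ω ∈ basicSet q) : rankAt x ω = ξ := by
  have hω' := basicSet_mono hq hω
  refine le_antisymm (not_lt.1 fun hlt => ?_) (le_of_forall_lt fun η hη => ?_)
  · rw [lt_rankAt_iff hω'] at hlt
    exact mem_basicSet_compl.1 (basicSet_mono h.2 hω) hlt
  · rw [lt_rankAt_iff hω']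
    exact basicSet_mono (h.1.trans (rankProj_le_succProj hη x)) hω

open Classical in
/-- The function that represents an element of a continuous dimension scale. -/
noncomputable def scaleFun (E : Set S) (a : S) (ω : UltrafilterSpace S) : RInf.{u} :=
  if ω ∈ basicSet (infProj a) then aleph (rankAt a ω) else ofENNReal (finVal E a ω)

variable {E : Set S}

theorem scaleFun_of_mem {a : S} {ω : UltrafilterSpace S} (h : ω ∈ basicSet (infProj a)) :
    scaleFun E a ω = aleph (rankAt a ω) := if_pos h

theorem scaleFun_of_notMem {a : S} {ω : UltrafilterSpace S} (h : ω ∉ basicSet (infProj a)) :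
    scaleFun E a ω = ofENNReal (finVal E a ω) := if_neg h

theorem inf_infProj_le {x y : S} {p : Projection S} (h : p x ≤ p y) :
    p ⊓ infProj x ≤ infProj y := by
  rw [← disjoint_compl_right_iff, disjoint_iff]
  set r := p ⊓ infProj x ⊓ (infProj y)ᶜ with hr
  have h1 : PurelyInfinite (r x) := (le_infProj_iff.1 (inf_le_left.trans inf_le_right)).2
  have h2 : DirectlyFinite (r y) := le_compl_infProj_iff.1 inf_le_right
  have h3 : r x ≤ r y := by
    have hrp : r ≤ p := inf_le_left.trans inf_le_left
    have := r.mono h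
    rwa [r.apply_of_le hrp, r.apply_of_le hrp] at this
  have h4 := inf_supp_eq_bot_iff.2 (h1.eq_zero (h2.mono h3))
  rwa [inf_eq_left.2] at h4
  exact (inf_le_left.trans inf_le_right).trans (infProj_le_supp x)

theorem mem_infProj_of_le {x y : S} {p : Projection S} (h : p x ≤ p y) {ω : UltrafilterSpace S}
    (hω : ω ∈ basicSet p) (hx : ω ∈ basicSet (infProj x)) : ω ∈ basicSet (infProj y) :=
  basicSet_mono (inf_infProj_le h) (mem_basicSet_inf.2 ⟨hω, hx⟩)

theorem IsFinitaryUnit.scaleFun_mono (hE : IsFinitaryUnit E) {x y : S} {p : Projection S}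
    (h : p x ≤ p y) {ω : UltrafilterSpace S} (hω : ω ∈ basicSet p) :
    scaleFun E x ω ≤ scaleFun E y ω := by
  by_cases hx : ω ∈ basicSet (infProj x)
  · have hy := mem_infProj_of_le h hω hx
    rw [scaleFun_of_mem hx, scaleFun_of_mem hy, aleph_le_aleph]
    refine le_of_forall_lt fun ξ hξ => ?_
    rw [lt_rankAt_iff hx] at hξ
    rw [lt_rankAt_iff hy]
    exact succProj_apply_of_le h hω hξ
  · rw [scaleFun_of_notMem hx]
    by_cases hy : ω ∈ basicSet (infProj y)
    · rw [scaleFun_of_mem hy]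
      exact ofENNReal_le_aleph _ _
    · rw [scaleFun_of_notMem hy]
      exact strictMono_ofENNReal.monotone (hE.finVal_mono h hω)

theorem IsFinitaryUnit.scaleFun_congr (hE : IsFinitaryUnit E) {x y : S} {p : Projection S}
    (h : p x = p y) {ω : UltrafilterSpace S} (hω : ω ∈ basicSet p) :
    scaleFun E x ω = scaleFun E y ω :=
  le_antisymm (hE.scaleFun_mono h.le hω) (hE.scaleFun_mono h.ge hω)

/-- From `0 + 0 = 0` the value is `0` wherever it is finite. That happens on a dense set, and
continuity does the rest. -/
theorem IsFinitaryUnit.finVal_zero (hE : IsFinitaryUnit E) : finVal E (0 : S) = fun _ => 0 := by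
  refine eq_of_dense_basicSet (hE.continuous_finVal 0) continuous_const fun p hp => ?_
  obtain ⟨q, hq, hq0, hfin⟩ := hE.exists_finVal_ne_top (a := 0)
    (directlyFinite_zero.projection p) hp
  obtain ⟨ω, hω⟩ := exists_mem_basicSet hq0
  refine ⟨ω, basicSet_mono hq hω, ?_⟩
  have h1 := hE.finVal_add (a := 0) (b := 0) (c := 0) (by rw [Ext.of_zero, add_zero]) ω
  have h2 := hfin ω hω
  nth_rewrite 1 [← add_zero (finVal E 0 ω)] at h1
  exact ((ENNReal.add_right_inj h2).1 h1).symm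

theorem infProj_zero : infProj (0 : S) = ⊥ := by
  rw [eq_bot_iff, ← supp_zero]
  exact infProj_le_supp 0

theorem IsFinitaryUnit.scaleFun_zero (hE : IsFinitaryUnit E) (ω : UltrafilterSpace S) :
    scaleFun E (0 : S) ω = 0 := by
  rw [scaleFun_of_notMem (by rw [infProj_zero]; exact notMem_basicSet_bot ω), hE.finVal_zero,
    ofENNReal_zero]

/-- Where `a` is purely infinite and `b ≤ a`, the sum `c` equals `a`; correspondingly, an aleph
absorbs every value not above it. -/
theorem IsFinitaryUnit.scaleFun_add_of_mem (hE : IsFinitaryUnit E) {a b c : S}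
    (hc : (a + b : Ext S) = c) {ω : UltrafilterSpace S} (ha : ω ∈ basicSet (infProj a))
    (hba : ω ∈ basicSet (leProj b a)) : scaleFun E c ω = scaleFun E a ω + scaleFun E b ω := by
  have hq := mem_basicSet_inf.2 ⟨ha, hba⟩
  set q := infProj a ⊓ leProj b a with hq'
  have h1 : q b ≤ q a := le_leProj_iff.1 inf_le_right
  have h2 : PurelyInfinite (q a) := (le_infProj_iff.1 inf_le_left).2
  have h3 : q c = q a := by
    refine le_antisymm ?_ (q.mono (le_of_add_eq hc))
    rw [← Ext.of_le_of, ← q.add hc]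
    exact (add_le_add le_rfl (Ext.of_le_of.2 h1)).trans (purelyInfinite_iff.1 h2).le
  have h4 := hE.scaleFun_mono h1 hq
  rw [hE.scaleFun_congr h3 hq]
  rw [scaleFun_of_mem ha] at h4 ⊢
  exact (aleph_add_of_le h4).symm

theorem IsFinitaryUnit.scaleFun_add (hE : IsFinitaryUnit E) {a b c : S}
    (hc : (a + b : Ext S) = c) (ω : UltrafilterSpace S) :
    scaleFun E c ω = scaleFun E a ω + scaleFun E b ω := by
  have hac : (⊤ : Projection S) a ≤ (⊤ : Projection S) c := (⊤ : Projection S).mono (le_of_add_eq hc)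
  have hbc : (⊤ : Projection S) b ≤ (⊤ : Projection S) c :=
    (⊤ : Projection S).mono (le_of_add_eq' hc)
  by_cases hab : ω ∈ basicSet (infProj a) ∨ ω ∈ basicSet (infProj b)
  -- At `ω` one of the two is the larger, and it is purely infinite there as soon as either is.
  · have hcmp : ω ∈ basicSet (leProj b a) ∨ ω ∈ basicSet (leProj a b) := by
      rw [← mem_basicSet_sup, leProj_sup_leProj]
      exact mem_basicSet_top ω
    rcases hcmp with h | h
    · have ha : ω ∈ basicSet (infProj a) :=
        hab.elim id (mem_infProj_of_le (leProj_apply_le b a) h)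
      exact hE.scaleFun_add_of_mem hc ha h
    · have hb : ω ∈ basicSet (infProj b) :=
        hab.elim (mem_infProj_of_le (leProj_apply_le a b) h) id
      rw [add_comm]
      exact hE.scaleFun_add_of_mem ((add_comm _ _).trans hc) hb h
  · push Not at hab
    have hcn : ω ∉ basicSet (infProj c) := by
      rw [← mem_basicSet_compl, ← mem_basicSet_compl] at hab
      rw [← mem_basicSet_compl]
      refine basicSet_mono (le_compl_infProj_iff.2 ?_) (mem_basicSet_inf.2 hab)
      exact (le_compl_infProj_iff.1 inf_le_left).add (le_compl_infProj_iff.1 inf_le_right)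
        (Projection.add _ hc)
    rw [scaleFun_of_notMem hcn, scaleFun_of_notMem hab.1, scaleFun_of_notMem hab.2,
      hE.finVal_add hc, ofENNReal_add]

theorem IsFinitaryUnit.scaleFun_projection (hE : IsFinitaryUnit E) (x : S) (p : Projection S) :
    scaleFun E (p x) = (basicSet p).indicator (scaleFun E x) := by
  funext ω
  by_cases hω : ω ∈ basicSet p
  · rw [Set.indicator_of_mem hω]
    exact hE.scaleFun_congr (p.idem x) hω
  · rw [Set.indicator_of_notMem hω, ← hE.scaleFun_zero ω]
    refine hE.scaleFun_congr (p := pᶜ) ?_ (mem_basicSet_compl.2 hω)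
    rw [p.compl_apply_self, Projection.map_zero]

/-- On the clopen set of `infProj a`, the condition `ξ < rankAt a ω` is membership in the clopen set
of `succProj ξ a`; elsewhere continuity comes from `finVal`. -/
theorem IsFinitaryUnit.continuous_scaleFun (hE : IsFinitaryUnit E) (a : S) :
    Continuous (scaleFun E a) := by
  refine continuous_iff_continuousAt.2 fun ω => ?_
  by_cases hω : ω ∈ basicSet (infProj a)
  · have hev : ∀ᶠ ω' in nhds ω, ω' ∈ basicSet (infProj a) := (isOpen_basicSet _).mem_nhds hω
    refine tendsto_order.2 ⟨fun t ht => ?_, fun t ht => ?_⟩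
    · rw [scaleFun_of_mem hω] at ht
      rcases t with r | ξ
      · filter_upwards [hev] with ω' h
        rw [scaleFun_of_mem h]
        exact fin_lt_aleph _ _
      · rw [aleph_lt_aleph, lt_rankAt_iff hω] at ht
        filter_upwards [hev, (isOpen_basicSet _).mem_nhds ht] with ω' h h'
        rw [scaleFun_of_mem h, aleph_lt_aleph, lt_rankAt_iff h]
        exact h'
    · rw [scaleFun_of_mem hω] at ht
      rcases t with r | ξ
      · exact absurd ht (not_aleph_lt_fin _ _)
      · rw [gt_iff_lt, aleph_lt_aleph] at ht
        have h1 := mem_basicSet_compl.2 (notMem_succProj_rankAt hω)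
        filter_upwards [hev, (isOpen_basicSet _).mem_nhds h1] with ω' h h'
        rw [scaleFun_of_mem h, aleph_lt_aleph]
        refine lt_of_le_of_lt (not_lt.1 fun hlt => ?_) ht
        exact mem_basicSet_compl.1 h' ((lt_rankAt_iff h).1 hlt)
  · refine ContinuousAt.congr
      (continuous_ofENNReal.comp (hE.continuous_finVal a)).continuousAt ?_
    filter_upwards [(isOpen_basicSet _).mem_nhds (mem_basicSet_compl.2 hω)] with ω' h
    exact (scaleFun_of_notMem (mem_basicSet_compl.1 h)).symm

theorem IsFinitaryUnit.scaleFun_mem (hE : IsFinitaryUnit E) (a : S) :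
    scaleFun E a ∈ ScaleFunctions S := by
  refine mem_scaleFunctions_iff.2 ⟨hE.continuous_scaleFun a, fun ω hω => ?_, fun ω hω => ?_⟩
  · by_cases h : ω ∈ basicSet (infProj a)
    · exact ⟨aleph (rankAt a ω), (scaleFun_of_mem h).symm⟩
    · rw [scaleFun_of_notMem h, finVal_of_mem_I hω]
      rcases (hE.isUnitFamily 0).floorAt_cases a ω with ⟨h1, -⟩ | ⟨k, h1, -⟩
      · exact ⟨aleph 0, by rw [h1, ofENNReal_top]; rfl⟩
      · exact ⟨fin k, by rw [h1, ofENNReal_natCast]; rfl⟩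
  · by_cases h : ω ∈ basicSet (infProj a)
    · exact ⟨aleph (rankAt a ω), (scaleFun_of_mem h).symm⟩
    · rw [scaleFun_of_notMem h, finVal_of_mem_III hω]
      exact ⟨0, by rw [ofENNReal_zero]; rfl⟩

theorem inf_ne_bot_or (p q : Projection S) :
    p ⊓ q ≠ ⊥ ∨ p ≤ qᶜ := by
  by_cases h : p ⊓ q = ⊥
  · exact Or.inr (le_compl_iff_disjoint_right.2 (disjoint_iff.2 h))
  · exact Or.inl h

theorem IsFinitaryUnit.exists_scaleFun_lt_aleph (hE : IsFinitaryUnit E) {y : S}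
    {p : Projection S} (hy : DirectlyFinite (p y)) (h0 : p ≠ ⊥) :
    ∃ q ≤ p, q ≠ ⊥ ∧ ∀ ω ∈ basicSet q, ∃ r : ℝ≥0, finVal E y ω = r ∧ scaleFun E y ω = fin r := by
  obtain ⟨q, hq, hq0, hfin⟩ := hE.exists_finVal_ne_top hy h0
  refine ⟨q, hq, hq0, fun ω hω => ⟨(finVal E y ω).toNNReal,
    (ENNReal.coe_toNNReal (hfin ω hω)).symm, ?_⟩⟩
  rw [scaleFun_of_notMem, ← ofENNReal_coe, ENNReal.coe_toNNReal (hfin ω hω)]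
  exact mem_basicSet_compl.1 (basicSet_mono (hq.trans (le_compl_infProj_iff.2 hy)) hω)

theorem apply_infProj_apply {x : S} {q : Projection S} (hq : q ≤ infProj x) :
    q (infProj x x) = q x := q.apply_of_le hq x

theorem exists_hasRank_infProj {x : S} {p : Projection S} (hp : p ≤ infProj x) (h0 : p ≠ ⊥) :
    ∃ ξ, ∃ q ≤ p, q ≠ ⊥ ∧ HasRank ξ x q := by
  obtain ⟨ξ, q, hq, hq0, h⟩ := exists_hasRank (purelyInfinite_infProj_apply x) (p := p) (by
    rw [supp_projection_apply]
    exact le_inf hp (hp.trans (infProj_le_supp x))) h0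
  exact ⟨ξ, q, hq, hq0, h.congr (apply_infProj_apply (hq.trans hp))⟩

/-- If both elements are purely infinite, shrink until both ranks are constant. If only `x` is,
shrink until the value of `y` is finite. If `x` is directly finite on `p`, then `p x = p y + d` with
`d` supported on all of `p`; shrink until `d` has nonzero and `y` has finite value. -/
theorem IsFinitaryUnit.exists_scaleFun_lt (hE : IsFinitaryUnit E) {x y : S} {p : Projection S}
    (hp : p ≤ ltProj y x) (h0 : p ≠ ⊥) :
    ∃ q ≤ p, q ≠ ⊥ ∧ ∀ ω ∈ basicSet q, scaleFun E y ω < scaleFun E x ω := by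
  rcases inf_ne_bot_or p (infProj x) with hr | hfin
  · rcases inf_ne_bot_or (p ⊓ infProj x) (infProj y) with hs | hyfin
    · obtain ⟨ξ, q₁, hq₁, hq₁0, hx⟩ := exists_hasRank_infProj (x := x)
        (inf_le_left.trans inf_le_right) hs
      obtain ⟨ζ, q₂, hq₂, hq₂0, hy⟩ := exists_hasRank_infProj (x := y)
        (hq₁.trans inf_le_right) hq₁0
      have hy' : q₂ ≤ infProj y := (hq₂.trans hq₁).trans inf_le_right
      have hx' : q₂ ≤ infProj x := (hq₂.trans hq₁).trans (inf_le_left.trans inf_le_right)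
      have hlt : ζ < ξ := by
        refine (hx.mono hq₂).lt (hy.congr (apply_infProj_apply hy').symm)
          (purelyInfinite_infProj_apply y) ?_ hq₂0
        refine le_ltProj_of_le ((hq₂.trans hq₁).trans (inf_le_left.trans (inf_le_left.trans hp)))
          (apply_infProj_apply hy').le le_rfl
      refine ⟨q₂, (hq₂.trans hq₁).trans (inf_le_left.trans inf_le_left), hq₂0, fun ω hω => ?_⟩
      rw [scaleFun_of_mem (basicSet_mono hx' hω), scaleFun_of_mem (basicSet_mono hy' hω),
        (hx.mono hq₂).rankAt_eq hx' hω, hy.rankAt_eq hy' hω]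
      exact aleph_lt_aleph.2 hlt
    · obtain ⟨q, hq, hq0, h⟩ := hE.exists_scaleFun_lt_aleph (le_compl_infProj_iff.1 hyfin) hr
      refine ⟨q, hq.trans inf_le_left, hq0, fun ω hω => ?_⟩
      obtain ⟨r, -, h2⟩ := h ω hω
      rw [h2, scaleFun_of_mem (basicSet_mono (hq.trans inf_le_right) hω)]
      exact fin_lt_aleph _ _
  · have hle := apply_le_of_le_ltProj hp
    have hxf : DirectlyFinite (p x) := le_compl_infProj_iff.1 hfin
    have hyf : DirectlyFinite (p y) := hxf.mono hle
    obtain ⟨d, hd⟩ := le_iff_exists.1 hle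
    have hpd : p ≤ supp d := by
      rw [← disjoint_compl_right_iff, disjoint_iff]
      refine le_ltProj_iff.1 hp _ inf_le_left ?_
      have h1 := (p ⊓ (supp d)ᶜ).add hd
      rw [(le_compl_supp_iff (x := d)).1 inf_le_right, Ext.of_zero, add_zero, Ext.of_inj,
        Projection.apply_of_le inf_le_left, Projection.apply_of_le inf_le_left] at h1
      exact h1.ge
    have hIII : p ≤ (projIII S)ᶜ := by
      rw [← inf_eq_left.2 (hp.trans (ltProj_le_supp y x)), ← supp_projection_apply]
      exact supp_le_compl_projIII hxf
    obtain ⟨q₁, hq₁, hq₁0, h1⟩ := hE.exists_finVal_ne_zero hIII hpd h0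
    obtain ⟨q₂, hq₂, hq₂0, h2⟩ := hE.exists_finVal_ne_top (a := y)
      (p := q₁) (by rw [← q₁.apply_of_le hq₁]; exact hyf.projection _) hq₁0
    refine ⟨q₂, hq₂.trans hq₁, hq₂0, fun ω hω => ?_⟩
    have hωp := basicSet_mono (hq₂.trans hq₁) hω
    rw [scaleFun_of_notMem (mem_basicSet_compl.1 (basicSet_mono hfin hωp)),
      scaleFun_of_notMem (mem_basicSet_compl.1 (basicSet_mono (le_compl_infProj_iff.2 hyf) hωp))]
    refine strictMono_ofENNReal ?_
    have h3 := hE.finVal_add hd ω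
    have h4 : finVal E (p x) ω = finVal E x ω := le_antisymm
      (hE.finVal_mono (p.idem x).le hωp) (hE.finVal_mono (p.idem x).ge hωp)
    have h5 : finVal E (p y) ω = finVal E y ω := le_antisymm
      (hE.finVal_mono (p.idem y).le hωp) (hE.finVal_mono (p.idem y).ge hωp)
    rw [h4, h5] at h3
    rw [h3]
    exact ENNReal.lt_add_right (h2 ω hω) (h1 ω (basicSet_mono hq₂ hω))

/-- Where `x ≤ y` fails, `y < x` strictly, and the values would show it at some ultrafilter. -/
theorem IsFinitaryUnit.le_of_scaleFun_le (hE : IsFinitaryUnit E) {x y : S} {p : Projection S}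
    (h : ∀ ω ∈ basicSet p, scaleFun E x ω ≤ scaleFun E y ω) : p x ≤ p y := by
  rw [← le_leProj_iff]
  rcases eq_or_ne (p ⊓ ltProj y x) ⊥ with h0 | h0
  · rwa [ltProj, ← disjoint_iff, disjoint_compl_right_iff] at h0
  · obtain ⟨q, hq, hq0, hlt⟩ := hE.exists_scaleFun_lt inf_le_right h0
    obtain ⟨ω, hω⟩ := exists_mem_basicSet hq0
    exact absurd (h ω (basicSet_mono (hq.trans inf_le_left) hω)) (not_le.2 (hlt ω hω))

theorem IsFinitaryUnit.scaleFun_unit (hE : IsFinitaryUnit E) {e : S} (he : e ∈ E)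
    (ω : UltrafilterSpace S) : scaleFun E e ω ∈ ({0, fin 1} : Set RInf.{u}) := by
  by_cases h : ω ∈ basicSet (supp e)
  · right
    have h1 : (⊤ : Projection S) ≤ (infProj e)ᶜ := by
      rw [le_compl_infProj_iff, Projection.top_apply]
      exact hE.subset_fin he
    rw [scaleFun_of_notMem (mem_basicSet_compl.1 (basicSet_mono h1 (mem_basicSet_top ω))),
      hE.finVal_unit he h, ofENNReal_one]
    rfl
  · left
    rw [← supp_apply e, hE.scaleFun_projection, Set.indicator_of_notMem h]

end ScaleMap

end DimScale

namespace DimScale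

open scoped ENNReal

open AlephExt

/-! ### The range of the scale map is a lower set -/

theorem exists_dyadic_btwn {r s : ℝ≥0} (h : r < s) :
    ∃ k n : ℕ, r < (k : ℝ≥0) / 2 ^ n ∧ (k : ℝ≥0) / 2 ^ n < s := by
  obtain ⟨n, hn⟩ := exists_pow_lt_of_lt_one (tsub_pos_of_lt h) (show (2⁻¹ : ℝ≥0) < 1 from
    inv_lt_one_of_one_lt₀ one_lt_two)
  have h2 : (0 : ℝ≥0) < 2 ^ n := by positivity
  -- Since `2^(-n) < s - r`, the first multiple of `2^(-n)` beyond `r` lies before `s`.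
  refine ⟨⌊r * 2 ^ n⌋₊ + 1, n, ?_, ?_⟩
  · rw [lt_div_iff₀ h2]
    exact_mod_cast Nat.lt_floor_add_one (r * 2 ^ n)
  · push_cast
    rw [add_div]
    calc (⌊r * 2 ^ n⌋₊ : ℝ≥0) / 2 ^ n + 1 / 2 ^ n ≤ r + 1 / 2 ^ n := by
          refine add_le_add ?_ le_rfl
          rw [div_le_iff₀ h2]
          exact Nat.floor_le zero_le
      _ < r + (s - r) := by
          refine add_lt_add_of_le_of_lt le_rfl ?_
          rwa [one_div, ← inv_pow]
      _ = s := add_tsub_cancel_of_le h.le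

theorem exists_dyadic_fin_btwn {r : ℝ≥0} {y : RInf.{u}} (h : fin r < y) :
    ∃ k n : ℕ, r < (k : ℝ≥0) / 2 ^ n ∧ fin ((k : ℝ≥0) / 2 ^ n) < y := by
  rcases y with s | ξ
  · obtain ⟨k, n, h1, h2⟩ := exists_dyadic_btwn (fin_lt_fin.1 h)
    exact ⟨k, n, h1, fin_lt_fin.2 h2⟩
  · obtain ⟨k, n, h1, -⟩ := exists_dyadic_btwn (lt_add_one r)
    exact ⟨k, n, h1, fin_lt_aleph _ _⟩

theorem range_toRInf_cases {y : RInf.{u}} (h : y ∈ Set.range ZInf.toRInf) :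
    (∃ n : ℕ, y = fin (n : ℝ≥0)) ∨ ∃ ξ, y = aleph ξ := by
  obtain ⟨n | ξ, rfl⟩ := h
  · exact Or.inl ⟨n, rfl⟩
  · exact Or.inr ⟨ξ, rfl⟩

theorem range_twoInf_toRInf_cases {y : RInf.{u}} (h : y ∈ Set.range TwoInf.toRInf) :
    y = fin 0 ∨ ∃ ξ, y = aleph ξ := by
  obtain ⟨n | ξ, rfl⟩ := h
  · exact Or.inl rfl
  · exact Or.inr ⟨ξ, rfl⟩

section LowerRange

variable {S : Type u} [PartialCommMonoid S] [hS : Fact (IsContinuousDimensionScale S)]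
  {E : Set S}

theorem IsUnitFamily.infProj_le_multProj {ι : Type*} {h : ι → S} (hu : IsUnitFamily h) (k : ℕ)
    (x : S) : infProj x ≤ multProj h k x := by
  refine hu.le_multProj_iff.2 fun i => ?_
  set p := infProj x with hp
  have hx := purelyInfinite_infProj_apply x
  have h1 : supp (p x) = p := by
    rw [supp_projection_apply, inf_eq_left]
    exact infProj_le_supp x
  have h2 : p (h i) ≤ p x := by
    have := le_leProj_iff.1 (hx.supp_le_leProj (hu.fin i))
    rwa [h1, p.idem] at this
  induction k with
  | zero => rw [zero_nsmul]; exact zero_le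
  | succ k ih =>
    rw [succ_nsmul]
    exact (add_le_add ih (Ext.of_le_of.2 h2)).trans (purelyInfinite_iff.1 hx).le

/-- A standard element: `z` has the constant value `t` on a nonzero projection below `q`. -/
def HasStandard (E : Set S) (t : RInf.{u}) (q : Projection S) (x : S) : Prop :=
  ∃ q' ≤ q, q' ≠ ⊥ ∧ ∃ z ≤ x, ∀ ω ∈ basicSet q', scaleFun E z ω = t

/-- An element of rank at least `ξ` has below it, locally, one of rank exactly `ξ`. -/
theorem IsFinitaryUnit.hasStandard_aleph (hE : IsFinitaryUnit E) {ξ : Ordinal.{u}} {x : S}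
    {p : Projection S} (h0 : p ≠ ⊥) (h : ∀ ω ∈ basicSet p, aleph ξ ≤ scaleFun E x ω) :
    HasStandard E (aleph ξ) p x := by
  -- Outside `infProj x` the value `ℵ₀` can occur only where `finVal` is `∞`, and `finVal` is finite
  -- throughout some nonzero smaller projection.
  have hp : p ≤ infProj x := by
    rcases inf_ne_bot_or p (infProj x)ᶜ with h1 | h1
    · obtain ⟨q, hq, hq0, h2⟩ :=
        hE.exists_scaleFun_lt_aleph (le_compl_infProj_iff.1 inf_le_right) h1
      obtain ⟨ω, hω⟩ := exists_mem_basicSet hq0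
      obtain ⟨r, -, h3⟩ := h2 ω hω
      have h4 := h ω (basicSet_mono (hq.trans inf_le_left) hω)
      rw [h3] at h4
      exact absurd (fin_lt_aleph r ξ) (not_lt.2 h4)
    · rwa [compl_compl] at h1
  have hr : p ≤ rankProj ξ x := by
    refine le_rankProj_iff.2 ⟨hp.trans (infProj_le_supp x), fun η hη => ?_⟩
    refine le_of_basicSet_subset fun ω hω => ?_
    have h1 := h ω hω
    rw [scaleFun_of_mem (basicSet_mono hp hω), aleph_le_aleph] at h1
    exact (lt_rankAt_iff (basicSet_mono hp hω)).1 (hη.trans_le h1)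
  obtain ⟨q, hq, hq0, y, hy, hyI, hrk⟩ := exists_hasRank_le (purelyInfinite_infProj_apply x)
    (le_rankProj_of_apply_le (apply_infProj_apply hp).ge hr) h0
  have hqy : q ≤ infProj y :=
    le_infProj_iff.2 ⟨hrk.1.trans (rankProj_le_supp _ _), hyI.projection q⟩
  refine ⟨q, hq, hq0, y, hy.trans (Projection.apply_le _ _), fun ω hω => ?_⟩
  rw [scaleFun_of_mem (basicSet_mono hqy hω), hrk.rankAt_eq hqy hω]

theorem IsFinitaryUnit.finVal_nsmul (hE : IsFinitaryUnit E) {k : ℕ} {a c : S}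
    (h : k • (a : Ext S) = c) (ω : UltrafilterSpace S) : finVal E c ω = k * finVal E a ω := by
  induction k generalizing c with
  | zero =>
    rw [zero_nsmul, ← Ext.of_zero, Ext.of_inj] at h
    rw [← h, hE.finVal_zero, Nat.cast_zero, zero_mul]
  | succ k ih =>
    rw [succ_nsmul] at h
    obtain ⟨b, -, hb, -⟩ := Ext.exists_of_add_eq h
    rw [hb] at h
    rw [hE.finVal_add h, ih hb, Nat.cast_succ, add_mul, one_mul]

/-- The witness consists of `k` copies of the `2^n`-th part of a unit that meets `p`, restricted to
its support in `p`. -/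
theorem IsFinitaryUnit.hasStandard_of_le_multProj (hE : IsFinitaryUnit E) {n k : ℕ} {x : S}
    {p : Projection S} (h0 : p ≠ ⊥) (hp : p ≤ (projIII S)ᶜ) (hn : n = 0 ∨ p ≤ projII S)
    (h : p ≤ multProj (unitFamily E n) k x) : HasStandard E (fin ((k : ℝ≥0) / 2 ^ n)) p x := by
  obtain ⟨e, he⟩ := (hE.isUnitFamily n).cover p hp h0
  set q := p ⊓ supp (unitFamily E n e) with hq
  obtain ⟨z, hz, hzx⟩ := Ext.exists_of_le ((hE.isUnitFamily n).multProj_apply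
    (p := q) (inf_le_left.trans h) e)
  refine ⟨q, inf_le_left, he, z, hzx.trans (q.apply_le x), fun ω hω => ?_⟩
  have hef : DirectlyFinite e.1 := hE.subset_fin e.2
  have hωe : ω ∈ basicSet (supp e.1) := by
    have : q ≤ supp e.1 := by
      rw [← supp_iterate_half n]; exact inf_le_right
    exact basicSet_mono this hω
  have hzf : DirectlyFinite ((⊤ : Projection S) z) :=
    ((((hE.isUnitFamily n).fin e).projection q).nsmul hz).projection _
  rw [scaleFun_of_notMem (mem_basicSet_compl.1
    (basicSet_mono (le_compl_infProj_iff.2 hzf) (mem_basicSet_top ω))), hE.finVal_nsmul hz]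
  have h1 : finVal E (q (unitFamily E n e)) ω = finVal E (unitFamily E n e) ω :=
    le_antisymm (hE.finVal_mono (q.idem _).le hω) (hE.finVal_mono (q.idem _).ge hω)
  have h2 : 2 ^ n * finVal E (unitFamily E n e) ω = 1 := by
    rcases hn with rfl | hII
    · rw [pow_zero, one_mul]
      exact hE.finVal_unit e.2 hωe
    · rcases hE.cases e.2 with h3 | h3
      · refine absurd ?_ he
        rw [hq, unitFamily, supp_iterate_half, eq_bot_iff, ← inf_compl_eq_bot (a := projI S),
          inf_comm]
        exact inf_le_inf (supp_le_projI h3) (hII.trans inf_le_left)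
      · have := hE.finVal_nsmul (two_pow_nsmul_iterate_half hef h3.1 n) ω
        rw [hE.finVal_unit e.2 hωe] at this
        rw [this]
        push_cast
        rfl
  have h3 : finVal E (unitFamily E n e) ω = ((2 ^ n : ℝ≥0)⁻¹ : ℝ≥0) := by
    rw [ENNReal.coe_inv (by positivity)]
    push_cast
    exact ENNReal.eq_inv_of_mul_eq_one_left (by rw [mul_comm]; exact h2)
  rw [h1, h3, ← ENNReal.coe_natCast, ← ENNReal.coe_mul, ofENNReal_coe, div_eq_mul_inv]

theorem hasStandard_zero (hE : IsFinitaryUnit E) {x : S} {p : Projection S} (h0 : p ≠ ⊥) :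
    HasStandard E (fin 0) p x :=
  ⟨p, le_rfl, h0, 0, DimScale.zero_le x, fun ω _ => hE.scaleFun_zero ω⟩

theorem IsFinitaryUnit.hasStandard_natCast (hE : IsFinitaryUnit E) {k : ℕ} {x : S}
    {p : Projection S} (h0 : p ≠ ⊥) (hp : p ≤ projI S)
    (h : ∀ ω ∈ basicSet p, fin (k : ℝ≥0) ≤ scaleFun E x ω) : HasStandard E (fin (k : ℝ≥0)) p x := by
  have : p ≤ multProj (unitFamily E 0) k x := by
    refine le_of_basicSet_subset fun ω hω => ?_
    by_contra hcon
    have hfin : ω ∉ basicSet (infProj x) := fun h1 =>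
      hcon (basicSet_mono ((hE.isUnitFamily 0).infProj_le_multProj k x) h1)
    have h1 := h ω hω
    rw [scaleFun_of_notMem hfin, finVal_of_mem_I (basicSet_mono hp hω), ← ofENNReal_natCast,
      strictMono_ofENNReal.le_iff_le] at h1
    cases k with
    | zero => exact hcon (by rw [multProj_zero]; exact mem_basicSet_top ω)
    | succ k =>
      have h2 := h1.trans ((hE.isUnitFamily 0).floorAt_le hcon)
      rw [Nat.cast_le] at h2
      omega
  simpa using hE.hasStandard_of_le_multProj h0 (hp.trans projI_le_compl_projIII) (Or.inl rfl) this

/-- If `k > 0` copies fail to fit at scale `n`, the value is at most `k / 2^n`; hence the strict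
inequality in the hypothesis. -/
theorem IsFinitaryUnit.hasStandard_dyadic (hE : IsFinitaryUnit E) {k n : ℕ} {x : S}
    {p : Projection S} (h0 : p ≠ ⊥) (hp : p ≤ projII S)
    (h : ∀ ω ∈ basicSet p, fin ((k : ℝ≥0) / 2 ^ n) < scaleFun E x ω) :
    HasStandard E (fin ((k : ℝ≥0) / 2 ^ n)) p x := by
  refine hE.hasStandard_of_le_multProj h0 (hp.trans inf_le_right) (Or.inr hp) ?_
  refine le_of_basicSet_subset fun ω hω => ?_
  by_contra hcon
  have hfin : ω ∉ basicSet (infProj x) := fun h1 =>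
    hcon (basicSet_mono ((hE.isUnitFamily n).infProj_le_multProj k x) h1)
  have h1 := h ω hω
  have hII := basicSet_mono hp hω
  rw [scaleFun_of_notMem hfin, finVal_of_mem_II hII, ← ofENNReal_coe,
    strictMono_ofENNReal.lt_iff_lt] at h1
  cases k with
  | zero => exact hcon (by rw [multProj_zero]; exact mem_basicSet_top ω)
  | succ k =>
    refine absurd (hE.floorSup_le x hII n) (not_le.2 (lt_of_le_of_lt ?_ h1))
    rw [ENNReal.coe_div (by positivity)]
    push_cast
    exact ENNReal.div_le_div_right (add_le_add ((hE.isUnitFamily n).floorAt_le hcon) le_rfl) _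

/-- Two scale functions with different values at some point can be separated by a standard value
on a nonzero projection. -/
theorem IsFinitaryUnit.exists_separation (hE : IsFinitaryUnit E) {f g : UltrafilterSpace S → RInf.{u}}
    (hf : f ∈ ScaleFunctions S) (hg : g ∈ ScaleFunctions S) {x : S}
    (hgx : ∀ ω, g ω ≤ scaleFun E x ω) {ω₀ : UltrafilterSpace S} (hlt : f ω₀ < g ω₀) :
    (∃ q ≠ ⊥, ∃ t, (∀ ω ∈ basicSet q, f ω ≤ t ∧ t < g ω) ∧ HasStandard E t q x) ∧
    (∃ q ≠ ⊥, ∃ t, (∀ ω ∈ basicSet q, f ω < t ∧ t ≤ g ω) ∧ HasStandard E t q x) := by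
  obtain ⟨hfc, hfI, hfIII⟩ := mem_scaleFunctions_iff.1 hf
  obtain ⟨hgc, hgI, hgIII⟩ := mem_scaleFunctions_iff.1 hg
  have hopen : ∀ (p : Projection S), ω₀ ∈ basicSet p → ∀ s t : RInf.{u}, f ω₀ < s → t < g ω₀ →
      ∃ q ≤ p, q ≠ ⊥ ∧ ∀ ω ∈ basicSet q, f ω < s ∧ t < g ω := by
    intro p hp s t hs ht
    obtain ⟨q, hq, hq0, -, hsub⟩ := exists_le_basicSet_subset
      (((isOpen_Iio (a := s)).preimage hfc).inter ((isOpen_Ioi (a := t)).preimage hgc))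
      (ω := ω₀) ⟨hs, ht⟩ hp
    exact ⟨q, hq, hq0, fun ω hω => hsub hω⟩
  rcases hval : f ω₀ with r | ξ
  · rw [hval] at hlt hopen
    rcases mem_type_cases ω₀ with h | h | h
    -- Type I: the separating values are the consecutive integers `n` and `n + 1`.
    · have hn : ∃ n : ℕ, r = n := by
        rcases range_toRInf_cases (hval ▸ hfI ω₀ h) with ⟨n, hn⟩ | ⟨ξ, hξ⟩
        · exact ⟨n, by injection hn⟩
        · cases hξ
      obtain ⟨n, rfl⟩ := hn
      obtain ⟨q, hq, hq0, hsep⟩ := hopen _ h (fin ((n + 1 : ℕ) : ℝ≥0)) (fin (n : ℝ≥0))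
        (fin_lt_fin.2 (by exact_mod_cast n.lt_succ_self)) hlt
      have h1 : ∀ ω ∈ basicSet q, f ω ≤ fin (n : ℝ≥0) := fun ω hω => by
        have h2 := (hsep ω hω).1
        rcases range_toRInf_cases (hfI ω (basicSet_mono hq hω)) with ⟨m, hm⟩ | ⟨ξ, hξ⟩
        · rw [hm, fin_lt_fin, Nat.cast_lt] at h2
          rw [hm, fin_le_fin, Nat.cast_le]
          omega
        · rw [hξ] at h2
          exact absurd h2 (not_aleph_lt_fin _ _)
      have h3 : ∀ ω ∈ basicSet q, fin ((n + 1 : ℕ) : ℝ≥0) ≤ g ω := fun ω hω => by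
        have h2 := (hsep ω hω).2
        rcases range_toRInf_cases (hgI ω (basicSet_mono hq hω)) with ⟨m, hm⟩ | ⟨ξ, hξ⟩
        · rw [hm, fin_lt_fin, Nat.cast_lt] at h2
          rw [hm, fin_le_fin, Nat.cast_le]
          omega
        · rw [hξ]
          exact (fin_lt_aleph _ _).le
      refine ⟨⟨q, hq0, fin (n : ℝ≥0), fun ω hω => ⟨h1 ω hω, (hsep ω hω).2⟩,
        hE.hasStandard_natCast hq0 hq fun ω hω => (hsep ω hω).2.le.trans (hgx ω)⟩,
        ⟨q, hq0, fin ((n + 1 : ℕ) : ℝ≥0), fun ω hω => ⟨(hsep ω hω).1, h3 ω hω⟩,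
        hE.hasStandard_natCast hq0 hq fun ω hω => (h3 ω hω).trans (hgx ω)⟩⟩
    -- Type II: one dyadic number strictly between the two values serves both purposes.
    · obtain ⟨k, n, h1, h2⟩ := exists_dyadic_fin_btwn hlt
      obtain ⟨q, hq, hq0, hsep⟩ := hopen _ h _ _ (fin_lt_fin.2 h1) h2
      have hst := hE.hasStandard_dyadic hq0 hq fun ω hω => (hsep ω hω).2.trans_le (hgx ω)
      exact ⟨⟨q, hq0, _, fun ω hω => ⟨(hsep ω hω).1.le, (hsep ω hω).2⟩, hst⟩,
        ⟨q, hq0, _, fun ω hω => ⟨(hsep ω hω).1, (hsep ω hω).2.le⟩, hst⟩⟩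
    · have hr : r = 0 := by
        rcases range_twoInf_toRInf_cases (hval ▸ hfIII ω₀ h) with hn | ⟨ξ, hξ⟩
        · injection hn
        · cases hξ
      subst hr
      -- Type III: the separating values are `0` and the next value `ℵ₀`.
      obtain ⟨q, hq, hq0, hsep⟩ := hopen _ h (aleph 0) (fin 0) (fin_lt_aleph _ _) hlt
      have h1 : ∀ ω ∈ basicSet q, f ω ≤ fin 0 := fun ω hω => by
        have h2 := (hsep ω hω).1
        rcases range_twoInf_toRInf_cases (hfIII ω (basicSet_mono hq hω)) with hm | ⟨ξ, hξ⟩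
        · exact hm.le
        · rw [hξ, aleph_lt_aleph] at h2
          exact absurd h2 (not_lt_zero)
      have h3 : ∀ ω ∈ basicSet q, aleph 0 ≤ g ω := fun ω hω => by
        have h2 := (hsep ω hω).2
        rcases range_twoInf_toRInf_cases (hgIII ω (basicSet_mono hq hω)) with hm | ⟨ξ, hξ⟩
        · rw [hm] at h2
          exact absurd h2 (lt_irrefl _)
        · rw [hξ, aleph_le_aleph]
          exact zero_le
      exact ⟨⟨q, hq0, fin 0, fun ω hω => ⟨h1 ω hω, (hsep ω hω).2⟩, hasStandard_zero hE hq0⟩,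
        ⟨q, hq0, aleph 0, fun ω hω => ⟨(hsep ω hω).1, h3 ω hω⟩,
        hE.hasStandard_aleph hq0 fun ω hω => (h3 ω hω).trans (hgx ω)⟩⟩
  · rw [hval] at hlt hopen
    -- For an aleph the separating values are `ℵ_ξ` and its successor, whatever the type.
    obtain ⟨q, -, hq0, hsep⟩ := hopen ⊤ (mem_basicSet_top _) (aleph (Order.succ ξ)) (aleph ξ)
      (aleph_lt_aleph.2 (Order.lt_succ ξ)) hlt
    have h1 : ∀ ω ∈ basicSet q, f ω ≤ aleph ξ := fun ω hω => by
      have h2 := (hsep ω hω).1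
      rcases hv : f ω with r | η <;> rw [hv] at h2
      · exact (fin_lt_aleph _ _).le
      · rw [aleph_lt_aleph, Order.lt_succ_iff] at h2
        exact aleph_le_aleph.2 h2
    have h3 : ∀ ω ∈ basicSet q, aleph (Order.succ ξ) ≤ g ω := fun ω hω => by
      have h2 := (hsep ω hω).2
      rcases hv : g ω with r | η <;> rw [hv] at h2
      · exact absurd h2 (not_aleph_lt_fin _ _)
      · rw [aleph_lt_aleph] at h2
        exact aleph_le_aleph.2 (Order.succ_le_of_lt h2)
    exact ⟨⟨q, hq0, aleph ξ, fun ω hω => ⟨h1 ω hω, (hsep ω hω).2⟩,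
      hE.hasStandard_aleph hq0 fun ω hω => (hsep ω hω).2.le.trans (hgx ω)⟩,
      ⟨q, hq0, aleph (Order.succ ξ), fun ω hω => ⟨(hsep ω hω).1, h3 ω hω⟩,
      hE.hasStandard_aleph hq0 fun ω hω => (h3 ω hω).trans (hgx ω)⟩⟩

theorem RInf.zero_le (y : RInf.{u}) : 0 ≤ y := by
  have := le_add_left' (0 : RInf.{u}) y
  rwa [zero_add] at this

/-- The element is the supremum of all `c ≤ b` with values at most `f`. A discrepancy in either
direction can be separated by a standard value, which contradicts being the least upper bound or
being an upper bound. -/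
theorem IsFinitaryUnit.exists_scaleFun_eq (hE : IsFinitaryUnit E)
    {f : UltrafilterSpace S → RInf.{u}} (hf : f ∈ ScaleFunctions S) {b : S}
    (hfb : ∀ ω, f ω ≤ scaleFun E b ω) : ∃ x : S, scaleFun E x = f := by
  set X : Set S := {c | c ≤ b ∧ ∀ ω, scaleFun E c ω ≤ f ω} with hX
  obtain ⟨x, hx⟩ := exists_isLUB (X := X) ⟨b, fun c hc => hc.1⟩
  have hxb : x ≤ b := hx.2 fun c hc => hc.1
  refine ⟨x, funext fun ω => le_antisymm (not_lt.1 fun hlt => ?_) (not_lt.1 fun hlt => ?_)⟩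
  · obtain ⟨⟨q, -, t, hsep, q', hq', hq'0, z, hz, hzt⟩, -⟩ :=
      hE.exists_separation hf (hE.scaleFun_mem x) (fun _ => le_rfl) hlt
    -- Lowering `x` to the standard element `z` on `q'` still bounds every `c`, as `f ≤ t` there.
    -- Then `x ≤ w` forces the value of `x` to be at most `t` on `q'`.
    obtain ⟨w, -, hw1, hw2⟩ := q'.exists_glue ((q'.apply_le z).trans hz) (q'ᶜ.apply_le x)
    have hxw : x ≤ w := hx.2 fun c hc => by
      refine q'.le_of_apply ?_ ?_
      · rw [hw1]
        refine hE.le_of_scaleFun_le fun ω hω => ?_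
        rw [hzt ω hω]
        exact (hc.2 ω).trans (hsep ω (basicSet_mono hq' hω)).1
      · rw [hw2]
        exact q'ᶜ.mono (hx.1 hc)
    obtain ⟨ω', hω'⟩ := exists_mem_basicSet hq'0
    have h1 := hE.scaleFun_mono ((q'.mono hxw).trans hw1.le) hω'
    rw [hzt ω' hω'] at h1
    exact absurd (hsep ω' (basicSet_mono hq' hω')).2 (not_lt.2 h1)
  · obtain ⟨-, ⟨q, -, t, hsep, q', hq', hq'0, z, hz, hzt⟩⟩ :=
      hE.exists_separation (hE.scaleFun_mem x) hf hfb hlt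
    -- The standard element cut down to `q'` has values at most `f`, so it belongs to `X` and lies
    -- below `x`, although its value there exceeds that of `x`.
    have hzX : q' z ∈ X := by
      refine ⟨(q'.apply_le z).trans hz, fun ω => ?_⟩
      rw [hE.scaleFun_projection]
      by_cases hω : ω ∈ basicSet q'
      · rw [Set.indicator_of_mem hω, hzt ω hω]
        exact (hsep ω (basicSet_mono hq' hω)).2
      · rw [Set.indicator_of_notMem hω]
        exact RInf.zero_le _
    obtain ⟨ω', hω'⟩ := exists_mem_basicSet hq'0
    have h1 := hE.scaleFun_mono (E := E) (show q' z ≤ q' x by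
      rw [← q'.idem z]
      exact q'.mono (hx.1 hzX)) hω'
    rw [hzt ω' hω'] at h1
    exact absurd (hsep ω' (basicSet_mono hq' hω')).1 (not_lt.2 h1)

end LowerRange

end DimScale

namespace DimScale

open scoped ENNReal

open AlephExt

theorem nsmul_fin (k : ℕ) (r : ℝ≥0) : k • (fin r : RInf.{u}) = fin (k * r) := by
  induction k with
  | zero => rw [zero_nsmul, Nat.cast_zero, zero_mul]; rfl
  | succ k ih => rw [succ_nsmul, ih, fin_add_fin, Nat.cast_succ, add_mul, one_mul]

theorem eq_aleph_of_add_self {y : RInf.{u}} (h : y + y = y) : y = 0 ∨ ∃ ξ, y = aleph ξ := by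
  rcases y with r | ξ
  · left
    have h1 : fin (r + r) = (fin r : RInf.{u}) := h
    have h2 : r + r = r := by injection h1
    rw [left_eq_add.1 h2.symm]
    rfl
  · exact Or.inr ⟨ξ, rfl⟩

/-! ### Uniqueness of admissible embeddings -/

section Uniqueness

variable {S : Type u} [PartialCommMonoid S] [hS : Fact (IsContinuousDimensionScale S)]
  {E : Set S} {ε ε' : S → ScaleFunctions S}

theorem isSum_scaleFunctions_iff {f g h : ScaleFunctions S} :
    IsSum f g h ↔ ∀ ω, f.1 ω + g.1 ω = h.1 ω := by
  have : IsSum f g h ↔ f + g = h := Option.some_inj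
  rw [this, Subtype.ext_iff, funext_iff]
  rfl

theorem continuous_scaleFunctions (f : ScaleFunctions S) : Continuous f.1 :=
  (mem_scaleFunctions_iff.1 f.2).1

theorem indicator_const_mem {c : RInf.{u}} {p : Projection S}
    (hI : ∀ ω ∈ basicSet p, ω ∈ basicSet (projI S) → c ∈ Set.range ZInf.toRInf)
    (hIII : ∀ ω ∈ basicSet p, ω ∈ basicSet (projIII S) → c ∈ Set.range TwoInf.toRInf) :
    (basicSet p).indicator (fun _ => c) ∈ ScaleFunctions S := by
  refine mem_scaleFunctions_iff.2 ⟨?_, fun ω h => ?_, fun ω h => ?_⟩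
  · exact continuous_const.indicator (by simp [(isClopen_basicSet p).frontier_eq])
  · by_cases hω : ω ∈ basicSet p
    · rw [Set.indicator_of_mem hω]
      exact hI ω hω h
    · rw [Set.indicator_of_notMem hω]
      exact ⟨0, map_zero' _⟩
  · by_cases hω : ω ∈ basicSet p
    · rw [Set.indicator_of_mem hω]
      exact hIII ω hω h
    · rw [Set.indicator_of_notMem hω]
      exact ⟨0, map_zero' _⟩

theorem indicator_aleph_mem (ξ : Ordinal.{u}) (p : Projection S) :
    (basicSet p).indicator (fun _ => (aleph ξ : RInf.{u})) ∈ ScaleFunctions S :=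
  indicator_const_mem (fun _ _ _ => ⟨aleph ξ, rfl⟩) fun _ _ _ => ⟨aleph ξ, rfl⟩

theorem indicator_natCast_mem (n : ℕ) {p : Projection S} (hp : p ≤ projI S) :
    (basicSet p).indicator (fun _ => (fin (n : ℝ≥0) : RInf.{u})) ∈ ScaleFunctions S :=
  indicator_const_mem (fun _ _ _ => ⟨fin n, rfl⟩) fun _ h h' =>
    absurd h' (notMem_III_of_mem_I (basicSet_mono hp h))

namespace IsAdmissibleEmbedding

theorem add (hε : IsAdmissibleEmbedding E ε) {a b c : S} (h : (a + b : Ext S) = c)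
    (ω : UltrafilterSpace S) : (ε a).1 ω + (ε b).1 ω = (ε c).1 ω :=
  isSum_scaleFunctions_iff.1 (hε.isLowerEmbedding.isHom.map_add a b c h) ω

theorem zero (hε : IsAdmissibleEmbedding E ε) (ω : UltrafilterSpace S) : (ε 0).1 ω = 0 := by
  rw [hε.isLowerEmbedding.isHom.map_zero]
  rfl

theorem nsmul (hε : IsAdmissibleEmbedding E ε) {k : ℕ} {a c : S} (h : k • (a : Ext S) = c)
    (ω : UltrafilterSpace S) : (ε c).1 ω = k • (ε a).1 ω := by
  induction k generalizing c with
  | zero =>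
    rw [zero_nsmul, ← Ext.of_zero, Ext.of_inj] at h
    rw [← h, hε.zero, zero_nsmul]
  | succ k ih =>
    rw [succ_nsmul] at h
    obtain ⟨b, -, hb, -⟩ := Ext.exists_of_add_eq h
    rw [hb] at h
    rw [← hε.add h, ih hb, succ_nsmul]

theorem le (hε : IsAdmissibleEmbedding E ε) {a b : S} (h : a ≤ b) (ω : UltrafilterSpace S) :
    (ε a).1 ω ≤ (ε b).1 ω := by
  obtain ⟨c, hc⟩ := le_iff_exists.1 h
  rw [← hε.add hc]
  exact le_add_left' _ _

theorem apply_of_mem (hε : IsAdmissibleEmbedding E ε) (a : S) {p : Projection S}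
    {ω : UltrafilterSpace S} (hω : ω ∈ basicSet p) : (ε (p a)).1 ω = (ε a).1 ω := by
  rw [hε.map_projection, Set.indicator_of_mem hω]

theorem apply_of_notMem (hε : IsAdmissibleEmbedding E ε) (a : S) {p : Projection S}
    {ω : UltrafilterSpace S} (hω : ω ∉ basicSet p) : (ε (p a)).1 ω = 0 := by
  rw [hε.map_projection, Set.indicator_of_notMem hω]

/-- This is injectivity of `ε` made local by compatibility with projections. -/
theorem apply_eq (hε : IsAdmissibleEmbedding E ε) {a b : S} {p : Projection S}
    (h : ∀ ω ∈ basicSet p, (ε a).1 ω = (ε b).1 ω) : p a = p b := by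
  refine hε.isLowerEmbedding.injective (Subtype.ext (funext fun ω => ?_))
  by_cases hω : ω ∈ basicSet p
  · rw [hε.apply_of_mem a hω, hε.apply_of_mem b hω, h ω hω]
  · rw [hε.apply_of_notMem a hω, hε.apply_of_notMem b hω]

/-- The lower range provides the element, and reflection of the order puts it below `a`. This is how
functions are turned back into elements of `S`. -/
theorem exists_le (hε : IsAdmissibleEmbedding E ε) {a : S} {f g : UltrafilterSpace S → RInf.{u}}
    (hf : f ∈ ScaleFunctions S) (hg : g ∈ ScaleFunctions S)
    (h : ∀ ω, f ω + g ω = (ε a).1 ω) : ∃ b ≤ a, (ε b).1 = f := by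
  have h1 : AlgLE (⟨f, hf⟩ : ScaleFunctions S) (ε a) :=
    ⟨⟨g, hg⟩, isSum_scaleFunctions_iff.2 h⟩
  obtain ⟨b, hb⟩ := hε.isLowerEmbedding.range_lower _ _ h1
  refine ⟨b, algLE_iff.1 (hε.isLowerEmbedding.le_of_map_le _ _ ?_), congrArg Subtype.val hb⟩
  rwa [hb]

/-! ### Purely infinite elements -/

theorem eq_zero_or_aleph (hε : IsAdmissibleEmbedding E ε) {x : S} (hx : PurelyInfinite x)
    (ω : UltrafilterSpace S) : (ε x).1 ω = 0 ∨ ∃ ξ, (ε x).1 ω = aleph ξ :=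
  eq_aleph_of_add_self (hε.add (purelyInfinite_iff.1 hx) ω)

/-- A purely infinite element below a purely infinite element, with a prescribed value. -/
theorem exists_aleph (hε : IsAdmissibleEmbedding E ε) {x : S} (hx : PurelyInfinite x)
    {ξ : Ordinal.{u}} {p : Projection S} (h : ∀ ω ∈ basicSet p, aleph ξ ≤ (ε x).1 ω) :
    ∃ y ≤ x, PurelyInfinite y ∧ ∀ ω ∈ basicSet p, (ε y).1 ω = aleph ξ := by
  obtain ⟨y, hy, hyε⟩ := hε.exists_le (indicator_aleph_mem ξ p) (ε x).2 (a := x) fun ω => by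
    by_cases hω : ω ∈ basicSet p
    · rw [Set.indicator_of_mem hω]
      have h1 := h ω hω
      rcases hv : (ε x).1 ω with r | η <;> rw [hv] at h1
      · exact absurd (fin_lt_aleph r ξ) (not_lt.2 h1)
      · simpa using h1
    · rw [Set.indicator_of_notMem hω, zero_add]
  refine ⟨y, hy, ?_, fun ω hω => by rw [hyε, Set.indicator_of_mem hω]⟩
  have h1 : (y + y : Ext S) ≤ x :=
    (add_le_add (Ext.of_le_of.2 hy) (Ext.of_le_of.2 hy)).trans (purelyInfinite_iff.1 hx).le
  obtain ⟨w, hw, -⟩ := Ext.exists_of_le h1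
  -- The sum `y + y` is defined because it is below `x`; injectivity then identifies it with `y`,
  -- since alephs are idempotent.
  have h2 : w = y := by
    refine hε.isLowerEmbedding.injective (Subtype.ext (funext fun ω => ?_))
    rw [← hε.add hw, hyε]
    by_cases hω : ω ∈ basicSet p
    · rw [Set.indicator_of_mem hω, aleph_add_aleph, max_self]
    · rw [Set.indicator_of_notMem hω, zero_add]
  rw [purelyInfinite_iff, hw, h2]

/-- Induction on `ξ`. If `ε'` gave `x` a constant smaller value `ℵ_ζ` on some `r`, take `y ≤ x` with
`ε`-value `ℵ_ζ` there. By induction `ε'` cannot distinguish `y` from `x` on `r`, so `r y = r x`, and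
`ε x` would be `ℵ_ζ` too. -/
theorem aleph_le (hε : IsAdmissibleEmbedding E ε) (hε' : IsAdmissibleEmbedding E ε')
    (ξ : Ordinal.{u}) : ∀ {x : S} {p : Projection S}, PurelyInfinite x →
      (∀ ω ∈ basicSet p, aleph ξ ≤ (ε x).1 ω) → ∀ ω ∈ basicSet p, aleph ξ ≤ (ε' x).1 ω := by
  induction ξ using WellFoundedLT.induction with
  | ind ξ ih =>
  intro x p hx h ω hω
  by_contra! hlt
  obtain ⟨q, hq, hq0, -, hsub⟩ := exists_le_basicSet_subset
    ((isOpen_Iio (a := aleph ξ)).preimage (continuous_scaleFunctions (ε' x))) (ω := ω) hlt hω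
  set Z : Set Ordinal.{u} := {ζ | ∃ ω ∈ basicSet q, (ε' x).1 ω = aleph ζ} with hZ
  -- If no aleph occurred, `ε' x` would vanish on `q`; then `q x = 0`, against `ε x ≥ ℵ_ξ`.
  have hne : Z.Nonempty := by
    by_contra! hcon
    have h1 : q x = q 0 := hε'.apply_eq fun ω hω => by
      rw [hε'.zero]
      rcases hε'.eq_zero_or_aleph hx ω with h0 | ⟨ζ, hζ⟩
      · exact h0
      · exact absurd (hcon ▸ (⟨ω, hω, hζ⟩ : ζ ∈ Z) : ζ ∈ (∅ : Set Ordinal.{u})) (by simp)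
    obtain ⟨ω', hω'⟩ := exists_mem_basicSet hq0
    have h2 := h ω' (basicSet_mono hq hω')
    rw [← hε.apply_of_mem x hω', h1, hε.apply_of_mem 0 hω', hε.zero] at h2
    exact absurd (fin_lt_aleph (0 : ℝ≥0) ξ) (not_lt.2 h2)
  obtain ⟨ω₁, hω₁, hval⟩ : sInf Z ∈ Z := csInf_mem hne
  set ζ := sInf Z with hζ
  have hζξ : ζ < ξ := by
    have := hsub hω₁
    rwa [Set.mem_preimage, Set.mem_Iio, hval, aleph_lt_aleph] at this
  -- Near `ω₁` the values are nonzero and below `ℵ_(ζ+1)`; minimality of `ζ` makes them equal to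
  -- `ℵ_ζ`.
  obtain ⟨r, hr, hr0, -, hrsub⟩ := exists_le_basicSet_subset
    (((isOpen_Iio (a := aleph (Order.succ ζ))).preimage (continuous_scaleFunctions (ε' x))).inter
      ((isOpen_Ioi (a := fin (0 : ℝ≥0))).preimage (continuous_scaleFunctions (ε' x))))
    (ω := ω₁) ⟨by rw [Set.mem_preimage, hval]; exact aleph_lt_aleph.2 (Order.lt_succ ζ),
      by rw [Set.mem_preimage, hval]; exact fin_lt_aleph _ _⟩ hω₁
  have hconst : ∀ ω ∈ basicSet r, (ε' x).1 ω = aleph ζ := fun ω hω => by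
    obtain ⟨h1, h2⟩ := hrsub hω
    rcases hε'.eq_zero_or_aleph hx ω with h0 | ⟨η, hη⟩
    · rw [Set.mem_preimage, h0] at h2
      exact absurd h2 (lt_irrefl (0 : RInf.{u}))
    · rw [Set.mem_preimage, hη, Set.mem_Iio, aleph_lt_aleph, Order.lt_succ_iff] at h1
      rw [hη, h1.antisymm (csInf_le' ⟨ω, basicSet_mono hr hω, hη⟩)]
  have hrp := basicSet_mono (hr.trans hq)
  obtain ⟨y, hyx, hy, hyε⟩ := hε.exists_aleph (p := r) hx (ξ := ζ) fun ω hω =>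
    (aleph_le_aleph.2 hζξ.le).trans (h ω (hrp hω))
  have h1 := ih ζ hζξ hy fun ω hω => (hyε ω hω).ge
  have h2 : r y = r x := hε'.apply_eq fun ω hω => by
    refine le_antisymm (hε'.le hyx ω) ?_
    rw [hconst ω hω]
    exact h1 ω hω
  obtain ⟨ω', hω'⟩ := exists_mem_basicSet hr0
  have h3 := h ω' (hrp hω')
  rw [← hε.apply_of_mem x hω', ← h2, hε.apply_of_mem y hω', hyε ω' hω', aleph_le_aleph] at h3
  exact absurd hζξ (not_lt.2 h3)

/-- Above each possible value `t` of `ε' x` there is a next aleph, `ℵ₀` or a successor. If `ε x`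
exceeds `t` at a point, it is at least that aleph nearby, and `aleph_le` transfers the bound to
`ε'`. -/
theorem le_of_purelyInfinite (hε : IsAdmissibleEmbedding E ε) (hε' : IsAdmissibleEmbedding E ε')
    {x : S} (hx : PurelyInfinite x) (ω : UltrafilterSpace S) : (ε x).1 ω ≤ (ε' x).1 ω := by
  by_contra! hlt
  have key : ∀ t : RInf.{u}, t < (ε x).1 ω → ∀ ξ, (∀ η, t < aleph η → ξ ≤ η) →
      (t = fin 0 ∨ ∃ ζ, t = aleph ζ) → aleph ξ ≤ (ε' x).1 ω := by
    intro t ht ξ hξ ht'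
    obtain ⟨q, -, -, hωq, hsub⟩ := exists_le_basicSet_subset
      ((isOpen_Ioi (a := t)).preimage (continuous_scaleFunctions (ε x))) (ω := ω) ht (mem_basicSet_top ω)
    refine hε.aleph_le hε' ξ hx (fun ω' hω' => ?_) ω hωq
    have h1 : t < (ε x).1 ω' := hsub hω'
    rcases hε.eq_zero_or_aleph hx ω' with h0 | ⟨η, hη⟩
    · rw [h0] at h1
      exact absurd h1 (not_lt.2 (RInf.zero_le t))
    · rw [hη] at h1 ⊢
      exact aleph_le_aleph.2 (hξ η h1)
  rcases hε'.eq_zero_or_aleph hx ω with h0 | ⟨ζ, hζ⟩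
  · have := key _ hlt 0 (fun _ _ => zero_le) (Or.inl h0)
    rw [h0] at this
    exact absurd (fin_lt_aleph (0 : ℝ≥0) 0) (not_lt.2 this)
  · have := key _ hlt (Order.succ ζ) (fun η hη => by
      rw [hζ, aleph_lt_aleph] at hη
      exact Order.succ_le_of_lt hη) (Or.inr ⟨ζ, hζ⟩)
    rw [hζ, aleph_le_aleph] at this
    exact absurd (Order.lt_succ ζ) (not_lt.2 this)

/-! ### Finite elements -/

theorem mem_supp (hε : IsAdmissibleEmbedding E ε) {a : S} {ω : UltrafilterSpace S}
    (h : (ε a).1 ω ≠ 0) : ω ∈ basicSet (supp a) := by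
  by_contra hω
  rw [← supp_apply a, hε.apply_of_notMem a hω] at h
  exact h rfl

theorem natCast_or_aleph (ε : S → ScaleFunctions S) (a : S) {ω : UltrafilterSpace S}
    (hω : ω ∈ basicSet (projI S)) : (∃ n : ℕ, (ε a).1 ω = fin (n : ℝ≥0)) ∨
      ∃ ξ, (ε a).1 ω = aleph ξ :=
  range_toRInf_cases ((mem_scaleFunctions_iff.1 (ε a).2).2.1 ω hω)

theorem exists_two_add (hε : IsAdmissibleEmbedding E ε) {a : S} {ω : UltrafilterSpace S}
    (hω : ω ∈ basicSet (projI S)) (h : fin 1 < (ε a).1 ω) :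
    ∃ r ≤ projI S, r ≠ ⊥ ∧ ∃ g ∈ ScaleFunctions S, ∀ ω,
      (basicSet r).indicator (fun _ => fin ((1 : ℕ) : ℝ≥0)) ω +
        ((basicSet r).indicator (fun _ => fin ((1 : ℕ) : ℝ≥0)) ω + g ω) = (ε (r a)).1 ω := by
  obtain ⟨q, hq, hq0, -, hsub⟩ := exists_le_basicSet_subset
    ((isOpen_Ioi (a := fin (1 : ℝ≥0))).preimage (continuous_scaleFunctions (ε a))) (ω := ω) h hω
  -- If some value is finite, say `m + 2`, it is locally constant and the remainder `g` is the
  -- constant `m`. Otherwise all values on `q` are alephs, which absorb the two units, so `g` may be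
  -- `ε (q a)` itself.
  by_cases hfin : ∃ ω₁ ∈ basicSet q, ∃ n : ℕ, (ε a).1 ω₁ = fin (n : ℝ≥0)
  · obtain ⟨ω₁, hω₁, n, hn⟩ := hfin
    have h1 : fin 1 < (ε a).1 ω₁ := hsub hω₁
    rw [hn, fin_lt_fin, Nat.one_lt_cast] at h1
    obtain ⟨m, rfl⟩ := Nat.exists_eq_add_of_le' h1
    obtain ⟨r, hr, hr0, -, hrsub⟩ := exists_le_basicSet_subset
      (((isOpen_Iio (a := fin ((m + 3 : ℕ) : ℝ≥0))).preimage (continuous_scaleFunctions (ε a))).inter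
        ((isOpen_Ioi (a := fin ((m + 1 : ℕ) : ℝ≥0))).preimage (continuous_scaleFunctions (ε a)))) (ω := ω₁)
      ⟨by rw [Set.mem_preimage, hn, Set.mem_Iio, fin_lt_fin, Nat.cast_lt]; omega,
        by rw [Set.mem_preimage, hn, Set.mem_Ioi, fin_lt_fin, Nat.cast_lt]; omega⟩ hω₁
    refine ⟨r, hr.trans hq, hr0, _, indicator_natCast_mem m (hr.trans hq), fun ω' => ?_⟩
    by_cases hω' : ω' ∈ basicSet r
    · rw [Set.indicator_of_mem hω', Set.indicator_of_mem hω', hε.apply_of_mem a hω']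
      obtain ⟨h2, h3⟩ := hrsub hω'
      rw [Set.mem_preimage] at h2 h3
      rcases natCast_or_aleph ε a (basicSet_mono (hr.trans hq) hω') with ⟨k, hk⟩ | ⟨ξ, hξ⟩
      · rw [hk, Set.mem_Iio, fin_lt_fin, Nat.cast_lt] at h2
        rw [hk, Set.mem_Ioi, fin_lt_fin, Nat.cast_lt] at h3
        rw [hk, fin_add_fin, fin_add_fin, ← Nat.cast_add, ← Nat.cast_add]
        congr 2
        omega
      · rw [hξ] at h2
        exact absurd h2 (not_aleph_lt_fin _ _)
    · rw [Set.indicator_of_notMem hω', Set.indicator_of_notMem hω', hε.apply_of_notMem a hω',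
        add_zero, add_zero]
  · refine ⟨q, hq, hq0, _, (ε (q a)).2, fun ω' => ?_⟩
    by_cases hω' : ω' ∈ basicSet q
    · rw [Set.indicator_of_mem hω', hε.apply_of_mem a hω']
      rcases natCast_or_aleph ε a (basicSet_mono hq hω') with hk | ⟨ξ, hξ⟩
      · exact absurd ⟨ω', hω', hk⟩ hfin
      · rw [hξ]
        rfl
    · rw [Set.indicator_of_notMem hω', hε.apply_of_notMem a hω', add_zero, add_zero]

/-- A value greater than `1` leaves room for two copies of the indicator of some `Ω_r`. These come
from an element of `S` whose double is below `e`, contradicting multiple-freeness. -/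
theorem le_one_of_multipleFree (hε : IsAdmissibleEmbedding E ε) {e : S} (he : MultipleFree e)
    (ω : UltrafilterSpace S) : (ε e).1 ω ≤ fin 1 := by
  by_contra! hlt
  obtain ⟨r, hr, hr0, g, hg, hsum⟩ := hε.exists_two_add (basicSet_mono (supp_le_projI he)
    (hε.mem_supp ((RInf.zero_le _).trans_lt hlt).ne')) hlt
  have hf := indicator_natCast_mem 1 hr
  obtain ⟨y, -, hyε⟩ := hε.exists_le hf (add_mem hf hg) hsum
  obtain ⟨w, hw, hwε⟩ := hε.exists_le (add_mem hf hf) hg fun ω => (add_assoc _ _ _).trans (hsum ω)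
  have hyw : y ≤ w := algLE_iff.1 <| hε.isLowerEmbedding.le_of_map_le _ _
    ⟨ε y, isSum_scaleFunctions_iff.2 fun ω => by rw [hyε, hwε]; rfl⟩
  obtain ⟨z, hz⟩ := le_iff_exists.1 hyw
  -- That `y + y` is defined is not known beforehand: the complement `z` of `y` in `w` is shown to
  -- have the same values as `y`.
  have hzy : z = y := by
    refine hε.isLowerEmbedding.injective (Subtype.ext (funext fun ω => ?_))
    have h1 := hε.add hz ω
    rw [hyε, hwε, Pi.add_apply] at h1
    rw [hyε]
    by_cases hω : ω ∈ basicSet r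
    · rw [Set.indicator_of_mem hω] at h1 ⊢
      rcases hv : (ε z).1 ω with t | ξ
      · rw [hv, fin_add_fin, fin_add_fin] at h1
        have h2 : ((1 : ℕ) : ℝ≥0) + t = (1 : ℕ) + (1 : ℕ) := by injection h1
        rw [add_left_cancel h2]
      · rw [hv] at h1
        cases h1
    · rw [Set.indicator_of_notMem hω] at h1 ⊢
      rwa [zero_add, zero_add] at h1
  rw [hzy] at hz
  have hy0 : y = 0 := he y w hz (algLE_iff.2 (hw.trans (r.apply_le e)))
  obtain ⟨ω', hω'⟩ := exists_mem_basicSet hr0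
  have h1 := congrFun hyε ω'
  rw [hy0, hε.zero, Set.indicator_of_mem hω', zero_eq_fin] at h1
  have h2 : (0 : ℝ≥0) = (1 : ℕ) := by injection h1
  norm_num at h2

/-- Only `0` and `1` are possible, by the previous bound on type I and by hypothesis on type II. The
value `0` would spread to a neighbourhood and kill a nonzero part of `e` inside its support. -/
theorem unit_apply (hε : IsAdmissibleEmbedding E ε) (hE : IsFinitaryUnit E) {e : S} (he : e ∈ E)
    {ω : UltrafilterSpace S} (hω : ω ∈ basicSet (supp e)) : (ε e).1 ω = fin 1 := by
  have hval : ∀ ω ∈ basicSet (supp e), (ε e).1 ω = 0 ∨ (ε e).1 ω = fin 1 := by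
    intro ω hω
    rcases hE.cases he with hmf | hII
    · have h1 := hε.le_one_of_multipleFree hmf ω
      rcases natCast_or_aleph ε e (basicSet_mono (supp_le_projI hmf) hω) with ⟨n, hn⟩ | ⟨ξ, hξ⟩
      · rw [hn, fin_le_fin, Nat.cast_le_one] at h1
        rw [hn]
        interval_cases n
        · left; rw [Nat.cast_zero]; rfl
        · right; rw [Nat.cast_one]
      · rw [hξ] at h1
        exact absurd (fin_lt_aleph _ _) (not_lt.2 h1)
    · exact hε.values e ⟨he, hII⟩ ω
  refine (hval ω hω).resolve_left fun h0 => ?_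
  obtain ⟨q, hq, hq0, -, hsub⟩ := exists_le_basicSet_subset
    ((isOpen_Iio (a := fin (1 : ℝ≥0))).preimage (continuous_scaleFunctions (ε e))) (ω := ω)
    (by rw [Set.mem_preimage, h0]; exact fin_lt_fin.2 one_pos) hω
  have h1 : q e = q 0 := hε.apply_eq fun ω' hω' => by
    rw [hε.zero]
    refine (hval ω' (basicSet_mono hq hω')).resolve_right fun h1 => ?_
    have := hsub hω'
    rw [Set.mem_preimage, h1] at this
    exact lt_irrefl (fin 1 : RInf.{u}) this
  rw [q.map_zero, ← inf_supp_eq_bot_iff, inf_eq_left.2 hq] at h1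
  exact hq0 h1

/-- The `2^n` copies of the part add up to the value `1`; being at most `1`, the value of the part
is not an aleph, so it can be divided out. -/
theorem unitFamily_apply (hε : IsAdmissibleEmbedding E ε) (hE : IsFinitaryUnit E) (e : E) {n : ℕ}
    {ω : UltrafilterSpace S} (hω : ω ∈ basicSet (supp e.1)) (hn : n = 0 ∨ ω ∈ basicSet (projII S)) :
    (ε (unitFamily E n e)).1 ω = fin (2 ^ n)⁻¹ := by
  rcases hn with rfl | hII
  · rw [pow_zero, inv_one]
    exact hε.unit_apply hE e.2 hω
  · have hIIe := (hE.cases e.2).resolve_left fun h =>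
      notMem_I_of_mem_II hII (basicSet_mono (supp_le_projI h) hω)
    have h1 := hε.nsmul (two_pow_nsmul_iterate_half (hE.subset_fin e.2) hIIe.1 n) ω
    have h2 := hε.le (iterate_half_le n e.1) ω
    rw [hε.unit_apply hE e.2 hω] at h1 h2
    rw [unitFamily]
    rcases hv : (ε (half^[n] e.1)).1 ω with t | ξ
    · rw [hv, nsmul_fin] at h1
      have h3 : (1 : ℝ≥0) = (2 ^ n : ℕ) * t := by injection h1
      push_cast at h3
      rw [← eq_inv_of_mul_eq_one_right h3.symm]
    · rw [hv] at h2
      exact absurd (fin_lt_aleph _ _) (not_lt.2 h2)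

theorem le_of_mem_multProj (hε : IsAdmissibleEmbedding E ε) (hE : IsFinitaryUnit E) (e : E)
    {n k : ℕ} {x : S} {ω : UltrafilterSpace S} (hω : ω ∈ basicSet (supp e.1))
    (hn : n = 0 ∨ ω ∈ basicSet (projII S)) (hk : ω ∈ basicSet (multProj (unitFamily E n) k x)) :
    fin ((k : ℝ≥0) * (2 ^ n)⁻¹) ≤ (ε x).1 ω := by
  obtain ⟨z, hz, hzx⟩ := Ext.exists_of_le ((hE.isUnitFamily n).multProj_apply le_rfl e)
  rw [← hε.apply_of_mem x hk]
  refine le_trans ?_ (hε.le hzx ω)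
  rw [hε.nsmul hz, hε.apply_of_mem _ hk, hε.unitFamily_apply hE e hω hn, nsmul_fin]

/-- Division with remainder, in terms of values. -/
theorem exists_remainder (hε : IsAdmissibleEmbedding E ε) (hE : IsFinitaryUnit E) (e : E)
    {n k : ℕ} {x : S} {ω : UltrafilterSpace S} (hω : ω ∈ basicSet (supp e.1))
    (hn : n = 0 ∨ ω ∈ basicSet (projII S)) (hk : ω ∉ basicSet (multProj (unitFamily E n) k x)) :
    ∃ j < k, ∃ r : S, (ε x).1 ω = fin ((j : ℝ≥0) * (2 ^ n)⁻¹) + (ε r).1 ω ∧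
      (ε r).1 ω ≤ fin (2 ^ n)⁻¹ ∧ (MultipleFree e.1 → r = 0) := by
  classical
  have hex : ∃ j, ω ∉ basicSet (multProj (unitFamily E n) j x) := ⟨k, hk⟩
  -- Here `j` is the number of copies that fit at `ω`; the first failing count is positive because
  -- zero copies always fit.
  obtain ⟨j, hj⟩ := Nat.exists_eq_succ_of_ne_zero (n := Nat.find hex) fun h0 => by
    have := Nat.find_spec hex
    rw [h0, multProj_zero] at this
    exact this (mem_basicSet_top ω)
  have h1 : ω ∉ basicSet (multProj (unitFamily E n) (j + 1) x) := by
    have := Nat.find_spec hex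
    rwa [hj] at this
  have h2 : ω ∈ basicSet (multProj (unitFamily E n) j x) := by
    by_contra hcon
    exact absurd (Nat.find_min' hex hcon) (by omega)
  have hjk := Nat.find_min' hex hk
  have hp := mem_basicSet_inf.2 ⟨hω, mem_basicSet_inf.2 ⟨h2, mem_basicSet_compl.2 h1⟩⟩
  set p := supp e.1 ⊓ (multProj (unitFamily E n) j x ⊓ (multProj (unitFamily E n) (j + 1) x)ᶜ)
  have hsupp : p ≤ supp (unitFamily E n e) := by
    rw [unitFamily, supp_iterate_half]
    exact inf_le_left
  obtain ⟨r, hr, hrle, hrlt⟩ := (hE.isUnitFamily n).exists_remainder hsupp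
    (inf_le_right.trans inf_le_left) (inf_le_right.trans inf_le_right)
  refine ⟨j, by omega, r, ?_, ?_, fun he =>
    MultipleFree.remainder_eq_zero (MultipleFree.mono he (iterate_half_le n _)) hrle hrlt⟩
  · obtain ⟨z, -, hz, -⟩ := Ext.exists_of_add_eq hr
    rw [hz] at hr
    rw [← hε.apply_of_mem x hp, ← hε.add hr, hε.nsmul hz, hε.apply_of_mem _ hp,
      hε.unitFamily_apply hE e hω hn, nsmul_fin]
  · rw [← hε.unitFamily_apply hE e hω hn, ← hε.apply_of_mem (unitFamily E n e) hp]
    exact hε.le hrle ω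

theorem le_of_notMem_multProj (hε : IsAdmissibleEmbedding E ε) (hE : IsFinitaryUnit E) (e : E)
    {n k : ℕ} {x : S} {ω : UltrafilterSpace S} (hω : ω ∈ basicSet (supp e.1))
    (hn : n = 0 ∨ ω ∈ basicSet (projII S)) (hk : ω ∉ basicSet (multProj (unitFamily E n) k x)) :
    (ε x).1 ω ≤ fin ((k : ℝ≥0) * (2 ^ n)⁻¹) := by
  obtain ⟨j, hj, r, h1, h2, -⟩ := hε.exists_remainder hE e hω hn hk
  rw [h1]
  rcases hv : (ε r).1 ω with t | ξ <;> rw [hv] at h2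
  · rw [fin_add_fin, fin_le_fin]
    rw [fin_le_fin] at h2
    calc (j * (2 ^ n)⁻¹ + t : ℝ≥0) ≤ j * (2 ^ n)⁻¹ + (2 ^ n)⁻¹ := by gcongr
      _ = ((j + 1 : ℕ) : ℝ≥0) * (2 ^ n)⁻¹ := by push_cast; ring
      _ ≤ k * (2 ^ n)⁻¹ := by gcongr; omega
  · exact absurd (fin_lt_aleph _ _) (not_lt.2 h2)

/-- Whether a multiple of a part of a unit fits into `x` is decided in `S`, independently of the
embedding. On type I this determines an integer value exactly; on type II a dyadic number between
two different values would have to fit and not fit. -/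
theorem le_of_finite (hε : IsAdmissibleEmbedding E ε) (hε' : IsAdmissibleEmbedding E ε')
    (hE : IsFinitaryUnit E) (e : E) {k : ℕ} {x : S} {ω : UltrafilterSpace S}
    (hω : ω ∈ basicSet (supp e.1)) (hk : ω ∉ basicSet (multProj (unitFamily E 0) k x)) :
    (ε x).1 ω ≤ (ε' x).1 ω := by
  rcases hE.cases e.2 with he | he
  · obtain ⟨j, -, r, h1, -, h2⟩ := hε.exists_remainder hE e hω (Or.inl rfl) hk
    obtain ⟨j', -, r', h1', -, h2'⟩ := hε'.exists_remainder hE e hω (Or.inl rfl) hk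
    rw [h2 he, hε.zero, add_zero, pow_zero, inv_one, mul_one] at h1
    rw [h2' he, hε'.zero, add_zero, pow_zero, inv_one, mul_one] at h1'
    rw [h1, h1', fin_le_fin, Nat.cast_le]
    by_contra! hlt
    by_cases hj : ω ∈ basicSet (multProj (unitFamily E 0) j x)
    · have h3 := hε'.le_of_mem_multProj hE e hω (Or.inl rfl) hj
      rw [h1', pow_zero, inv_one, mul_one, fin_le_fin, Nat.cast_le] at h3
      omega
    · obtain ⟨i, hi, s, h4, -, h5⟩ := hε.exists_remainder hE e hω (Or.inl rfl) hj
      rw [h5 he, hε.zero, add_zero, pow_zero, inv_one, mul_one, h1] at h4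
      have h6 : (j : ℝ≥0) = i := by injection h4
      rw [Nat.cast_inj] at h6
      omega
  · have hII : ω ∈ basicSet (projII S) := basicSet_mono (mem_typeII_iff.1 he) hω
    by_contra! hlt
    rcases hv : (ε' x).1 ω with t | ξ
    · rw [hv] at hlt
      obtain ⟨l, n, h1, h2⟩ := exists_dyadic_fin_btwn hlt
      rw [div_eq_mul_inv] at h1 h2
      by_cases hl : ω ∈ basicSet (multProj (unitFamily E n) l x)
      · have h3 := hε'.le_of_mem_multProj hE e hω (Or.inr hII) hl
        rw [hv, fin_le_fin] at h3
        exact absurd h1 (not_lt.2 h3)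
      · exact absurd h2 (not_lt.2 (hε.le_of_notMem_multProj hE e hω (Or.inr hII) hl))
    · have h3 := hε'.le_of_notMem_multProj hE e hω (Or.inl rfl) hk
      rw [hv] at h3
      exact absurd (fin_lt_aleph _ _) (not_lt.2 h3)

/-- It suffices to compare the two at one point of each nonempty `Ω_p`. Such a point is found where
`x` is purely infinite, or where it is directly finite and bounded by multiples of a unit; on the
directly finite part of type III, `x` vanishes. -/
theorem unique (hε : IsAdmissibleEmbedding E ε) (hε' : IsAdmissibleEmbedding E ε')
    (hE : IsFinitaryUnit E) : ε = ε' := by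
  refine funext fun x => Subtype.ext (eq_of_dense_basicSet (continuous_scaleFunctions (ε x)) (continuous_scaleFunctions (ε' x))
    fun p hp => ?_)
  rcases inf_ne_bot_or p (infProj x) with hinf | hfin
  · obtain ⟨ω, hω⟩ := exists_mem_basicSet hinf
    have hω' := basicSet_mono inf_le_right hω
    have hx := purelyInfinite_infProj_apply x
    refine ⟨ω, basicSet_mono inf_le_left hω, ?_⟩
    rw [← hε.apply_of_mem x hω', ← hε'.apply_of_mem x hω']
    exact le_antisymm (hε.le_of_purelyInfinite hε' hx ω) (hε'.le_of_purelyInfinite hε hx ω)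
  have hxf : DirectlyFinite (p x) := le_compl_infProj_iff.1 hfin
  rcases inf_ne_bot_or p (projIII S)ᶜ with hq0 | hIII
  · obtain ⟨e, he⟩ := (hE.isUnitFamily 0).cover _ inf_le_right hq0
    have hle : p ⊓ (projIII S)ᶜ ⊓ supp e.1 ≤ p := inf_le_left.trans inf_le_left
    obtain ⟨k, q, hq, hq0, -, hk⟩ := (hE.isUnitFamily 0).exists_not_le_multProj (a := x)
      (p := p ⊓ (projIII S)ᶜ ⊓ supp e.1)
      (by rw [← Projection.apply_of_le hle]; exact hxf.projection _)
      (inf_le_left.trans inf_le_right) he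
    obtain ⟨ω, hω⟩ := exists_mem_basicSet hq0
    have hωe : ω ∈ basicSet (supp e.1) := basicSet_mono (hq.trans inf_le_right) hω
    have hωk := mem_basicSet_compl.1 (basicSet_mono hk hω)
    exact ⟨ω, basicSet_mono (hq.trans hle) hω, le_antisymm (hε.le_of_finite hε' hE e hωe hωk)
      (hε'.le_of_finite hε hE e hωe hωk)⟩
  · rw [compl_compl, le_projIII_iff] at hIII
    obtain ⟨ω, hω⟩ := exists_mem_basicSet hp
    refine ⟨ω, hω, ?_⟩
    rw [← hε.apply_of_mem x hω, ← hε'.apply_of_mem x hω, hIII x hxf, hε.zero, hε'.zero]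

end IsAdmissibleEmbedding

/-! ### Existence: the scale map is admissible -/

theorem IsFinitaryUnit.le_of_forall_scaleFun_le (hE : IsFinitaryUnit E) {a b : S}
    (h : ∀ ω, scaleFun E a ω ≤ scaleFun E b ω) : a ≤ b := by
  have := hE.le_of_scaleFun_le (p := ⊤) fun ω _ => h ω
  rwa [Projection.top_apply, Projection.top_apply] at this

theorem IsFinitaryUnit.isAdmissibleEmbedding (hE : IsFinitaryUnit E) :
    IsAdmissibleEmbedding E fun a => (⟨scaleFun E a, hE.scaleFun_mem a⟩ : ScaleFunctions S) where
  isLowerEmbedding :=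
    { isHom :=
        { map_zero := Subtype.ext (funext hE.scaleFun_zero)
          map_add := fun a b c h => isSum_scaleFunctions_iff.2 fun ω => (hE.scaleFun_add h ω).symm }
      injective := fun a b h => by
        have h' : scaleFun E a = scaleFun E b := congrArg Subtype.val h
        refine le_antisymm ?_ ?_
        · exact hE.le_of_forall_scaleFun_le fun ω => (congrFun h' ω).le
        · exact hE.le_of_forall_scaleFun_le fun ω => (congrFun h' ω).ge
      le_of_map_le := fun a b ⟨g, hg⟩ => algLE_iff.2 <|
        hE.le_of_forall_scaleFun_le fun ω =>
          (le_add_left' _ _).trans (isSum_scaleFunctions_iff.1 hg ω).le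
      range_lower := fun f a ⟨g, hg⟩ => by
        obtain ⟨x, hx⟩ := hE.exists_scaleFun_eq f.2 (b := a) fun ω =>
          (le_add_left' _ _).trans (isSum_scaleFunctions_iff.1 hg ω).le
        exact ⟨x, Subtype.ext hx⟩ }
  map_projection := hE.scaleFun_projection
  values e he := hE.scaleFun_unit he.1

end Uniqueness

end DimScale

open DimScale in
theorem theoremT {S : Type u} [PartialCommMonoid S] (hS : IsContinuousDimensionScale S)
    (E : Set S) (hE : IsFinitaryUnit E) :
    ∃ ε : S → ScaleFunctions S,
      IsAdmissibleEmbedding E ε ∧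
      (∀ ε' : S → ScaleFunctions S, IsAdmissibleEmbedding E ε' → ε' = ε) ∧
      ∀ e ∈ E, ∀ ω : UltrafilterSpace S,
        (ε e : UltrafilterSpace S → RInf.{u}) ω ∈ ({0, AlephExt.fin 1} : Set RInf.{u}) := by
  have : Fact (IsContinuousDimensionScale S) := ⟨hS⟩
  exact ⟨_, hE.isAdmissibleEmbedding, fun ε' hε' => hε'.unique hE.isAdmissibleEmbedding hE,
    fun e he => hE.scaleFun_unit he⟩
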